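/- Let $K$ be a field and let $G$ be a finite connected simple graph with vertex set $V$, $|V|=n$. Let $S=K[x_i,y_i : i\in V]$ and let $J_G\subset S$ be the binomial edge ideal of $G$, generated by all $x_iy_j-x_jy_i$ with $\{i,j\}$ an edge of $G$. The ideal $J_G$ is called Cohen–Macaulay if $\operatorname{depth} S/J_G=\dim S/J_G$, and almost Cohen–Macaulay if $\operatorname{depth} S/J_G\ge \dim S/J_G-1$, where depth is taken with respect to the graded maximal ideal of $S$ and $\dim$ is Krull dimension. The graph $G$ is called closed if its vertices can be labelled by $1,\dots,n$ so that for all edges $\{i,j\},\{k,l\}$ with $i<j$ and $k<l$: if $i=k$ and $j\ne l$ then $\{j,l\}$ is an edge, and if $j=l$ and $i\neq k$ then $\{i,k\}$ is an edge. A vertex of a graph is free if it belongs to exactly one maximal clique. A connected graph $H$ is decomposable if $H=H_1\cup H_2$ for subgraphs $H_1,H_2$ with at least two vertices each such that $V(H_1)\cap V(H_2)=\{v\}$ with $v$ a free vertex of both $H_1$ and $H_2$; otherwise $H$ is indecomposable. Splitting decomposable subgraphs in this way until all pieces are indecomposable gives the decomposition $G=G_1\cup\dots\cup G_r$ of $G$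 into indecomposable subgraphs. Assume that $G$ is connected and closed and that $J_G$ is not Cohen–Macaulay, and let $G=G_1\cup\dots\cup G_r$ be its decomposition into indecomposable subgraphs. Then $J_G$ is almost Cohen–Macaulay if and only if there is a unique $i\in\{1,\dots,r\}$ such that $G_j$ is a maximal clique of $G$ for all $j\ne i$ and $G_i$ is of one of the following forms: (a) $G_i$ has exactly two maximal cliques, and they intersect in exactly two vertices; (b) with $m=|V(G_i)|$, the vertices of $G_i$ can be labelled by $1,\dots,m$ so that its maximal cliques are exactly $[1,b],\ [b-1,b+1],\ [b,m]$ for some $3\le b\le m-2$; (c) with $m=|V(G_i)|$, the vertices of $G_i$ can be labelled by $1,\dots,m$ so that its maximal cliques are exactly $[1,b],\ [b-1,b+1],\ [b,b+2],\ [b+1,m]$ for some $3\le b\le m-3$. Here $[p,q]=\{p,p+1,\dots,q\}$. -/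

import Mathlib

universe u v

/-! ### Depth, Cohen-Macaulay and almost Cohen-Macaulay modules -/

/-- The depth of a module `M` over the standard graded polynomial ring `K[X_s : s ∈ σ]`: the
supremum of the lengths of the `M`-regular sequences in the graded maximal ideal generated by the
variables. -/
noncomputable def gradedDepth (σ : Type u) (K : Type v) [Field K] (M : Type*) [AddCommGroup M]
    [Module (MvPolynomial σ K) M] : ℕ∞ :=
  ⨆ rs ∈ {rs : List (MvPolynomial σ K) | RingTheory.Sequence.IsRegular M rs ∧
    ∀ r ∈ rs, r ∈ Ideal.span (Set.range (MvPolynomial.X : σ → MvPolynomial σ K))},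
    (rs.length : ℕ∞)

/-- `J` is Cohen-Macaulay: the module `S / J` over the polynomial ring `S` has depth equal to its
Krull dimension. -/
def IsCohenMacaulayIdeal {σ : Type u} {K : Type v} [Field K] (J : Ideal (MvPolynomial σ K)) :
    Prop :=
  (gradedDepth σ K (MvPolynomial σ K ⧸ J) : WithBot ℕ∞) =
    Module.supportDim (MvPolynomial σ K) (MvPolynomial σ K ⧸ J)

/-- `J` is almost Cohen-Macaulay: `depth S / J ≥ dim S / J - 1`. -/
def IsAlmostCohenMacaulayIdeal {σ : Type u} {K : Type v} [Field K]
    (J : Ideal (MvPolynomial σ K)) : Prop :=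
  Module.supportDim (MvPolynomial σ K) (MvPolynomial σ K ⧸ J) ≤
    (gradedDepth σ K (MvPolynomial σ K ⧸ J) : WithBot ℕ∞) + 1

/-! ### Binomial edge ideals -/

/-- The binomial edge ideal `J_G`, generated by `x_i y_j - x_j y_i` over all edges `{i, j}`. The
variable `x_i` is `X (Sum.inl i)` and `y_i` is `X (Sum.inr i)`. Exchanging `i` and `j` only changes
the sign of a generator, so no order on the vertices is needed. -/
noncomputable def binomialEdgeIdeal {V : Type u} (K : Type v) [Field K] (G : SimpleGraph V) :
    Ideal (MvPolynomial (V ⊕ V) K) :=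
  Ideal.span {f | ∃ i j : V, G.Adj i j ∧
    f = MvPolynomial.X (Sum.inl i) * MvPolynomial.X (Sum.inr j) -
      MvPolynomial.X (Sum.inl j) * MvPolynomial.X (Sum.inr i)}

/-! ### Closed graphs -/

/-- `G` is closed: its vertices can be labelled by `1, …, n` so that for all edges `{i, j}` and
`{k, l}` with `i < j` and `k < l`, if `i = k` and `j ≠ l` then `{j, l}` is an edge, and if `j = l`
and `i ≠ k` then `{i, k}` is an edge. -/
def IsClosedGraph {V : Type u} (G : SimpleGraph V) : Prop :=
  ∃ (n : ℕ) (lab : V ≃ Set.Icc 1 n), ∀ i j k l : V,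
    G.Adj i j → G.Adj k l → lab i < lab j → lab k < lab l →
      (i = k → j ≠ l → G.Adj j l) ∧ (j = l → i ≠ k → G.Adj i k)

/-! ### Facets of the clique complex, free vertices -/

/-- The facets of the clique complex of `G`, that is, the maximal cliques of `G`. -/
def cliqueFacets {V : Type u} (G : SimpleGraph V) : Set (Set V) :=
  {F | Maximal G.IsClique F}

/-- The number of maximal cliques of `G` to which `v` belongs. -/
noncomputable def cliqueDegree {V : Type u} (G : SimpleGraph V) (v : V) : ℕ :=
  {F | F ∈ cliqueFacets G ∧ v ∈ F}.ncard

/-- `v` is a free vertex of the subgraph `H`. -/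
def IsFreeVertexOf {V : Type u} {G : SimpleGraph V} (H : G.Subgraph) (v : V) : Prop :=
  ∃ hv : v ∈ H.verts, cliqueDegree H.coe ⟨v, hv⟩ = 1

/-! ### Decomposition into indecomposable subgraphs -/

/-- `H = H₁ ∪ H₂` where `H₁` and `H₂` have exactly one common vertex, which is free in both. Both
have a further vertex: this excludes the trivial splitting of `H` into `H` and a single vertex. -/
def IsGluing {V : Type u} {G : SimpleGraph V} (H H₁ H₂ : G.Subgraph) : Prop :=
  H = H₁ ⊔ H₂ ∧ H₁.verts.Nontrivial ∧ H₂.verts.Nontrivial ∧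
    ∃ v : V, H₁.verts ∩ H₂.verts = {v} ∧ IsFreeVertexOf H₁ v ∧ IsFreeVertexOf H₂ v

/-- A (connected) graph is indecomposable if it is not such a union. -/
def IsIndecomposable {V : Type u} {G : SimpleGraph V} (H : G.Subgraph) : Prop :=
  ¬ ∃ H₁ H₂ : G.Subgraph, IsGluing H H₁ H₂

/-- `IsDecomposition H L`: the list `L = [G₁, …, G_r]` is the decomposition of `H` into
indecomposable subgraphs, obtained by splitting decomposable subgraphs as long as possible. -/
inductive IsDecomposition {V : Type u} {G : SimpleGraph V} :
    G.Subgraph → List G.Subgraph → Prop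
  | single (H : G.Subgraph) (h : IsIndecomposable H) : IsDecomposition H [H]
  | split (H H₁ H₂ : G.Subgraph) (L₁ L₂ : List G.Subgraph) (h : IsGluing H H₁ H₂)
      (h₁ : IsDecomposition H₁ L₁) (h₂ : IsDecomposition H₂ L₂) : IsDecomposition H (L₁ ++ L₂)

/-- Every finite graph has a decomposition into indecomposable subgraphs. -/
theorem exists_isDecomposition {V : Type u} [Finite V] {G : SimpleGraph V} (H : G.Subgraph) :
    ∃ L, IsDecomposition H L := by
  induction hn : H.verts.ncard using Nat.strong_induction_on generalizing H with
  | _ n ih =>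
    subst hn
    by_cases h : IsIndecomposable H
    · exact ⟨[H], .single H h⟩
    · obtain ⟨H₁, H₂, hg⟩ := not_not.mp h
      obtain ⟨he, n₁, n₂, w, hw, -, -⟩ := id hg
      have key : ∀ A B : Set V, A ∩ B = {w} → B.Nontrivial → A.ncard < (A ∪ B).ncard := by
        intro A B hAB hB
        obtain ⟨b, hb, hbw⟩ := hB.exists_ne w
        refine Set.ncard_lt_ncard ⟨Set.subset_union_left, fun hs => hbw ?_⟩ (Set.toFinite _)
        have hm : b ∈ A ∩ B := ⟨hs (Or.inr hb), hb⟩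
        rwa [hAB] at hm
      have hv : H.verts = H₁.verts ∪ H₂.verts := by rw [he]; rfl
      obtain ⟨L₁, d₁⟩ := ih _ (hv ▸ key _ _ hw n₂) H₁ rfl
      obtain ⟨L₂, d₂⟩ := ih _ (by
        rw [hv, Set.union_comm]
        exact key _ _ (by rw [Set.inter_comm]; exact hw) n₁) H₂ rfl
      exact ⟨_, .split H H₁ H₂ L₁ L₂ hg d₁ d₂⟩

/-! ### The exceptional forms -/

/-- The set of vertices whose labels lie in the interval `[a, b]`. -/
def labelInterval {W : Type u} {n : ℕ} (lab : W ≃ Set.Icc 1 n) (a b : ℕ) : Set W :=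
  {w | (lab w : ℕ) ∈ Set.Icc a b}

/-- There are exactly two maximal cliques, and they intersect in two vertices. -/
def HasTwoFacetForm {W : Type u} (H : SimpleGraph W) : Prop :=
  ∃ F₁ F₂ : Set W, F₁ ≠ F₂ ∧ cliqueFacets H = {F₁, F₂} ∧ (F₁ ∩ F₂).ncard = 2

/-- In a suitable labelling the maximal cliques are exactly `[1, b]`, `[b - 1, b + 1]`, `[b, n]`,
where `3 ≤ b ≤ n - 2`. -/
def HasThreeFacetForm {W : Type u} (H : SimpleGraph W) : Prop :=
  ∃ (n : ℕ) (lab : W ≃ Set.Icc 1 n) (b : ℕ), 3 ≤ b ∧ b + 2 ≤ n ∧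
    cliqueFacets H =
      {labelInterval lab 1 b, labelInterval lab (b - 1) (b + 1), labelInterval lab b n}

/-- In a suitable labelling the maximal cliques are exactly `[1, b]`, `[b - 1, b + 1]`,
`[b, b + 2]`, `[b + 1, n]`, where `3 ≤ b ≤ n - 3`. -/
def HasFourFacetForm {W : Type u} (H : SimpleGraph W) : Prop :=
  ∃ (n : ℕ) (lab : W ≃ Set.Icc 1 n) (b : ℕ), 3 ≤ b ∧ b + 3 ≤ n ∧
    cliqueFacets H =
      {labelInterval lab 1 b, labelInterval lab (b - 1) (b + 1), labelInterval lab b (b + 2),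
        labelInterval lab (b + 1) n}

/-- `H` is of one of the three exceptional forms. -/
def HasExceptionalForm {W : Type u} (H : SimpleGraph W) : Prop :=
  HasTwoFacetForm H ∨ HasThreeFacetForm H ∨ HasFourFacetForm H

/-- The subgraph `H` is a maximal clique of `G`: it is the subgraph of `G` induced on the vertex
set of a maximal clique. -/
def IsMaximalCliqueSubgraph {V : Type u} {G : SimpleGraph V} (H : G.Subgraph) : Prop :=
  H.IsInduced ∧ H.verts ∈ cliqueFacets G

/-! ### Depth of cyclic modules through vanishing of Ext. -/

section Depth

open RingTheory.Sequence CategoryTheory CategoryTheory.Abelian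

/-! A closed labelling of a connected graph makes it an interval structure: the later neighbours of
`i` are `i + 1, …, r i` with `r` monotone, so maximal cliques are intervals and the problem is one
about `r`. The dimension of `S / J_G` is `n + 1`, so almost Cohen-Macaulay means depth at least `n`.
The hinge is the numerical condition `IsNarrow`: consecutive maximal cliques share at most two
vertices, the places where they share two ("wide ends") lie within distance two, and wide ends `q`,
`q + 2` are not produced by a clique `[q - 1, q + 2]`.

Narrow implies depth at least `n` (`depthBound_of_isNarrow`). Vertices are removed from left to
right. The variable `y_p` of the first vertex is regular, and modulo it the minors at `p` become
monomials `x_p y_j`. The sequence `S/(I : x_p) → S/I → S/(I, x_p)` then disposes of `x_p`: the colon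
kills the `y_j` of the later neighbours `j` and creates monomials `x_j y_k` beyond them. This keeps
the process inside the family `mixedIdeal`, with the losses recorded by the parameter `e` of
`DepthBound`. With only single overlaps the same process gives depth `n + 1`, so a graph that is not
Cohen-Macaulay has a wide end.

Depth at least `n` implies narrow (`isNarrow_of_hasRegularSeq`). If a class `g` stays nonzero at the
graded maximal ideal and is killed by `Q`, then depth is at most `dim S / Q`
(`HasRegularSeq.le_ringKrullDim`). Minors `f_xy` of nonadjacent vertices, and products of them, are
killed by the variables of the separating vertices by Plücker relations; evaluation at points on the
coordinate axes shows that they are nonzero. This excludes overlaps of three vertices and wide ends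
at distance at least three. A clique `[q - 1, q + 2]` between two wide ends is subtler: the quotient
is first cut by the regular form `x_q - y_{q+1}`, after which `x_q f_xy` is such a class, detected
over the dual numbers.

Combinatorics. A decomposition cuts `[1, n]` exactly at the vertices `c` with `r (c - 1) ≤ c`
(`exists_blocks`). Wide ends are interior to blocks, and blocks without one are maximal cliques. If
`r` is narrow, all wide ends lie in one block, and reading off `r` there gives forms (a), (b), (c).
The converse must handle the unrelated labelling supplied by the form, so it goes through the
label-free pattern `IsDiamond`. -/

/-- There is a regular sequence of length `k` on `R ⧸ I` inside the ideal `m`. -/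
def HasRegularSeq {R : Type u} [CommRing R] (m I : Ideal R) (k : ℕ) : Prop :=
  ∃ rs : List R, rs.length = k ∧ (∀ r ∈ rs, r ∈ m) ∧ IsRegular (R ⧸ I) rs

variable {R : Type u} [CommRing R]

lemma smul_top_quotient_lt_top {m I : Ideal R} (hm : m ≠ ⊤) (hI : I ≤ m) :
    m • (⊤ : Submodule R (R ⧸ I)) < ⊤ := by
  rw [lt_top_iff_ne_top]
  intro h
  apply hm
  have h1 : (Submodule.mkQ I 1) ∈ m • (⊤ : Submodule R (R ⧸ I)) := by rw [h]; trivial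
  have h2 : m • (⊤ : Submodule R (R ⧸ I)) = Submodule.map (Submodule.mkQ I) m := by
    rw [← Submodule.range_mkQ I, ← Submodule.map_top, ← Submodule.map_smul'']
    simp
  rw [h2] at h1
  obtain ⟨a, ha, hae⟩ := h1
  have : a - 1 ∈ I := by
    rw [← Submodule.Quotient.eq I]; exact hae
  rw [Ideal.eq_top_iff_one]
  have := m.sub_mem ha (hI this)
  simpa using this

/-- Rees' theorem. It replaces regular sequences by a condition that passes through long exact
sequences. -/
lemma hasRegularSeq_iff_subsingleton_ext [IsNoetherianRing R] {m I : Ideal R} (hm : m ≠ ⊤)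
    (hI : I ≤ m) (k : ℕ) :
    HasRegularSeq m I k ↔ ∀ i < k, Subsingleton
      (Ext (ModuleCat.of R (Shrink.{u} (R ⧸ m))) (ModuleCat.of R (R ⧸ I)) i) := by
  have := ModuleCat.exists_isRegular_tfae m k (ModuleCat.of R (R ⧸ I))
    (smul_top_quotient_lt_top hm hI)
  exact (this.out 1 3).symm

/-- The sequence `R / N → R / I → R / (I + x)`, the first map being multiplication by `x`. -/
def colonShortComplex (I N : Ideal R) (x : R) (hN : ∀ f, x * f ∈ I ↔ f ∈ N) :
    ShortComplex (ModuleCat.{u} R) :=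
  ShortComplex.mk (X₁ := ModuleCat.of R (R ⧸ N)) (X₂ := ModuleCat.of R (R ⧸ I))
    (X₃ := ModuleCat.of R (R ⧸ (I ⊔ Ideal.span {x})))
    (ModuleCat.ofHom (Submodule.mapQ N I (LinearMap.lsmul R R x) (fun f hf => by
      simpa using (hN f).2 hf)))
    (ModuleCat.ofHom (Submodule.mapQ I (I ⊔ Ideal.span {x}) LinearMap.id (fun f hf =>
      Ideal.mem_sup_left hf)))
    (by
      apply ModuleCat.hom_ext
      refine LinearMap.ext fun f => ?_
      obtain ⟨f, rfl⟩ := Submodule.mkQ_surjective N f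
      change Submodule.Quotient.mk (x * f) = 0
      rw [Submodule.Quotient.mk_eq_zero]
      exact Ideal.mem_sup_right (Ideal.mul_mem_right _ _ (Ideal.mem_span_singleton_self x)))

lemma colonShortComplex_shortExact (I N : Ideal R) (x : R) (hN : ∀ f, x * f ∈ I ↔ f ∈ N) :
    (colonShortComplex I N x hN).ShortExact where
  exact := by
    rw [ShortComplex.ShortExact.moduleCat_exact_iff_function_exact]
    intro f
    obtain ⟨f, rfl⟩ := Submodule.mkQ_surjective I f
    constructor
    · intro h
      change Submodule.Quotient.mk f = 0 at h
      rw [Submodule.Quotient.mk_eq_zero] at h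
      obtain ⟨a, ha, b, hb, rfl⟩ := Submodule.mem_sup.1 h
      obtain ⟨c, rfl⟩ := Ideal.mem_span_singleton'.1 hb
      refine ⟨Submodule.Quotient.mk c, ?_⟩
      change Submodule.Quotient.mk (x * c) = Submodule.Quotient.mk _
      rw [Submodule.Quotient.eq]
      have : x * c - (a + c * x) = - a := by ring
      rw [this]
      exact I.neg_mem ha
    · rintro ⟨g, hg⟩
      obtain ⟨g, rfl⟩ := Submodule.mkQ_surjective N g
      change Submodule.Quotient.mk (x * g) = Submodule.Quotient.mk _ at hg
      rw [Submodule.Quotient.eq] at hg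
      change Submodule.Quotient.mk f = 0
      rw [Submodule.Quotient.mk_eq_zero]
      have : f = x * g - (x * g - f) := by ring
      rw [this]
      exact Ideal.sub_mem _ (Ideal.mem_sup_right (Ideal.mul_mem_right _ _
        (Ideal.mem_span_singleton_self x))) (Ideal.mem_sup_left hg)
  mono_f := by
    rw [ModuleCat.mono_iff_injective]
    rw [injective_iff_map_eq_zero]
    intro f hf
    obtain ⟨f, rfl⟩ := Submodule.mkQ_surjective N f
    change Submodule.Quotient.mk (x * f) = 0 at hf
    rw [Submodule.Quotient.mk_eq_zero] at hf
    change Submodule.Quotient.mk f = 0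
    rw [Submodule.Quotient.mk_eq_zero]
    exact (hN f).1 hf
  epi_g := by
    rw [ModuleCat.epi_iff_surjective]
    intro f
    obtain ⟨f, rfl⟩ := Submodule.mkQ_surjective _ f
    exact ⟨Submodule.Quotient.mk f, rfl⟩

/-- Depth lemma: in the long exact sequence, the Ext group of `R / I` is squeezed between those of
`R / N` and `R / (I + x)`, where `N = I : x`. -/
lemma HasRegularSeq.of_colon [IsNoetherianRing R] {m I N : Ideal R} (hm : m ≠ ⊤) (hIm : I ≤ m)
    (hNm : N ≤ m) {x : R} (hx : x ∈ m) (hN : ∀ f, x * f ∈ I ↔ f ∈ N) {k : ℕ}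
    (h₁ : HasRegularSeq m N k) (h₂ : HasRegularSeq m (I ⊔ Ideal.span {x}) k) :
    HasRegularSeq m I k := by
  have hC : I ⊔ Ideal.span {x} ≤ m := sup_le hIm ((Ideal.span_singleton_le_iff_mem _).2 hx)
  rw [hasRegularSeq_iff_subsingleton_ext hm hNm] at h₁
  rw [hasRegularSeq_iff_subsingleton_ext hm hC] at h₂
  rw [hasRegularSeq_iff_subsingleton_ext hm hIm]
  intro i hi
  have zero1 := AddCommGrpCat.isZero_of_iff_subsingleton.mpr (h₁ i hi)
  have zero2 := AddCommGrpCat.isZero_of_iff_subsingleton.mpr (h₂ i hi)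
  exact AddCommGrpCat.subsingleton_of_isZero <| ShortComplex.Exact.isZero_of_both_zeros
        (Ext.covariant_sequence_exact₂' _ (colonShortComplex_shortExact I N x hN) i)
        (zero1.eq_zero_of_src _) (zero2.eq_zero_of_tgt _)

lemma HasRegularSeq.zero {m I : Ideal R} (hm : m ≠ ⊤) (hI : I ≤ m) : HasRegularSeq m I 0 := by
  have : Nontrivial (R ⧸ I) := Ideal.Quotient.nontrivial_iff.2
    (fun h => hm (top_le_iff.1 (h ▸ hI)))
  exact ⟨[], rfl, by simp, IsRegular.nil _ _⟩

lemma HasRegularSeq.mono [IsNoetherianRing R] {m I : Ideal R} (hm : m ≠ ⊤) (hI : I ≤ m) {k l : ℕ}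
    (hkl : k ≤ l) (h : HasRegularSeq m I l) : HasRegularSeq m I k := by
  rw [hasRegularSeq_iff_subsingleton_ext hm hI] at h ⊢
  exact fun i hi => h i (by omega)

/-- `y` is a nonzerodivisor modulo the ideal `I`. -/
def RegularMod (I : Ideal R) (y : R) : Prop := ∀ f, y * f ∈ I → f ∈ I

lemma RegularMod.isSMulRegular {I : Ideal R} {y : R} (h : RegularMod I y) :
    IsSMulRegular (R ⧸ I) y := by
  rw [isSMulRegular_quotient_iff_mem_of_smul_mem]
  exact fun f hf => h f hf

/-- `(R / I) / y (R / I)` is `R / (I + y)`. -/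
noncomputable def quotSMulTopQuotientEquiv (I : Ideal R) (y : R) :
    QuotSMulTop y (R ⧸ I) ≃ₗ[R] R ⧸ (I ⊔ Ideal.span {y}) :=
  (Submodule.quotEquivOfEq _ _ (by
    rw [← Submodule.ideal_span_singleton_smul, ← Submodule.range_mkQ I, ← Submodule.map_top,
      ← Submodule.map_smul'', Submodule.map_sup]
    simp)).trans
    (Submodule.quotientQuotientEquivQuotient I (I ⊔ Ideal.span {y}) le_sup_left)

lemma hasRegularSeq_quotSMulTop {m I : Ideal R} {y : R} {k : ℕ} :
    HasRegularSeq m (I ⊔ Ideal.span {y}) k ↔ ∃ rs : List R, rs.length = k ∧ (∀ r ∈ rs, r ∈ m) ∧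
      IsRegular (QuotSMulTop y (R ⧸ I)) rs := by
  unfold HasRegularSeq
  simp only [(quotSMulTopQuotientEquiv I y).isRegular_congr]

lemma HasRegularSeq.succ_of_regularMod {m I : Ideal R} {y : R} (hy : y ∈ m) (hreg : RegularMod I y)
    {k : ℕ} (h : HasRegularSeq m (I ⊔ Ideal.span {y}) k) : HasRegularSeq m I (k + 1) := by
  obtain ⟨rs, hlen, hmem, hrs⟩ := hasRegularSeq_quotSMulTop.1 h
  exact ⟨y :: rs, by simp [hlen], by simpa using ⟨hy, hmem⟩, .cons hreg.isSMulRegular hrs⟩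

/-- Since `I : y = I`, the Ext group of `R / (I + y)` in degree `i` lies between those of `R / I` in
degrees `i` and `i + 1`. So any regular element may be taken as the first of a maximal sequence. -/
lemma HasRegularSeq.quotient_of_regularMod [IsNoetherianRing R] {m I : Ideal R} (hm : m ≠ ⊤)
    (hI : I ≤ m) {y : R} (hy : y ∈ m) (hreg : RegularMod I y)
    {k : ℕ} (h : HasRegularSeq m I (k + 1)) : HasRegularSeq m (I ⊔ Ideal.span {y}) k := by
  have hC : I ⊔ Ideal.span {y} ≤ m := sup_le hI ((Ideal.span_singleton_le_iff_mem _).2 hy)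
  have hN : ∀ f, y * f ∈ I ↔ f ∈ I := fun f => ⟨hreg f, fun h => I.mul_mem_left _ h⟩
  rw [hasRegularSeq_iff_subsingleton_ext hm hI] at h
  rw [hasRegularSeq_iff_subsingleton_ext hm hC]
  intro i hi
  have zero1 := AddCommGrpCat.isZero_of_iff_subsingleton.mpr (h i (by omega))
  have zero2 := AddCommGrpCat.isZero_of_iff_subsingleton.mpr (h (i + 1) (by omega))
  exact AddCommGrpCat.subsingleton_of_isZero <| ShortComplex.Exact.isZero_of_both_zeros
        (Ext.covariant_sequence_exact₃' _ (colonShortComplex_shortExact I I y hN) i (i + 1) rfl)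
        (zero1.eq_zero_of_src _) (zero2.eq_zero_of_tgt _)

end Depth

/-! ### Depth is bounded by the dimension of the support of any nonzero element. -/

section DepthLeDim

open RingTheory.Sequence
open scoped Pointwise

/-- Variant of "depth is at most `dim R / P` for associated primes `P`" that needs no prime:
dividing by `f` replaces `u` by an element killed by both `Ann u` and `f`, and `f` is regular modulo
`Ann u`, so the dimension drops by one along with the length. -/
lemma length_le_ringKrullDim_quotient_annihilator {R : Type*} [CommRing R] [IsNoetherianRing R]
    [IsLocalRing R] (rs : List R) : ∀ {M : Type u} [AddCommGroup M] [Module R M]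
    [Module.Finite R M], IsRegular M rs → (∀ r ∈ rs, r ∈ IsLocalRing.maximalIdeal R) →
    ∀ u : M, u ≠ 0 →
    ((rs.length : ℕ) : WithBot ℕ∞) ≤ ringKrullDim (R ⧸ (Submodule.span R {u}).annihilator) := by
  induction rs with
  | nil =>
    intro M _ _ _ _ _ u hu
    have : Nontrivial (R ⧸ (Submodule.span R {u}).annihilator) := by
      rw [Ideal.Quotient.nontrivial_iff]
      intro h
      apply hu
      have h1 : (1 : R) ∈ (Submodule.span R {u}).annihilator := by rw [h]; trivial
      rw [Submodule.mem_annihilator_span_singleton] at h1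
      simpa using h1
    simpa using ringKrullDim_nonneg_of_nontrivial
  | cons f rs ih =>
    intro M _ _ _ hreg hmem u hu
    rw [isRegular_cons_iff] at hreg
    obtain ⟨hf, hreg⟩ := hreg
    have hfm : f ∈ IsLocalRing.maximalIdeal R := hmem f (by simp)
    set a := (Submodule.span R {u}).annihilator with ha
    -- The elements killed by `a = Ann u`; one of them outside `f M` survives in `M / f M`.
    let U : Submodule R M :=
      { carrier := {w | ∀ r ∈ a, r • w = 0}
        add_mem' := fun {x y} hx hy r hr => by rw [smul_add, hx r hr, hy r hr, add_zero]
        zero_mem' := fun r _ => smul_zero r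
        smul_mem' := fun c x hx r hr => by rw [smul_comm, hx r hr, smul_zero] }
    have huU : u ∈ U := fun r hr => by
      rwa [ha, Submodule.mem_annihilator_span_singleton] at hr
    have : ∃ w ∈ U, w ∉ f • (⊤ : Submodule R M) := by
      by_contra! hcon
      -- If `f w'` is killed by `a`, then so is `w'`, because `f` is regular on `M`. Hence `U ⊆ f M`
      -- would force `U = f U`, and Nakayama gives `U = 0`.
      have h1 : U ≤ Ideal.span {f} • U := by
        intro w hw
        obtain ⟨w', -, rfl⟩ := (Submodule.mem_smul_pointwise_iff_exists _ _ _).1 (hcon w hw)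
        rw [Submodule.ideal_span_singleton_smul]
        apply Submodule.smul_mem_pointwise_smul
        intro r hr
        have := hw r hr
        rw [smul_comm] at this
        exact hf (by simpa using this)
      have h2 : U = ⊥ := Submodule.eq_bot_of_le_smul_of_le_jacobson_bot (Ideal.span {f}) U
        (IsNoetherian.noetherian U) h1 (by
          rw [Ideal.span_singleton_le_iff_mem, IsLocalRing.jacobson_eq_maximalIdeal _ bot_ne_top]
          exact hfm)
      rw [h2] at huU
      exact hu (by simpa using huU)
    obtain ⟨w, hwU, hw⟩ := this
    have hw0 : (Submodule.Quotient.mk w : QuotSMulTop f M) ≠ 0 := by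
      rwa [Ne, Submodule.Quotient.mk_eq_zero]
    have key := ih hreg (fun r hr => hmem r (by simp [hr])) _ hw0
    have hsub : a ⊔ Ideal.span {f} ≤
        (Submodule.span R {(Submodule.Quotient.mk w : QuotSMulTop f M)}).annihilator := by
      apply sup_le
      · intro r hr
        rw [Submodule.mem_annihilator_span_singleton, ← Submodule.Quotient.mk_smul, hwU r hr]
        rfl
      · rw [Ideal.span_singleton_le_iff_mem, Submodule.mem_annihilator_span_singleton,
          ← Submodule.Quotient.mk_smul, Submodule.Quotient.mk_eq_zero]
        exact Submodule.smul_mem_pointwise_smul _ _ _ trivial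
    have hle := ringKrullDim_le_of_surjective (Ideal.Quotient.factor hsub)
      (Ideal.Quotient.factor_surjective hsub)
    -- `R / a` embeds in `M` as the submodule generated by `u`, so it inherits regularity of `f`.
    have hfa : IsSMulRegular (R ⧸ a) f := by
      rw [isSMulRegular_quotient_iff_mem_of_smul_mem]
      intro r hr
      rw [ha, Submodule.mem_annihilator_span_singleton] at hr ⊢
      rw [smul_eq_mul, mul_smul] at hr
      exact hf (by simpa using hr)
    have hdim := Module.supportDim_quotSMulTop_succ_eq_supportDim hfa hfm
    rw [Module.supportDim_eq_of_equiv (quotSMulTopQuotientEquiv a f),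
      Module.supportDim_quotient_eq_ringKrullDim, Module.supportDim_quotient_eq_ringKrullDim]
      at hdim
    rw [← hdim]
    simp only [List.length_cons, Nat.cast_add, Nat.cast_one]
    gcongr
    exact key.trans hle

lemma ringKrullDim_quotient_le_of_comap {S R : Type*} [CommRing S] [CommRing R] [Algebra S R]
    (M : Submonoid S) [IsLocalization M R] (Q : Ideal S) (A : Ideal R)
    (h : Q ≤ A.comap (algebraMap S R)) : ringKrullDim (R ⧸ A) ≤ ringKrullDim (S ⧸ Q) := by
  rw [ringKrullDim_quotient, ringKrullDim_quotient]
  let F : PrimeSpectrum.zeroLocus (R := R) A → PrimeSpectrum.zeroLocus (R := S) Q := fun P =>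
    ⟨PrimeSpectrum.comap (algebraMap S R) P.1, fun x hx => P.2 (h hx)⟩
  refine Order.krullDim_le_of_strictMono F ?_
  have hmono : Monotone F := fun P P' hPP' => Ideal.comap_mono (f := algebraMap S R) hPP'
  have hinj : Function.Injective F := fun P P' hPP' => by
    apply Subtype.ext
    exact PrimeSpectrum.localization_comap_injective R M (congrArg Subtype.val hPP')
  exact hmono.strictMono_of_injective hinj

/-- If a nonzero element of `S / J`, even after localizing at `m`, is annihilated by `Q`, then the
length of a regular sequence in `m` is at most the dimension of `S / Q`. -/
lemma HasRegularSeq.le_ringKrullDim {S : Type u} [CommRing S] [IsNoetherianRing S] {m J Q : Ideal S}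
    [hm : m.IsPrime] {k : ℕ} (h : HasRegularSeq m J k) {g : S}
    (hg : ∀ s, s ∉ m → s * g ∉ J) (hQ : ∀ q ∈ Q, q * g ∈ J) :
    (k : WithBot ℕ∞) ≤ ringKrullDim (S ⧸ Q) := by
  obtain ⟨rs, rfl, hmem, hrs⟩ := h
  let M := LocalizedModule m.primeCompl (S ⧸ J)
  let φ : (S ⧸ J) →ₗ[S] M := LocalizedModule.mkLinearMap m.primeCompl (S ⧸ J)
  let R := Localization.AtPrime m
  let u : M := φ (Submodule.Quotient.mk g)
  have hu : u ≠ 0 := by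
    intro h0
    rw [IsLocalizedModule.eq_zero_iff m.primeCompl φ] at h0
    obtain ⟨c, hc⟩ := h0
    have : (Submodule.Quotient.mk ((c : S) * g) : S ⧸ J) = 0 := hc
    rw [Submodule.Quotient.mk_eq_zero] at this
    exact hg c c.2 this
  have : Nontrivial M := ⟨u, 0, hu⟩
  have hfin : Module.Finite R M :=
    Module.Finite.of_isLocalizedModule m.primeCompl (Rₚ := R) φ
  have hreg : IsRegular M (rs.map (algebraMap S R)) :=
    hrs.toIsWeaklyRegular.isRegular_of_isLocalizedModule_of_mem R m φ hmem
  have key := length_le_ringKrullDim_quotient_annihilator _ hreg (by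
    intro r hr
    obtain ⟨s, hs, rfl⟩ := List.mem_map.1 hr
    exact (IsLocalization.AtPrime.to_map_mem_maximal_iff R m s).2 (hmem s hs)) u hu
  rw [List.length_map] at key
  refine key.trans (ringKrullDim_quotient_le_of_comap m.primeCompl Q _ ?_)
  intro q hq
  rw [Ideal.mem_comap, Submodule.mem_annihilator_span_singleton, algebraMap_smul]
  change q • φ _ = 0
  rw [← map_smul, ← Submodule.Quotient.mk_smul, smul_eq_mul]
  rw [(Submodule.Quotient.mk_eq_zero J).2 (hQ q hq), map_zero]

end DepthLeDim

/-! ### Dimension bounds from homogeneous systems of linear forms. -/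

section GradedDim

open MvPolynomial

variable {σ : Type u} {K : Type v} [Field K]

lemma homogeneousComponent_mul_of_isHomogeneous (a g : MvPolynomial σ K) {e : ℕ}
    (hg : g.IsHomogeneous e) (d : ℕ) :
    homogeneousComponent d (a * g) =
      if e ≤ d then homogeneousComponent (d - e) a * g else 0 := by
  have h : ∀ b : MvPolynomial σ K, ∀ i, b.IsHomogeneous i →
      homogeneousComponent d (b * g) =
        if e ≤ d then homogeneousComponent (d - e) b * g else 0 := by
    intro b i hb
    rw [homogeneousComponent_of_mem (hb.mul hg), homogeneousComponent_of_mem hb]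
    split_ifs <;> first | rfl | (exfalso; omega)
  conv_lhs => rw [← sum_homogeneousComponent a]
  rw [Finset.sum_mul, map_sum,
    Finset.sum_congr rfl fun i _ => h _ i (homogeneousComponent_isHomogeneous i a)]
  split_ifs
  · rw [← Finset.sum_mul, ← map_sum, sum_homogeneousComponent]
  · simp

/-- The ideal contains the homogeneous components of its elements. -/
def ComponentClosed (Q : Ideal (MvPolynomial σ K)) : Prop :=
  ∀ f ∈ Q, ∀ d, homogeneousComponent d f ∈ Q

lemma componentClosed_span (s : Set (MvPolynomial σ K)) (hs : ∀ g ∈ s, ∃ e, g.IsHomogeneous e) :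
    ComponentClosed (Ideal.span s) := by
  intro f hf
  induction hf using Submodule.span_induction with
  | mem g hg =>
    intro d
    obtain ⟨e, he⟩ := hs g hg
    rw [homogeneousComponent_of_mem he]
    split_ifs
    · exact Ideal.subset_span hg
    · exact zero_mem _
  | zero => intro d; simp
  | add f g _ _ hf hg => intro d; rw [map_add]; exact add_mem (hf d) (hg d)
  | smul a g _ hg =>
    intro d
    rw [smul_eq_mul, ← sum_homogeneousComponent a, Finset.sum_mul, map_sum]
    refine sum_mem fun i _ => ?_
    rw [mul_comm, homogeneousComponent_mul_of_isHomogeneous _ _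
      (homogeneousComponent_isHomogeneous i a)]
    split_ifs
    · exact Ideal.mul_mem_right _ _ (hg _)
    · exact zero_mem _

/-- Incomparability: strict chains of primes contract to strict chains. -/
lemma ringKrullDim_le_of_isIntegral {A B : Type*} [CommRing A] [CommRing B] [Algebra A B]
    [Algebra.IsIntegral A B] : ringKrullDim B ≤ ringKrullDim A := by
  refine Order.krullDim_le_of_strictMono (PrimeSpectrum.comap (algebraMap A B)) ?_
  intro P P' h
  exact Ideal.IsIntegral.comap_lt_comap (R := A) (I := P.asIdeal) (J := P'.asIdeal) h

/-- If linear forms `θ` generate, together with the homogeneous ideal `Q`, an ideal whose only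
prime above is the graded maximal ideal, then `S / Q` has dimension at most the number of forms. -/
lemma ringKrullDim_le_card_of_surjective [Finite σ] {ι : Type*} [Finite ι] {B : Type*} [CommRing B]
    (π : MvPolynomial σ K →+* B) (hπ : Function.Surjective π)
    (Q : Ideal (MvPolynomial σ K)) (hQ : ComponentClosed Q) (hπQ : ∀ q ∈ Q, π q = 0)
    (θ : ι → MvPolynomial σ K) (hθ : ∀ i, (θ i).IsHomogeneous 1)
    (hP : ∀ P : Ideal (MvPolynomial σ K), P.IsPrime → Q ≤ P → (∀ i, θ i ∈ P) →
      ∀ s, X s ∈ P) :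
    ringKrullDim B ≤ (Nat.card ι : WithBot ℕ∞) := by
  classical
  have := Fintype.ofFinite ι
  -- The hypothesis on primes puts all variables in the radical, and there are finitely many of
  -- them.
  obtain ⟨N, hN⟩ : ∃ N, idealOfVars σ K ^ N ≤ Q ⊔ Ideal.span (Set.range θ) := by
    apply Ideal.exists_pow_le_of_le_radical_of_fg
    · rw [Ideal.radical_eq_sInf]
      refine le_sInf fun P ⟨hQP, hPp⟩ => ?_
      refine Ideal.span_le.2 ?_
      rintro _ ⟨s, rfl⟩
      exact hP P hPp (le_sup_left.trans hQP)
        (fun i => hQP (Ideal.mem_sup_right (Ideal.subset_span (Set.mem_range_self i)))) s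
    · exact idealOfVars_fg _ _
  have hdeg : ∀ {F : MvPolynomial σ K} {d : ℕ}, F.IsHomogeneous d → ∀ e ∈ F.support,
      e.degree = d := by
    intro F d hF e he
    rw [Finsupp.degree_eq_weight_one]
    exact hF (mem_support_iff.1 he)
  let φ : MvPolynomial ι K →+* B := π.comp (aeval θ).toRingHom
  let _ : Algebra (MvPolynomial ι K) B := φ.toAlgebra
  let T : Set B := (fun d => π (monomial d (1 : K))) '' {d : σ →₀ ℕ | d.degree ≤ N}
  have hT : T.Finite := (Finsupp.finite_of_degree_le N).image _
  have hsmul : ∀ (p : MvPolynomial ι K) (f : MvPolynomial σ K), p • (π f) =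
      π (aeval θ p * f) := fun p f => by
    rw [Algebra.smul_def, map_mul]; rfl
  let W : Submodule (MvPolynomial ι K) B := Submodule.span _ T
  -- Graded Nakayama: a form of degree above `N` is, modulo `Q`, a combination of the `θ i` with
  -- coefficients of smaller degree. Thus monomials of degree at most `N` generate `B` over the
  -- polynomial ring in the `θ i`.
  have key : ∀ d : ℕ, ∀ F : MvPolynomial σ K, F.IsHomogeneous d → π F ∈ W := by
    intro d
    induction d using Nat.strong_induction_on with
    | _ d ih =>
      intro F hF
      by_cases hd : d ≤ N
      · rw [F.as_sum, map_sum]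
        refine sum_mem fun e he => ?_
        have h1 : monomial e (coeff e F) = aeval θ (C (coeff e F) : MvPolynomial ι K) *
            monomial e (1 : K) := by
          rw [algHom_C, algebraMap_eq, C_mul_monomial, mul_one]
        rw [h1, ← hsmul]
        refine Submodule.smul_mem _ _ (Submodule.subset_span ⟨e, ?_, rfl⟩)
        exact (hdeg hF e he).trans_le hd
      · have hFm : F ∈ Q ⊔ Ideal.span (Set.range θ) := by
          apply hN
          rw [mem_pow_idealOfVars_iff]
          intro e he
          have := hdeg hF e he
          omega
        obtain ⟨q, hq, t, ht, rfl⟩ := Submodule.mem_sup.1 hFm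
        obtain ⟨c, rfl⟩ := (Ideal.mem_span_range_iff_exists_fun).1 ht
        rw [← homogeneousComponent_eq_self hF, map_add, map_add,
          hπQ _ (hQ q hq d), zero_add, map_sum, map_sum]
        refine sum_mem fun i _ => ?_
        rw [homogeneousComponent_mul_of_isHomogeneous _ _ (hθ i), if_pos (by omega)]
        have h1 := hsmul (X i) (homogeneousComponent (d - 1) (c i))
        rw [aeval_X, mul_comm] at h1
        rw [← h1]
        exact Submodule.smul_mem _ _
          (ih (d - 1) (by omega) _ (homogeneousComponent_isHomogeneous _ _))
  have hW : W = ⊤ := by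
    rw [eq_top_iff]
    rintro f -
    obtain ⟨f, rfl⟩ := hπ f
    rw [← sum_homogeneousComponent f, map_sum]
    exact sum_mem fun i _ => key i _ (homogeneousComponent_isHomogeneous _ _)
  have hfin : Module.Finite (MvPolynomial ι K) B :=
    ⟨⟨hT.toFinset, by rw [hT.coe_toFinset]; exact hW⟩⟩
  refine (ringKrullDim_le_of_isIntegral (A := MvPolynomial ι K)).trans ?_
  rw [MvPolynomial.ringKrullDim_of_isNoetherianRing, ringKrullDim_eq_zero_of_field, zero_add]

end GradedDim

/-! ### Division by a variable modulo generators that do not involve it. -/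

section FreeOf

open MvPolynomial

variable {σ : Type u} {K : Type v} [Field K]

/-- The polynomials not involving the variable `X s`. -/
noncomputable def freeOf (K : Type v) [Field K] (s : σ) : Subalgebra K (MvPolynomial σ K) :=
  supported K {s}ᶜ

lemma X_mem_freeOf {s t : σ} (h : t ≠ s) : (X t : MvPolynomial σ K) ∈ freeOf K s :=
  X_mem_supported.2 h

lemma mem_freeOf_iff {s : σ} {f : MvPolynomial σ K} :
    f ∈ freeOf K s ↔ ∀ n ∈ f.support, n s = 0 := by
  rw [freeOf, mem_supported]
  constructor
  · intro h n hn
    by_contra hne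
    exact h ((mem_vars_iff_mem_support s).2 ⟨n, hn, Finsupp.mem_support_iff.2 hne⟩) rfl
  · intro h t ht hts
    obtain ⟨n, hn, hnt⟩ := (mem_vars_iff_mem_support t).1 ht
    rw [Set.mem_singleton_iff] at hts
    subst hts
    exact Finsupp.mem_support_iff.1 hnt (h n hn)

lemma modMonomial_mem_freeOf (s : σ) (f : MvPolynomial σ K) :
    f.modMonomial (Finsupp.single s 1) ∈ freeOf K s := by
  rw [mem_freeOf_iff]
  intro n hn
  by_contra hne
  apply mem_support_iff.1 hn
  apply coeff_modMonomial_of_le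
  rw [Finsupp.single_le_iff]
  omega

/-- Uniqueness of quotient and remainder on division by `X s` makes both linear over the polynomials
without `X s`. -/
lemma divMonomial_modMonomial_mul {s : σ} {g : MvPolynomial σ K} (hg : g ∈ freeOf K s)
    (f : MvPolynomial σ K) :
    (g * f).divMonomial (Finsupp.single s 1) = g * f.divMonomial (Finsupp.single s 1) ∧
      (g * f).modMonomial (Finsupp.single s 1) = g * f.modMonomial (Finsupp.single s 1) := by
  have h : g * f = X s * (g * f.divMonomial (Finsupp.single s 1)) +
      g * f.modMonomial (Finsupp.single s 1) := by
    conv_lhs => rw [← divMonomial_add_modMonomial_single f s]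
    ring
  have hr := mem_freeOf_iff.1 ((freeOf K s).mul_mem hg (modMonomial_mem_freeOf s f))
  exact ⟨(eq_divMonomial_single h hr).symm, (eq_modMonomial_single h hr).symm⟩

lemma modMonomial_of_mem_freeOf {s : σ} {g : MvPolynomial σ K} (hg : g ∈ freeOf K s) :
    g.modMonomial (Finsupp.single s 1) = g :=
  (eq_modMonomial_single (q := 0) (by simp) (mem_freeOf_iff.1 hg)).symm

lemma divMonomial_mem_span {s : σ} {t : Set (MvPolynomial σ K)} (ht : t ⊆ freeOf K s)
    {f : MvPolynomial σ K} (hf : f ∈ Ideal.span t) :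
    f.divMonomial (Finsupp.single s 1) ∈ Ideal.span t := by
  induction hf using Submodule.closure_induction with
  | zero => simp
  | add f g _ _ hf hg => rw [add_divMonomial]; exact add_mem hf hg
  | smul_mem r g hg =>
    rw [smul_eq_mul, mul_comm, (divMonomial_modMonomial_mul (ht hg) r).1]
    exact Ideal.mul_mem_right _ _ (Ideal.subset_span hg)

lemma regularMod_X_of_subset_freeOf {s : σ} {t : Set (MvPolynomial σ K)} (ht : t ⊆ freeOf K s) :
    RegularMod (Ideal.span t) (X s) := by
  intro f hf
  have := divMonomial_mem_span ht hf
  rwa [X_mul_divMonomial] at this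

/-- Removing the part of `X s * f` in `X s * (t')` leaves a multiple of `X s` in `(t)`, where `X s`
can be cancelled. This computes every colon ideal used later. -/
lemma X_mul_mem_span_iff {s : σ} {t t' : Set (MvPolynomial σ K)} (ht : t ⊆ freeOf K s)
    (f : MvPolynomial σ K) :
    X s * f ∈ Ideal.span (t ∪ (X s * ·) '' t') ↔ f ∈ Ideal.span (t ∪ t') := by
  constructor
  · intro hf
    have himg : Ideal.span ((X s * ·) '' t') = Ideal.span {(X s : MvPolynomial σ K)} *
        Ideal.span t' := by
      rw [Ideal.span_mul_span', Set.singleton_mul]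
    rw [Ideal.span_union, himg] at hf
    obtain ⟨a, ha, b, hb, hab⟩ := Submodule.mem_sup.1 hf
    obtain ⟨c, hc, rfl⟩ := Ideal.mem_span_singleton_mul.1 hb
    have : f - c ∈ Ideal.span t := by
      apply regularMod_X_of_subset_freeOf ht
      have : X s * (f - c) = a := by rw [mul_sub, ← hab]; ring
      rwa [this]
    rw [Ideal.span_union, ← sub_add_cancel f c]
    exact add_mem (Ideal.mem_sup_left this) (Ideal.mem_sup_right hc)
  · intro hf
    induction hf using Submodule.closure_induction with
    | zero => simp
    | add f g _ _ hf hg => rw [mul_add]; exact add_mem hf hg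
    | smul_mem r g hg =>
      rw [smul_eq_mul, mul_left_comm]
      apply Ideal.mul_mem_left
      rcases hg with hg | hg
      · exact Ideal.mul_mem_left _ _ (Ideal.subset_span (Or.inl hg))
      · exact Ideal.subset_span (Or.inr ⟨g, hg, rfl⟩)

end FreeOf

/-! ### The family of ideals that is closed under removing vertices. -/

section MixedIdeal

open MvPolynomial

variable {V : Type u} (K : Type v) [Field K] (G : SimpleGraph V)

/-- The minor `x_i y_j - x_j y_i`. -/
noncomputable def edgeMinor (i j : V) : MvPolynomial (V ⊕ V) K :=
  X (Sum.inl i) * X (Sum.inr j) - X (Sum.inl j) * X (Sum.inr i)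

/-- The ideal generated by the variables in `Z`, the monomials `x_i y_j` over the edges from `A` to
`U`, and the minors over the edges inside `U`. -/
noncomputable def mixedIdeal (Z : Set (V ⊕ V)) (A U : Set V) : Ideal (MvPolynomial (V ⊕ V) K) :=
  Ideal.span (X '' Z ∪ {f | ∃ i ∈ A, ∃ j ∈ U, G.Adj i j ∧ f = X (Sum.inl i) * X (Sum.inr j)} ∪
    {f | ∃ i ∈ U, ∃ j ∈ U, G.Adj i j ∧ f = edgeMinor K i j})

variable {K G}

lemma X_mem_mixedIdeal {Z : Set (V ⊕ V)} {A U : Set V} {z : V ⊕ V} (hz : z ∈ Z) :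
    X z ∈ mixedIdeal K G Z A U :=
  Ideal.subset_span (Or.inl (Or.inl ⟨z, hz, rfl⟩))

lemma mul_mem_mixedIdeal {Z : Set (V ⊕ V)} {A U : Set V} {i j : V} (hi : i ∈ A) (hj : j ∈ U)
    (h : G.Adj i j) : X (Sum.inl i) * X (Sum.inr j) ∈ mixedIdeal K G Z A U :=
  Ideal.subset_span (Or.inl (Or.inr ⟨i, hi, j, hj, h, rfl⟩))

lemma edgeMinor_mem_mixedIdeal {Z : Set (V ⊕ V)} {A U : Set V} {i j : V} (hi : i ∈ U) (hj : j ∈ U)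
    (h : G.Adj i j) : edgeMinor K i j ∈ mixedIdeal K G Z A U :=
  Ideal.subset_span (Or.inr ⟨i, hi, j, hj, h, rfl⟩)

lemma mixedIdeal_le {Z : Set (V ⊕ V)} {A U : Set V} {I : Ideal (MvPolynomial (V ⊕ V) K)}
    (hZ : ∀ z ∈ Z, X z ∈ I)
    (hA : ∀ i ∈ A, ∀ j ∈ U, G.Adj i j → X (Sum.inl i) * X (Sum.inr j) ∈ I)
    (hU : ∀ i ∈ U, ∀ j ∈ U, G.Adj i j → edgeMinor K i j ∈ I) : mixedIdeal K G Z A U ≤ I := by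
  refine Ideal.span_le.2 ?_
  rintro f ((⟨z, hz, rfl⟩ | ⟨i, hi, j, hj, h, rfl⟩) | ⟨i, hi, j, hj, h, rfl⟩)
  exacts [hZ z hz, hA i hi j hj h, hU i hi j hj h]

lemma binomialEdgeIdeal_eq_mixedIdeal :
    binomialEdgeIdeal K G = mixedIdeal K G ∅ ∅ Set.univ := by
  apply le_antisymm
  · refine Ideal.span_le.2 ?_
    rintro f ⟨i, j, h, rfl⟩
    exact edgeMinor_mem_mixedIdeal trivial trivial h
  · exact mixedIdeal_le (by simp) (by simp) fun i _ j _ h => Ideal.subset_span ⟨i, j, h, rfl⟩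

lemma edgeMinor_isHomogeneous (i j : V) : (edgeMinor K i j).IsHomogeneous 2 :=
  ((isHomogeneous_X _ _).mul (isHomogeneous_X _ _)).sub
    ((isHomogeneous_X _ _).mul (isHomogeneous_X _ _))

lemma mixedIdeal_componentClosed (Z : Set (V ⊕ V)) (A U : Set V) :
    ComponentClosed (mixedIdeal K G Z A U) := by
  apply componentClosed_span
  rintro f ((⟨z, hz, rfl⟩ | ⟨i, hi, j, hj, h, rfl⟩) | ⟨i, hi, j, hj, h, rfl⟩)
  exacts [⟨1, isHomogeneous_X _ _⟩, ⟨2, (isHomogeneous_X _ _).mul (isHomogeneous_X _ _)⟩,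
    ⟨2, edgeMinor_isHomogeneous i j⟩]

lemma edgeMinor_mem_freeOf {s : V ⊕ V} {i j : V} (h₁ : Sum.inl i ≠ s) (h₂ : Sum.inl j ≠ s)
    (h₃ : Sum.inr i ≠ s) (h₄ : Sum.inr j ≠ s) : edgeMinor K i j ∈ freeOf K s :=
  sub_mem (mul_mem (X_mem_freeOf h₁) (X_mem_freeOf h₄))
    (mul_mem (X_mem_freeOf h₂) (X_mem_freeOf h₃))

lemma regularMod_mixedIdeal_X {Z : Set (V ⊕ V)} {A U : Set V} {s : V ⊕ V} (hZ : s ∉ Z)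
    (hA : ∀ i ∈ A, ∀ j ∈ U, G.Adj i j → Sum.inl i ≠ s ∧ Sum.inr j ≠ s)
    (hU : ∀ i ∈ U, ∀ j ∈ U, G.Adj i j → Sum.inl i ≠ s ∧ Sum.inr i ≠ s) :
    RegularMod (mixedIdeal K G Z A U) (X s) := by
  apply regularMod_X_of_subset_freeOf
  rintro f ((⟨z, hz, rfl⟩ | ⟨i, hi, j, hj, h, rfl⟩) | ⟨i, hi, j, hj, h, rfl⟩)
  · exact X_mem_freeOf (fun hzs => hZ (hzs ▸ hz))
  · exact mul_mem (X_mem_freeOf (hA i hi j hj h).1) (X_mem_freeOf (hA i hi j hj h).2)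
  · exact edgeMinor_mem_freeOf (hU i hi j hj h).1 (hU j hj i hi h.symm).1 (hU i hi j hj h).2
      (hU j hj i hi h.symm).2

/-- The colon ideal of a mixed ideal by `x_i`, for `i ∈ A`. -/
lemma X_mul_mem_mixedIdeal_iff {Z : Set (V ⊕ V)} {A U : Set V} {i : V} (hi : i ∈ A)
    (hiU : i ∉ U) (hiZ : Sum.inl i ∉ Z) (f : MvPolynomial (V ⊕ V) K) :
    X (Sum.inl i) * f ∈ mixedIdeal K G Z A U ↔
      f ∈ mixedIdeal K G (Z ∪ Sum.inr '' (U ∩ G.neighborSet i))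
        ((A \ {i}) ∪ (U ∩ G.neighborSet i)) (U \ G.neighborSet i) := by
  let s : Set (MvPolynomial (V ⊕ V) K) := X '' Z ∪
    {f | ∃ a ∈ A \ {i}, ∃ j ∈ U, G.Adj a j ∧ f = X (Sum.inl a) * X (Sum.inr j)} ∪
    {f | ∃ i ∈ U, ∃ j ∈ U, G.Adj i j ∧ f = edgeMinor K i j}
  let t : Set (MvPolynomial (V ⊕ V) K) := {f | ∃ j ∈ U, G.Adj i j ∧ f = X (Sum.inr j)}
  have hs : s ⊆ freeOf K (Sum.inl i : V ⊕ V) := by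
    rintro f ((⟨z, hz, rfl⟩ | ⟨a, ha, j, hj, h, rfl⟩) | ⟨a, ha, j, hj, h, rfl⟩)
    · exact X_mem_freeOf (fun hzs => hiZ (hzs ▸ hz))
    · exact mul_mem (X_mem_freeOf (by simpa using ha.2)) (X_mem_freeOf (by simp))
    · have ha' : a ≠ i := fun e => hiU (e ▸ ha)
      have hj' : j ≠ i := fun e => hiU (e ▸ hj)
      exact edgeMinor_mem_freeOf (by simpa using ha') (by simpa using hj') (by simp) (by simp)
  have h1 : mixedIdeal K G Z A U = Ideal.span (s ∪ (X (Sum.inl i) * ·) '' t) := by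
    apply le_antisymm
    · apply mixedIdeal_le
      · exact fun z hz => Ideal.subset_span (Or.inl (Or.inl (Or.inl ⟨z, hz, rfl⟩)))
      · intro a ha j hj h
        by_cases hai : a = i
        · subst hai
          exact Ideal.subset_span (Or.inr ⟨_, ⟨j, hj, h, rfl⟩, rfl⟩)
        · exact Ideal.subset_span (Or.inl (Or.inl (Or.inr ⟨a, ⟨ha, hai⟩, j, hj, h, rfl⟩)))
      · exact fun a ha j hj h => Ideal.subset_span (Or.inl (Or.inr ⟨a, ha, j, hj, h, rfl⟩))
    · refine Ideal.span_le.2 ?_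
      rintro f (((⟨z, hz, rfl⟩ | ⟨a, ha, j, hj, h, rfl⟩) | ⟨a, ha, j, hj, h, rfl⟩) |
        ⟨_, ⟨j, hj, h, rfl⟩, rfl⟩)
      · exact X_mem_mixedIdeal hz
      · exact mul_mem_mixedIdeal ha.1 hj h
      · exact edgeMinor_mem_mixedIdeal ha hj h
      · exact mul_mem_mixedIdeal hi hj h
  have h2 : mixedIdeal K G (Z ∪ Sum.inr '' (U ∩ G.neighborSet i))
      ((A \ {i}) ∪ (U ∩ G.neighborSet i)) (U \ G.neighborSet i) = Ideal.span (s ∪ t) := by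
    apply le_antisymm
    · have hy : ∀ j ∈ U, G.Adj i j → X (Sum.inr j) ∈ Ideal.span (s ∪ t) := fun j hj h =>
        Ideal.subset_span (Or.inr ⟨j, hj, h, rfl⟩)
      apply mixedIdeal_le
      · rintro z (hz | ⟨j, ⟨hj, h⟩, rfl⟩)
        · exact Ideal.subset_span (Or.inl (Or.inl (Or.inl ⟨z, hz, rfl⟩)))
        · exact hy j hj h
      · rintro a (ha | ⟨haU, ha⟩) j ⟨hj, hjn⟩ h
        · exact Ideal.subset_span (Or.inl (Or.inl (Or.inr ⟨a, ha, j, hj, h, rfl⟩)))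
        · have h3 : edgeMinor K a j ∈ Ideal.span (s ∪ t) :=
            Ideal.subset_span (Or.inl (Or.inr ⟨a, haU, j, hj, h, rfl⟩))
          have h4 := add_mem h3 (Ideal.mul_mem_left _ (X (Sum.inl j)) (hy a haU ha))
          simpa [edgeMinor] using h4
      · rintro a ⟨ha, -⟩ j ⟨hj, -⟩ h
        exact Ideal.subset_span (Or.inl (Or.inr ⟨a, ha, j, hj, h, rfl⟩))
    · set I := mixedIdeal K G (Z ∪ Sum.inr '' (U ∩ G.neighborSet i))
        ((A \ {i}) ∪ (U ∩ G.neighborSet i)) (U \ G.neighborSet i)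
      have hy : ∀ j ∈ U, G.Adj i j → X (Sum.inr j) ∈ I := fun j hj h =>
        X_mem_mixedIdeal (Or.inr ⟨j, ⟨hj, h⟩, rfl⟩)
      have hxy : ∀ a ∈ U, ∀ j ∈ U, G.Adj a j → G.Adj i a → X (Sum.inl a) * X (Sum.inr j) ∈ I := by
        intro a ha j hj haj hia
        by_cases hij : G.Adj i j
        · exact Ideal.mul_mem_left _ _ (hy j hj hij)
        · exact mul_mem_mixedIdeal (Or.inr ⟨ha, hia⟩) ⟨hj, hij⟩ haj
      refine Ideal.span_le.2 ?_
      rintro f (((⟨z, hz, rfl⟩ | ⟨a, ha, j, hj, h, rfl⟩) | ⟨a, ha, j, hj, h, rfl⟩) |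
        ⟨j, hj, h, rfl⟩)
      · exact X_mem_mixedIdeal (Or.inl hz)
      · by_cases hij : G.Adj i j
        · exact Ideal.mul_mem_left _ _ (hy j hj hij)
        · exact mul_mem_mixedIdeal (Or.inl ha) ⟨hj, hij⟩ h
      · by_cases hia : G.Adj i a
        · exact sub_mem (hxy a ha j hj h hia) (Ideal.mul_mem_left _ _ (hy a ha hia))
        · by_cases hij : G.Adj i j
          · exact sub_mem (Ideal.mul_mem_left _ _ (hy j hj hij)) (hxy j hj a ha h.symm hij)
          · exact edgeMinor_mem_mixedIdeal ⟨ha, hia⟩ ⟨hj, hij⟩ h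
      · exact hy j hj h
  rw [h1, h2]
  exact X_mul_mem_span_iff hs f

lemma mixedIdeal_sup_span_X {Z : Set (V ⊕ V)} {A U : Set V} {i : V} :
    mixedIdeal K G Z A U ⊔ Ideal.span {X (Sum.inl i)} =
      mixedIdeal K G (insert (Sum.inl i) Z) (A \ {i}) U := by
  apply le_antisymm
  · apply sup_le
    · apply mixedIdeal_le
      · exact fun z hz => X_mem_mixedIdeal (Or.inr hz)
      · intro a ha j hj h
        by_cases hai : a = i
        · subst hai
          exact Ideal.mul_mem_right _ _ (X_mem_mixedIdeal (Or.inl rfl))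
        · exact mul_mem_mixedIdeal ⟨ha, hai⟩ hj h
      · exact fun a ha j hj h => edgeMinor_mem_mixedIdeal ha hj h
    · rw [Ideal.span_singleton_le_iff_mem]
      exact X_mem_mixedIdeal (Or.inl rfl)
  · apply mixedIdeal_le
    · rintro z (rfl | hz)
      · exact Ideal.mem_sup_right (Ideal.mem_span_singleton_self _)
      · exact Ideal.mem_sup_left (X_mem_mixedIdeal hz)
    · exact fun a ha j hj h => Ideal.mem_sup_left (mul_mem_mixedIdeal ha.1 hj h)
    · exact fun a ha j hj h => Ideal.mem_sup_left (edgeMinor_mem_mixedIdeal ha hj h)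

/-- Modulo `y_p` the minor of an edge `{p, j}` is `x_p y_j`, so `p` moves from the minor part to the
monomial part. -/
lemma mixedIdeal_empty_sup_span_X {Z : Set (V ⊕ V)} {U : Set V} {p : V} (hp : p ∈ U) :
    mixedIdeal K G Z ∅ U ⊔ Ideal.span {X (Sum.inr p)} =
      mixedIdeal K G (insert (Sum.inr p) Z) {p} (U \ {p}) := by
  apply le_antisymm
  · have hy : X (Sum.inr p) ∈ mixedIdeal K G (insert (Sum.inr p) Z) {p} (U \ {p}) :=
      X_mem_mixedIdeal (Or.inl rfl)
    apply sup_le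
    · apply mixedIdeal_le
      · exact fun z hz => X_mem_mixedIdeal (Or.inr hz)
      · simp
      · intro a ha j hj h
        by_cases hap : a = p
        · subst hap
          exact sub_mem (mul_mem_mixedIdeal rfl ⟨hj, h.ne'⟩ h) (Ideal.mul_mem_left _ _ hy)
        · by_cases hjp : j = p
          · subst hjp
            exact sub_mem (Ideal.mul_mem_left _ _ hy) (mul_mem_mixedIdeal rfl ⟨ha, h.ne⟩ h.symm)
          · exact edgeMinor_mem_mixedIdeal ⟨ha, hap⟩ ⟨hj, hjp⟩ h
    · rwa [Ideal.span_singleton_le_iff_mem]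
  · have hy : X (Sum.inr p) ∈ mixedIdeal K G Z ∅ U ⊔ Ideal.span {X (Sum.inr p)} :=
      Ideal.mem_sup_right (Ideal.mem_span_singleton_self _)
    apply mixedIdeal_le
    · rintro z (rfl | hz)
      · exact hy
      · exact Ideal.mem_sup_left (X_mem_mixedIdeal hz)
    · rintro a rfl j hj h
      have h3 : edgeMinor K a j ∈ mixedIdeal K G Z ∅ U ⊔ Ideal.span {X (Sum.inr a)} :=
        Ideal.mem_sup_left (edgeMinor_mem_mixedIdeal hp hj.1 h)
      have h4 := add_mem h3 (Ideal.mul_mem_left _ (X (Sum.inl j)) hy)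
      simpa [edgeMinor] using h4
    · exact fun a ha j hj h => Ideal.mem_sup_left (edgeMinor_mem_mixedIdeal ha.1 hj.1 h)

/-- `y_p` is regular modulo the minors on `U` when the neighbours of `p` form a clique containing
some `q` for which `y_q` is regular modulo the minors on `U \ {p}`. -/
lemma regularMod_mixedIdeal_empty [Finite V] {Z : Set (V ⊕ V)} {U : Set V} {p q : V} (hp : p ∈ U)
    (hpZ : Sum.inl p ∉ Z) (hpZ' : Sum.inr p ∉ Z) (hq : q ∈ U) (hpq : G.Adj p q)
    (hN : ∀ j ∈ U, G.Adj p j → j ≠ q → G.Adj q j)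
    (hreg : RegularMod (mixedIdeal K G Z ∅ (U \ {p})) (X (Sum.inr q))) :
    RegularMod (mixedIdeal K G Z ∅ U) (X (Sum.inr p)) := by
  classical
  have := Fintype.ofFinite V
  intro F hF
  set s : Set (MvPolynomial (V ⊕ V) K) := X '' Z ∪ {f | ∃ i ∈ (∅ : Set V), ∃ j ∈ U \ {p},
    G.Adj i j ∧ f = X (Sum.inl i) * X (Sum.inr j)} ∪
    {f | ∃ i ∈ U \ {p}, ∃ j ∈ U \ {p}, G.Adj i j ∧ f = edgeMinor K i j} with hs
  have hJ' : mixedIdeal K G Z ∅ (U \ {p}) = Ideal.span s := rfl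
  have hfree : ∀ v : V ⊕ V, (v = Sum.inl p ∨ v = Sum.inr p) → s ⊆ freeOf K v := by
    rintro v hv f ((⟨z, hz, rfl⟩ | ⟨a, ha, j, hj, h, rfl⟩) | ⟨a, ha, j, hj, h, rfl⟩)
    · refine X_mem_freeOf ?_
      rintro rfl
      rcases hv with rfl | rfl
      exacts [hpZ hz, hpZ' hz]
    · exact ha.elim
    · have ha' : a ≠ p := ha.2
      have hj' : j ≠ p := hj.2
      rcases hv with rfl | rfl <;> apply edgeMinor_mem_freeOf <;> simp [ha', hj']
  let N := {j : V // j ∈ U ∧ G.Adj p j}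
  have hJ : mixedIdeal K G Z ∅ U ≤ Ideal.span s ⊔
      Ideal.span (Set.range fun j : N => edgeMinor K p j) := by
    have hneg : ∀ i j : V, edgeMinor K i j = - edgeMinor K j i := fun i j => by
      simp only [edgeMinor]; ring
    apply mixedIdeal_le
    · exact fun z hz => Ideal.mem_sup_left (Ideal.subset_span (Or.inl (Or.inl ⟨z, hz, rfl⟩)))
    · simp
    · intro a ha j hj h
      by_cases hap : a = p
      · subst hap
        exact Ideal.mem_sup_right (Ideal.subset_span ⟨⟨j, hj, h⟩, rfl⟩)
      · by_cases hjp : j = p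
        · subst hjp
          rw [hneg]
          exact neg_mem (Ideal.mem_sup_right (Ideal.subset_span ⟨⟨a, ha, h.symm⟩, rfl⟩))
        · exact Ideal.mem_sup_left (Ideal.subset_span (Or.inr ⟨a, ⟨ha, hap⟩, j, ⟨hj, hjp⟩, h, rfl⟩))
  -- Write `y_p F` as an element `H` of the ideal `(s)` without `p`, plus a combination of the
  -- minors at `p`. Splitting `H` and each coefficient into its multiple `y * δ` and its `y`-free
  -- part `μ` separates the powers of `y = y_p`.
  obtain ⟨H, hH, T, hT, hHT⟩ := Submodule.mem_sup.1 (hJ hF)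
  obtain ⟨c, rfl⟩ := Ideal.mem_span_range_iff_exists_fun.1 hT
  set y : MvPolynomial (V ⊕ V) K := X (Sum.inr p) with hy
  set x : MvPolynomial (V ⊕ V) K := X (Sum.inl p) with hx
  let δ : MvPolynomial (V ⊕ V) K → MvPolynomial (V ⊕ V) K := fun f =>
    f.divMonomial (Finsupp.single (Sum.inr p) 1)
  let μ : MvPolynomial (V ⊕ V) K → MvPolynomial (V ⊕ V) K := fun f =>
    f.modMonomial (Finsupp.single (Sum.inr p) 1)
  have hδμ : ∀ f, f = y * δ f + μ f := fun f => (divMonomial_add_modMonomial_single f _).symm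
  have hμ : ∀ f, μ f ∈ freeOf K (Sum.inr p) := fun f => modMonomial_mem_freeOf _ f
  have hδH : δ H ∈ Ideal.span s := divMonomial_mem_span (hfree _ (Or.inr rfl)) hH
  have hμH : μ H ∈ Ideal.span s := by
    have := sub_mem hH (Ideal.mul_mem_left _ y hδH)
    have h0 : μ H = H - y * δ H := by linear_combination - hδμ H
    rwa [h0]
  set B := ∑ j : N, X (Sum.inr j.1) * μ (c j) with hB
  set D := ∑ j : N, X (Sum.inl j.1) * μ (c j) with hD
  set E := ∑ j : N, edgeMinor K p j * δ (c j) with hE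
  have hsum : ∑ j : N, c j * edgeMinor K p j = y * E + x * B - y * D := by
    rw [hB, hD, hE, Finset.mul_sum, Finset.mul_sum, Finset.mul_sum, ← Finset.sum_add_distrib,
      ← Finset.sum_sub_distrib]
    refine Finset.sum_congr rfl fun j _ => ?_
    conv_lhs => rw [hδμ (c j)]
    simp only [edgeMinor]
    ring
  have h1 : y * (F - E - δ H + D) = μ H + x * B := by
    have h2 : y * F = H + (y * E + x * B - y * D) := by rw [← hHT, hsum]
    have h3 := hδμ H
    linear_combination h2 + h3
  have h2 : μ H + x * B ∈ freeOf K (Sum.inr p) := by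
    refine add_mem (hμ _) (mul_mem (X_mem_freeOf (by simp)) (sum_mem fun j _ => ?_))
    exact mul_mem (X_mem_freeOf (by simpa using j.2.2.ne')) (hμ _)
  -- A `y`-free polynomial divisible by `y` is zero.
  have h3 : μ H + x * B = 0 := by
    rw [← modMonomial_of_mem_freeOf h2, ← h1, hy, X_mul_modMonomial]
  have hBs : B ∈ Ideal.span s := by
    apply regularMod_X_of_subset_freeOf (hfree _ (Or.inl rfl))
    have : x * B = - μ H := by linear_combination h3
    rw [← hx, this]
    exact neg_mem hμH
  have hDs : D ∈ Ideal.span s := by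
    rw [← hJ'] at hBs ⊢
    apply hreg
    -- Here `q` is used: trading `y_q x_j` for `x_q y_j` costs the minors `{q, j}`, which lie in the
    -- smaller ideal because `q` is adjacent to the other neighbours of `p`. So `B ∈ (s)` gives `y_q
    -- D ∈ (s)`, and `y_q` is regular.
    have h4 : X (Sum.inr q) * D = X (Sum.inl q) * B -
        ∑ j : N, edgeMinor K q j * μ (c j) := by
      rw [hD, hB, Finset.mul_sum, Finset.mul_sum, ← Finset.sum_sub_distrib]
      refine Finset.sum_congr rfl fun j _ => ?_
      simp only [edgeMinor]
      ring
    rw [h4]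
    refine sub_mem (Ideal.mul_mem_left _ _ hBs) (sum_mem fun j _ => ?_)
    by_cases hjq : j.1 = q
    · rw [hjq]
      simp [edgeMinor]
    · exact Ideal.mul_mem_right _ _ (edgeMinor_mem_mixedIdeal ⟨hq, hpq.ne'⟩
        ⟨j.2.1, j.2.2.ne'⟩ (hN j j.2.1 j.2.2 hjq))
  have h4 : F = E + δ H - D := by
    have hy0 : y ≠ 0 := X_ne_zero _
    have : y * (F - E - δ H + D) = y * 0 := by rw [h1, h3, mul_zero]
    have := mul_left_cancel₀ hy0 this
    linear_combination this
  have hle : Ideal.span s ≤ mixedIdeal K G Z ∅ U := by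
    rw [← hJ']
    exact mixedIdeal_le (fun z hz => X_mem_mixedIdeal hz) (by simp)
      fun a ha j hj h => edgeMinor_mem_mixedIdeal ha.1 hj.1 h
  rw [h4]
  refine sub_mem (add_mem (sum_mem fun j _ => ?_) (hle hδH)) (hle hDs)
  exact Ideal.mul_mem_right _ _ (edgeMinor_mem_mixedIdeal hp j.2.1 j.2.2)

end MixedIdeal

/-! ### Bookkeeping of depth for mixed ideals. -/

section DepthBound

open MvPolynomial

lemma idealOfVars_ne_top (σ : Type u) (K : Type v) [Field K] : idealOfVars σ K ≠ ⊤ := by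
  intro h
  have h1 : (C (1 : K) : MvPolynomial σ K) ∈ idealOfVars σ K ^ 1 := by rw [pow_one, h]; trivial
  rw [C_mem_pow_idealOfVars_iff] at h1
  simp at h1

lemma mem_idealOfVars_iff {σ : Type u} {K : Type v} [Field K] (f : MvPolynomial σ K) :
    f ∈ idealOfVars σ K ↔ constantCoeff f = 0 := by
  have := mem_pow_idealOfVars_iff' (R := K) 1 f
  rw [pow_one] at this
  rw [this, constantCoeff_eq]
  constructor
  · exact fun h => h 0 (by simp)
  · intro h x hx
    rw [Nat.lt_one_iff, Finsupp.degree_eq_zero_iff] at hx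
    rw [hx, h]

instance idealOfVars_isPrime (σ : Type u) (K : Type v) [Field K] : (idealOfVars σ K).IsPrime where
  ne_top' := idealOfVars_ne_top σ K
  mem_or_mem' := by
    intro f g
    simp only [mem_idealOfVars_iff, map_mul, mul_eq_zero, imp_self]

variable {V : Type u} {K : Type v} [Field K] {G : SimpleGraph V}

lemma X_mem_idealOfVars {σ : Type u} (K : Type v) [Field K] (s : σ) :
    (X s : MvPolynomial σ K) ∈ idealOfVars σ K := by
  simp [mem_idealOfVars_iff]

lemma mixedIdeal_le_idealOfVars (Z : Set (V ⊕ V)) (A U : Set V) :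
    mixedIdeal K G Z A U ≤ idealOfVars (V ⊕ V) K :=
  mixedIdeal_le (fun _ _ => X_mem_idealOfVars K _)
    (fun _ _ _ _ _ => Ideal.mul_mem_left _ _ (X_mem_idealOfVars K _))
    (fun _ _ _ _ _ => sub_mem (Ideal.mul_mem_left _ _ (X_mem_idealOfVars K _))
      (Ideal.mul_mem_left _ _ (X_mem_idealOfVars K _)))

variable (K G) in
/-- For all admissible sets `Z` of variables, the mixed ideal has depth at least
`2 |V| - |Z| - |U| + e - 1`. -/
def DepthBound (A U : Set V) (e : ℕ) : Prop :=
  ∀ (Z : Set (V ⊕ V)) (k : ℕ), (∀ u ∈ U, Sum.inl u ∉ Z ∧ Sum.inr u ∉ Z) →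
    (∀ a ∈ A, Sum.inl a ∉ Z) → k + Z.ncard + U.ncard + 1 ≤ 2 * Nat.card V + e →
    HasRegularSeq (idealOfVars (V ⊕ V) K) (mixedIdeal K G Z A U) k

lemma DepthBound.mono {A U : Set V} {e e' : ℕ} (h : DepthBound K G A U e') (he : e ≤ e') :
    DepthBound K G A U e := fun Z k h₁ h₂ h₃ => h Z k h₁ h₂ (by omega)

/-- Vertices of `A` without neighbours in `U` contribute no generators, so only the others matter.
-/
lemma DepthBound.of_subset {A A' U : Set V} {e : ℕ} (h : DepthBound K G A' U e) (hA : A' ⊆ A)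
    (hN : ∀ a ∈ A, a ∉ A' → ∀ u ∈ U, ¬ G.Adj a u) : DepthBound K G A U e := by
  intro Z k h₁ h₂ h₃
  have : mixedIdeal K G Z A U = mixedIdeal K G Z A' U := by
    apply le_antisymm
    · refine mixedIdeal_le (fun z hz => X_mem_mixedIdeal hz) (fun i hi j hj hij => ?_)
        (fun i hi j hj hij => edgeMinor_mem_mixedIdeal hi hj hij)
      by_cases hiA : i ∈ A'
      · exact mul_mem_mixedIdeal hiA hj hij
      · exact (hN i hi hiA j hj hij).elim
    · exact mixedIdeal_le (fun z hz => X_mem_mixedIdeal hz)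
        (fun i hi j hj hij => mul_mem_mixedIdeal (hA hi) hj hij)
        (fun i hi j hj hij => edgeMinor_mem_mixedIdeal hi hj hij)
  rw [this]
  exact h Z k h₁ (fun a ha => h₂ a (hA ha)) h₃

/-- With `U` empty the quotient is a polynomial ring in `2 |V| - |Z|` variables; this is the
normalisation `e = 1`. -/
lemma depthBound_empty [Finite V] (A : Set V) : DepthBound K G A ∅ 1 := by
  rintro Z k - - h
  rw [Set.ncard_empty] at h
  induction k generalizing Z with
  | zero => exact .zero (idealOfVars_ne_top _ _) (mixedIdeal_le_idealOfVars _ _ _)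
  | succ k ih =>
    obtain ⟨s, hs⟩ : ∃ s, s ∉ Z := by
      by_contra! hcon
      rw [Set.eq_univ_of_forall hcon, Set.ncard_univ, Nat.card_sum] at h
      simp at h
      omega
    have hsup : mixedIdeal K G Z A ∅ ⊔ Ideal.span {X s} = mixedIdeal K G (insert s Z) A ∅ := by
      apply le_antisymm
      · exact sup_le (mixedIdeal_le (fun z hz => X_mem_mixedIdeal (Or.inr hz)) (by simp) (by simp))
          ((Ideal.span_singleton_le_iff_mem _).2 (X_mem_mixedIdeal (Or.inl rfl)))
      · refine mixedIdeal_le ?_ (by simp) (by simp)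
        rintro z (rfl | hz)
        · exact Ideal.mem_sup_right (Ideal.mem_span_singleton_self _)
        · exact Ideal.mem_sup_left (X_mem_mixedIdeal hz)
    refine HasRegularSeq.succ_of_regularMod (y := X s) (X_mem_idealOfVars K s)
      (regularMod_mixedIdeal_X hs (by simp) (by simp)) ?_
    rw [hsup]
    have := Set.ncard_insert_le s Z
    exact ih _ (by omega)

/-- Adding `x_i` enlarges `Z` by one while `U` is unchanged, which requires `e + 1`. The colon adds
to `Z` as many `y_j` as `U` loses vertices, so `e` stays the same there. -/
lemma DepthBound.of_colon [Finite V] {A U : Set V} {e : ℕ} {i : V} (hi : i ∈ A) (hiU : i ∉ U)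
    (h₁ : DepthBound K G (A \ {i}) U (e + 1))
    (h₂ : DepthBound K G ((A \ {i}) ∪ (U ∩ G.neighborSet i)) (U \ G.neighborSet i) e) :
    DepthBound K G A U e := by
  intro Z k hU hA hk
  have hiZ := hA i hi
  refine HasRegularSeq.of_colon (idealOfVars_ne_top _ _) (mixedIdeal_le_idealOfVars _ _ _)
    (mixedIdeal_le_idealOfVars _ _ _) (X_mem_idealOfVars K (Sum.inl i))
    (X_mul_mem_mixedIdeal_iff hi hiU hiZ) ?_ ?_
  · apply h₂
    · rintro u ⟨hu, hun⟩
      refine ⟨?_, ?_⟩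
      · rintro (h | ⟨_, _, h⟩)
        · exact (hU u hu).1 h
        · cases h
      · rintro (h | ⟨w, hw, h⟩)
        · exact (hU u hu).2 h
        · cases h
          exact hun hw.2
    · rintro a ha (h | ⟨_, _, h⟩)
      · rcases ha with ha | ha
        · exact hA a ha.1 h
        · exact (hU a ha.1).1 h
      · cases h
    · have h3 := Set.ncard_union_le Z (Sum.inr '' (U ∩ G.neighborSet i))
      have h4 := Set.ncard_image_le (f := (Sum.inr : V → V ⊕ V))
        (Set.toFinite (U ∩ G.neighborSet i))
      have h5 := Set.ncard_inter_add_ncard_sdiff_eq_ncard U (G.neighborSet i)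
      omega
  · rw [mixedIdeal_sup_span_X]
    apply h₁
    · intro u hu
      refine ⟨?_, ?_⟩
      · rintro (h | h)
        · cases h
          exact hiU hu
        · exact (hU u hu).1 h
      · rintro (h | h)
        · cases h
        · exact (hU u hu).2 h
    · rintro a ⟨ha, hai⟩ (h | h)
      · cases h
        exact hai rfl
      · exact hA a ha h
    · have := Set.ncard_insert_le (Sum.inl i) Z
      omega

/-- Moving `p` from `U` to `Z` leaves `|Z| + |U|` unchanged, so the gain in `e` is the one regular
element `y_p`. -/
lemma DepthBound.of_regular [Finite V] {U : Set V} {e : ℕ} {p : V} (hp : p ∈ U)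
    (hreg : ∀ Z : Set (V ⊕ V), (∀ u ∈ U, Sum.inl u ∉ Z ∧ Sum.inr u ∉ Z) →
      RegularMod (mixedIdeal K G Z ∅ U) (X (Sum.inr p)))
    (h : DepthBound K G {p} (U \ {p}) e) : DepthBound K G ∅ U (e + 1) := by
  intro Z k hU _ hk
  rcases k with _ | k
  · exact .zero (idealOfVars_ne_top _ _) (mixedIdeal_le_idealOfVars _ _ _)
  refine HasRegularSeq.succ_of_regularMod (X_mem_idealOfVars K (Sum.inr p)) (hreg Z hU) ?_
  rw [mixedIdeal_empty_sup_span_X hp]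
  apply h
  · rintro u ⟨hu, hup⟩
    refine ⟨?_, ?_⟩
    · rintro (h | h)
      · cases h
      · exact (hU u hu).1 h
    · rintro (h | h)
      · cases h
        exact hup rfl
      · exact (hU u hu).2 h
  · rintro a ha (h | h)
    · cases h
    · exact (hU a (by rw [ha]; exact hp)).1 h
  · have h1 := Set.ncard_insert_le (Sum.inr p) Z
    have h2 := Set.ncard_sdiff_singleton_add_one hp
    omega

end DepthBound

/-! ### Interval labellings and the lower bounds for depth. -/

section Interval

open MvPolynomial

/-- The vertices of `G` are labelled by `1, …, n` so that the vertices after `i` which are adjacent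
to `i` are `i + 1, …, r i`. -/
structure IntervalLabelling {V : Type u} (G : SimpleGraph V) (n : ℕ) (l : V → ℕ) (r : ℕ → ℕ) :
    Prop where
  inj : Function.Injective l
  surj : ∀ i, 1 ≤ i → i ≤ n → ∃ v, l v = i
  one_le : ∀ v, 1 ≤ l v
  le_n : ∀ v, l v ≤ n
  mono : ∀ i j, i ≤ j → r i ≤ r j
  r_le : ∀ i, r i ≤ n
  le_r : ∀ i, i ≤ n → i ≤ r i
  lt_r : ∀ i, 1 ≤ i → i < n → i < r i
  adj_iff : ∀ u v, l u < l v → (G.Adj u v ↔ l v ≤ r (l u))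

variable {V : Type u} {K : Type v} [Field K] {G : SimpleGraph V} {n : ℕ} {l : V → ℕ} {r : ℕ → ℕ}

/-- The vertices with label at least `p`. -/
def labelIci (l : V → ℕ) (p : ℕ) : Set V := {v | p ≤ l v}

lemma mem_labelIci_self (l : V → ℕ) (p : V) : p ∈ labelIci l (l p) := le_refl (l p)

lemma IntervalLabelling.card (h : IntervalLabelling G n l r) : Nat.card V = n := by
  have : Nat.card V = Nat.card (Set.Icc 1 n) := by
    refine Nat.card_congr (Equiv.ofBijective
      (fun v => (⟨l v, h.one_le v, h.le_n v⟩ : Set.Icc 1 n)) ⟨fun v w hvw => ?_, fun i => ?_⟩)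
    · exact h.inj (congrArg Subtype.val hvw)
    · obtain ⟨v, hv⟩ := h.surj i i.2.1 i.2.2
      exact ⟨v, Subtype.ext hv⟩
  rw [this]
  simp

lemma IntervalLabelling.labelIci_eq_empty (h : IntervalLabelling G n l r) {p : ℕ} (hp : n < p) :
    labelIci l p = ∅ := by
  ext v
  have := h.le_n v
  simp only [labelIci, Set.mem_ofPred_eq, Set.mem_empty_iff_false, iff_false]
  omega

lemma IntervalLabelling.labelIci_diff_singleton (h : IntervalLabelling G n l r) {p : V} :
    labelIci l (l p) \ {p} = labelIci l (l p + 1) := by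
  ext v
  simp only [labelIci, Set.mem_sdiff, Set.mem_ofPred_eq, Set.mem_singleton_iff]
  constructor
  · rintro ⟨h1, h2⟩
    have : l v ≠ l p := fun e => h2 (h.inj e)
    omega
  · intro h1
    refine ⟨by omega, ?_⟩
    rintro rfl
    omega

lemma IntervalLabelling.labelIci_diff_neighborSet (h : IntervalLabelling G n l r) {p : ℕ} {a : V}
    (hap : l a < p) (hpa : p ≤ r (l a)) :
    labelIci l p \ G.neighborSet a = labelIci l (r (l a) + 1) := by
  ext v
  simp only [labelIci, Set.mem_sdiff, Set.mem_ofPred_eq, SimpleGraph.mem_neighborSet]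
  constructor
  · rintro ⟨h1, h2⟩
    rw [h.adj_iff a v (by omega)] at h2
    omega
  · intro h1
    refine ⟨by omega, ?_⟩
    rw [h.adj_iff a v (by omega)]
    omega

lemma IntervalLabelling.mem_labelIci_inter_neighborSet (h : IntervalLabelling G n l r) {p : ℕ}
    {a v : V} (hap : l a < p) :
    v ∈ labelIci l p ∩ G.neighborSet a ↔ p ≤ l v ∧ l v ≤ r (l a) := by
  simp only [labelIci, Set.mem_inter_iff, Set.mem_ofPred_eq, SimpleGraph.mem_neighborSet]
  refine and_congr_right fun hv => ?_
  rw [h.adj_iff a v (by omega)]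

/-- Downward induction on the label. The successor of `p` is adjacent to every later neighbour of
`p` because `r` is monotone, so it can serve as the vertex `q` of `regularMod_mixedIdeal_empty`. -/
lemma IntervalLabelling.regularMod [Finite V] (h : IntervalLabelling G n l r) (p : V) :
    ∀ Z : Set (V ⊕ V), (∀ u ∈ labelIci l (l p), Sum.inl u ∉ Z ∧ Sum.inr u ∉ Z) →
      RegularMod (mixedIdeal K G Z ∅ (labelIci l (l p))) (X (Sum.inr p)) := by
  obtain ⟨d, hd⟩ : ∃ d, n - l p = d := ⟨_, rfl⟩
  induction d generalizing p with
  | zero =>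
    intro Z hZ
    refine regularMod_mixedIdeal_X (hZ p (mem_labelIci_self l p)).2 (by simp) ?_
    intro i hi j hj hij
    exfalso
    have h1 := h.le_n i
    have h2 := h.le_n j
    have h3 : l i = l j := by
      simp only [labelIci, Set.mem_ofPred_eq] at hi hj
      omega
    exact hij.ne (h.inj h3)
  | succ d ih =>
    intro Z hZ
    obtain ⟨q, hq⟩ := h.surj (l p + 1) (by omega) (by omega)
    have hp := mem_labelIci_self l p
    refine regularMod_mixedIdeal_empty hp (hZ p hp).1 (hZ p hp).2 (q := q) ?_ ?_ ?_ ?_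
    · simp only [labelIci, Set.mem_ofPred_eq]
      omega
    · rw [h.adj_iff p q (by omega), hq]
      exact h.lt_r _ (h.one_le p) (by omega)
    · intro j hj hpj hjq
      simp only [labelIci, Set.mem_ofPred_eq] at hj
      have h1 : l p ≠ l j := fun e => hpj.ne (h.inj e)
      have h2 : l j ≠ l q := fun e => hjq (h.inj e)
      rw [h.adj_iff p j (by omega)] at hpj
      rw [h.adj_iff q j (by omega)]
      exact hpj.trans (h.mono _ _ (by omega))
    · rw [h.labelIci_diff_singleton, ← hq]
      refine ih q (by omega) Z fun u hu => hZ u ?_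
      simp only [labelIci, Set.mem_ofPred_eq] at hu ⊢
      omega

lemma IntervalLabelling.depthBound_of_forall_lt (h : IntervalLabelling G n l r) {A : Set V}
    {p e : ℕ}
    (hA : ∀ a ∈ A, l a < p) (hr : ∀ a ∈ A, r (l a) < p)
    (hb : DepthBound K G ∅ (labelIci l p) e) : DepthBound K G A (labelIci l p) e := by
  refine hb.of_subset (Set.empty_subset _) fun a ha _ u hu hau => ?_
  have h1 := hA a ha
  have h2 := hr a ha
  simp only [labelIci, Set.mem_ofPred_eq] at hu
  rw [h.adj_iff a u (by omega)] at hau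
  omega

lemma IntervalLabelling.depthBound_step [Finite V] (h : IntervalLabelling G n l r) {A : Set V}
    {p e : ℕ} {a : V} (ha : a ∈ A) (hap : l a < p) (hpa : p ≤ r (l a))
    (h₁ : DepthBound K G (A \ {a}) (labelIci l p) (e + 1))
    (h₂ : DepthBound K G ((A \ {a}) ∪ (labelIci l p ∩ G.neighborSet a))
      (labelIci l (r (l a) + 1)) e) :
    DepthBound K G A (labelIci l p) e := by
  refine DepthBound.of_colon ha ?_ h₁ ?_
  · simp only [labelIci, Set.mem_ofPred_eq]
    omega
  · rwa [h.labelIci_diff_neighborSet hap hpa]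

lemma IntervalLabelling.depthBound_succ [Finite V] (h : IntervalLabelling G n l r) {p e : ℕ}
    (hp : 1 ≤ p) (hpn : p ≤ n)
    (hb : ∀ v, l v = p → DepthBound K G {v} (labelIci l (p + 1)) e) :
    DepthBound K G ∅ (labelIci l p) (e + 1) := by
  obtain ⟨v, rfl⟩ := h.surj p hp hpn
  refine DepthBound.of_regular (p := v) (mem_labelIci_self l v) (h.regularMod v) ?_
  rw [h.labelIci_diff_singleton]
  exact hb v rfl

/-- Consecutive maximal cliques, the first of which ends after a vertex `≥ a`, share one vertex. -/
def SingleOverlapFrom (n : ℕ) (r : ℕ → ℕ) (a : ℕ) : Prop :=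
  ∀ j, a ≤ j → r j < n → r (r j - 1) ≤ r j

lemma SingleOverlapFrom.mono {a b : ℕ} (h : SingleOverlapFrom n r a) (hab : a ≤ b) :
    SingleOverlapFrom n r b := fun j hj => h j (hab.trans hj)

/-- The invariant is that at most one vertex of `A` has neighbours in `U`. A colon step at it passes
to the vertices after `q = r a`; by single overlap only `q` itself can see beyond `q`, so the
invariant persists. -/
lemma IntervalLabelling.depthBound_of_singleOverlap [Finite V] (h : IntervalLabelling G n l r) :
    ∀ p, 1 ≤ p →
    (p ≤ n → SingleOverlapFrom n r p → DepthBound K G ∅ (labelIci l p) 2) ∧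
    (∀ (A : Set V) (a : ℕ), a < p → SingleOverlapFrom n r a → (∀ v ∈ A, l v < p) →
      (∀ v ∈ A, p ≤ r (l v) → l v = a) → DepthBound K G A (labelIci l p) 1) := by
  intro p
  obtain ⟨d, hd⟩ : ∃ d, n + 1 - p = d := ⟨_, rfl⟩
  induction d using Nat.strong_induction_on generalizing p with
  | _ d ih =>
    intro hp
    by_cases hpn : p ≤ n
    swap
    · refine ⟨fun h => (hpn h).elim, fun A a _ _ _ _ => ?_⟩
      rw [h.labelIci_eq_empty (by omega)]
      exact depthBound_empty A
    have h1 : SingleOverlapFrom n r p → DepthBound K G ∅ (labelIci l p) 2 := by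
      intro hC
      refine h.depthBound_succ hp hpn fun v hv => ?_
      refine (ih _ (by omega) (p + 1) rfl (by omega)).2 {v} p (by omega) hC ?_ ?_
      · rintro _ rfl
        omega
      · rintro _ rfl _
        exact hv
    refine ⟨fun _ => h1, fun A a hap hC hA hAeff => ?_⟩
    have hempty := h1 (hC.mono hap.le)
    by_cases hex : ∃ v ∈ A, p ≤ r (l v)
    swap
    · push Not at hex
      exact h.depthBound_of_forall_lt hA hex (hempty.mono (by omega))
    obtain ⟨v, hv, hpv⟩ := hex
    have hva := hAeff v hv hpv
    refine h.depthBound_step hv (hA v hv) hpv ?_ ?_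
    · refine h.depthBound_of_forall_lt (fun w hw => hA w hw.1) (fun w hw => ?_) hempty
      by_contra hcon
      have := hAeff w hw.1 (by omega)
      exact hw.2 (h.inj (by omega))
    · have hq : a < r (l v) := by omega
      refine (ih _ (by omega) (r (l v) + 1) rfl (by omega)).2 _ (r (l v)) (by omega)
        (hC.mono hq.le) ?_ ?_
      · rintro w (hw | hw)
        · have := hA w hw.1
          omega
        · rw [h.mem_labelIci_inter_neighborSet (hA v hv)] at hw
          omega
      · rintro w (hw | hw) hwr
        · have := hAeff w hw.1 (by omega)
          exact (hw.2 (h.inj (by omega))).elim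
        · rw [h.mem_labelIci_inter_neighborSet (hA v hv)] at hw
          by_contra hne
          have h2 := h.mono (l w) (r (l v) - 1) (by omega)
          have h3 := h.r_le (l w)
          have h4 := hC (l v) hva.ge (by omega)
          omega

/-- The maximal clique ending at `q < n` shares at least two vertices with a later one. -/
def IsWideEnd (n : ℕ) (r : ℕ → ℕ) (q : ℕ) : Prop :=
  (∃ j, 1 ≤ j ∧ r j = q) ∧ q < n ∧ q < r (q - 1)

/-- Consecutive maximal cliques share at most two vertices, and the ends of those sharing two
vertices are close to each other. -/
def IsNarrow (n : ℕ) (r : ℕ → ℕ) : Prop :=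
  (∀ j, 1 ≤ j → r j < n → r (r j - 2) ≤ r j) ∧
    ∀ q q', IsWideEnd n r q → IsWideEnd n r q' → q < q' →
      q' ≤ q + 2 ∧ (q' = q + 2 → r (q - 1) = q + 1)

/-- A wide end `r j` with `j > q` would be at least `q + 2`, hence equal to it with `j = q + 1`.
Then `r j - 1 = j`, which contradicts wideness. -/
lemma IntervalLabelling.singleOverlapFrom_of_isWideEnd (h : IntervalLabelling G n l r)
    (hN : IsNarrow n r) {q : ℕ} (hq : IsWideEnd n r q) : SingleOverlapFrom n r (q + 1) := by
  intro j hj hjn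
  by_contra hcon
  have h1 : IsWideEnd n r (r j) := ⟨⟨j, by omega, rfl⟩, hjn, by omega⟩
  have hjlt : j < n := by
    by_contra hc
    have h3 := h.le_r n le_rfl
    have h4 := h.mono n j (by omega)
    omega
  have h2 := h.lt_r j (by omega) hjlt
  have h3 := (hN.2 q (r j) hq h1 (by omega)).1
  have h4 : r j = q + 2 := by omega
  have h5 : r j - 1 = j := by omega
  rw [h5] at hcon
  omega

/-- The invariant weakens to at most two effective vertices in `A`, namely `q - 1` and `q` for a
clique end `q`. When both are effective, `q` is a wide end, and single overlap after it supplies the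
stronger bounds demanded by killing `x_q` and then `x_{q-1}`. -/
lemma IntervalLabelling.depthBound_of_isNarrow [Finite V] (h : IntervalLabelling G n l r)
    (hN : IsNarrow n r) : ∀ p, 1 ≤ p →
    DepthBound K G ∅ (labelIci l p) 1 ∧
    (∀ (A : Set V) (a : ℕ), (∀ v ∈ A, l v < p) →
      (∀ v ∈ A, p ≤ r (l v) → l v = a) → DepthBound K G A (labelIci l p) 0) ∧
    (∀ (A : Set V) (q : ℕ), p = q + 1 → q < n → (∃ j, 1 ≤ j ∧ r j = q) → (∀ v ∈ A, l v < p) →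
      (∀ v ∈ A, p ≤ r (l v) → l v = q - 1 ∨ l v = q) → DepthBound K G A (labelIci l p) 0) := by
  intro p
  obtain ⟨d, hd⟩ : ∃ d, n + 1 - p = d := ⟨_, rfl⟩
  induction d using Nat.strong_induction_on generalizing p with
  | _ d ih =>
    intro hp
    by_cases hpn : p ≤ n
    swap
    · rw [h.labelIci_eq_empty (by omega)]
      exact ⟨depthBound_empty _, fun A _ _ _ => (depthBound_empty A).mono (by omega),
        fun A _ _ _ _ _ _ => (depthBound_empty A).mono (by omega)⟩
    have h1 : DepthBound K G ∅ (labelIci l p) 1 := by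
      refine h.depthBound_succ hp hpn fun v hv => ?_
      refine (ih _ (by omega) (p + 1) rfl (by omega)).2.1 {v} p ?_ ?_
      · rintro _ rfl
        omega
      · rintro _ rfl _
        exact hv
    -- After a colon step at `a` only the two last neighbours of `a` can see further, since overlaps
    -- have at most two vertices.
    have hcolon : ∀ (A : Set V) (a : V), l a < p → p ≤ r (l a) → (∀ v ∈ A, l v < p) →
        (∀ v ∈ A, r (l v) ≤ r (l a)) →
        DepthBound K G (A ∪ (labelIci l p ∩ G.neighborSet a)) (labelIci l (r (l a) + 1)) 0 := by
      intro A a hap hpa hA hAr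
      by_cases hqn : r (l a) < n
      · refine (ih _ (by omega) (r (l a) + 1) rfl (by omega)).2.2 _ (r (l a)) rfl hqn
          ⟨l a, h.one_le a, rfl⟩ ?_ ?_
        · rintro w (hw | hw)
          · have := hA w hw
            omega
          · rw [h.mem_labelIci_inter_neighborSet hap] at hw
            omega
        · rintro w (hw | hw) hwr
          · have := hAr w hw
            omega
          · rw [h.mem_labelIci_inter_neighborSet hap] at hw
            by_contra hcon
            have h2 := h.mono (l w) (r (l a) - 2) (by omega)
            have h3 := hN.1 (l a) (h.one_le a) hqn
            omega
      · rw [h.labelIci_eq_empty (p := r (l a) + 1) (by omega)]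
        exact (depthBound_empty _).mono (by omega)
    have h2 : ∀ (A : Set V) (a : ℕ), (∀ v ∈ A, l v < p) →
        (∀ v ∈ A, p ≤ r (l v) → l v = a) → DepthBound K G A (labelIci l p) 0 := by
      intro A a hA hAeff
      by_cases hex : ∃ v ∈ A, p ≤ r (l v)
      swap
      · push Not at hex
        exact h.depthBound_of_forall_lt hA hex (h1.mono (by omega))
      obtain ⟨v, hv, hpv⟩ := hex
      have hva := hAeff v hv hpv
      have hrest : ∀ w ∈ A \ {v}, r (l w) < p := by
        intro w hw
        by_contra hcon
        have := hAeff w hw.1 (by omega)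
        exact hw.2 (h.inj (by omega))
      refine h.depthBound_step hv (hA v hv) hpv ?_ ?_
      · exact h.depthBound_of_forall_lt (fun w hw => hA w hw.1) hrest h1
      · exact hcolon _ v (hA v hv) hpv (fun w hw => hA w hw.1)
          (fun w hw => by have := hrest w hw; omega)
    refine ⟨h1, h2, fun A q hpq hqn hj hA hAeff => ?_⟩
    by_cases hex : ∃ v ∈ A, p ≤ r (l v) ∧ l v = q - 1
    swap
    · refine h2 A q hA fun v hv hpv => ?_
      rcases hAeff v hv hpv with hvq | hvq
      · exact (hex ⟨v, hv, hpv, hvq⟩).elim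
      · exact hvq
    by_cases hex' : ∃ v ∈ A, p ≤ r (l v) ∧ l v = q
    swap
    · refine h2 A (q - 1) hA fun v hv hpv => ?_
      rcases hAeff v hv hpv with hvq | hvq
      · exact hvq
      · exact (hex' ⟨v, hv, hpv, hvq⟩).elim
    obtain ⟨v, hv, hpv, hvq⟩ := hex
    obtain ⟨w, hw, hpw, hwq⟩ := hex'
    have hv1 := h.one_le v
    -- Both `q - 1` and `q` see beyond `q`.
    have hwide : IsWideEnd n r q := ⟨hj, hqn, by rw [← hvq]; omega⟩
    have hC := h.singleOverlapFrom_of_isWideEnd hN hwide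
    refine h.depthBound_step hw (hA w hw) hpw ?_ ?_
    · have hvw : v ∈ A \ {w} := ⟨hv, by rintro rfl; omega⟩
      refine h.depthBound_step hvw (hA v hv) hpv ?_ ?_
      · refine h.depthBound_of_forall_lt (fun x hx => hA x hx.1.1) (fun x hx => ?_)
          ((h.depthBound_of_singleOverlap p hp).1 hpn (by rw [hpq]; exact hC))
        by_contra hcon
        rcases hAeff x hx.1.1 (by omega) with hxq | hxq
        · exact hx.2 (h.inj (by omega))
        · exact hx.1.2 (h.inj (by omega))
      · refine (h.depthBound_of_singleOverlap (r (l v) + 1) (by omega)).2 _ (r (l v)) (by omega)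
          (hC.mono (by omega)) ?_ ?_
        · rintro x (hx | hx)
          · have := hA x hx.1.1
            omega
          · rw [h.mem_labelIci_inter_neighborSet (hA v hv)] at hx
            omega
        · rintro x (hx | hx) hxr
          · rcases hAeff x hx.1.1 (by omega) with hxq | hxq
            · exact (hx.2 (h.inj (by omega))).elim
            · exact (hx.1.2 (h.inj (by omega))).elim
          · rw [h.mem_labelIci_inter_neighborSet (hA v hv)] at hx
            by_contra hne
            have h3 := h.mono (l x) (r (l v) - 1) (by omega)
            have h4 := h.r_le (l x)
            have h5 : IsWideEnd n r (r (l v)) := ⟨⟨l v, hv1, rfl⟩, by omega, by omega⟩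
            obtain ⟨h6, h7⟩ := hN.2 q _ hwide h5 (by omega)
            rw [← hvq] at h7
            omega
    · refine hcolon _ w (hA w hw) hpw (fun x hx => hA x hx.1) fun x hx => ?_
      by_cases hxr : p ≤ r (l x)
      · refine h.mono _ _ ?_
        rcases hAeff x hx.1 hxr with hxq | hxq <;> omega
      · omega

lemma IntervalLabelling.hasRegularSeq_of_depthBound [Finite V] (h : IntervalLabelling G n l r)
    {e k : ℕ} (hb : DepthBound K G ∅ (labelIci l 1) e) (hk : k + 1 = n + e) :
    HasRegularSeq (idealOfVars (V ⊕ V) K) (binomialEdgeIdeal K G) k := by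
  have h1 : labelIci l 1 = Set.univ := Set.eq_univ_of_forall fun v => h.one_le v
  rw [h1] at hb
  rw [binomialEdgeIdeal_eq_mixedIdeal]
  refine hb ∅ k (by simp) (by simp) ?_
  rw [Set.ncard_empty, Set.ncard_univ, h.card]
  omega

/-- If consecutive maximal cliques share one vertex, the depth is at least `n + 1`. -/
lemma IntervalLabelling.hasRegularSeq_of_singleOverlap [Finite V] (h : IntervalLabelling G n l r)
    (hn : 1 ≤ n) (hC : SingleOverlapFrom n r 1) :
    HasRegularSeq (idealOfVars (V ⊕ V) K) (binomialEdgeIdeal K G) (n + 1) :=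
  h.hasRegularSeq_of_depthBound ((h.depthBound_of_singleOverlap 1 le_rfl).1 hn hC) rfl

lemma IntervalLabelling.hasRegularSeq_of_isNarrow [Finite V] (h : IntervalLabelling G n l r)
    (hN : IsNarrow n r) :
    HasRegularSeq (idealOfVars (V ⊕ V) K) (binomialEdgeIdeal K G) n :=
  h.hasRegularSeq_of_depthBound (h.depthBound_of_isNarrow hN 1 le_rfl).1 rfl

end Interval

/-! ### Upper bounds for the dimension after deleting vertices. -/

section Dimension

open MvPolynomial

variable {V : Type u} {K : Type v} [Field K] {G : SimpleGraph V} {n : ℕ} {l : V → ℕ} {r : ℕ → ℕ}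

/-- The variables at the vertices with labels in `T`. -/
def labelVars (l : V → ℕ) (T : Finset ℕ) : Set (V ⊕ V) := {s | Sum.elim l l s ∈ T}

/-- Removing the vertices with labels in `T`, whose complement in `[1, n]` consists of at most
`|R|` intervals, leaves a quotient of dimension at most `n - |T| + |R|`. -/
lemma IntervalLabelling.ringKrullDim_le [Finite V] (h : IntervalLabelling G n l r) (hn : 1 ≤ n)
    (T R : Finset ℕ) (hR : ∀ i, 1 ≤ i → i ≤ n → i ∉ T → i = 1 ∨ i - 1 ∈ T → i ∈ R) :
    ringKrullDim (MvPolynomial (V ⊕ V) K ⧸ mixedIdeal K G (labelVars l T) ∅ Set.univ) ≤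
      (((Finset.Icc 1 n \ T).card + R.card : ℕ) : WithBot ℕ∞) := by
  classical
  have hne : Nonempty V := ⟨(h.surj 1 le_rfl hn).choose⟩
  let vx : ℕ → V := Function.invFun l
  have hvx : ∀ v, vx (l v) = v := Function.leftInverse_invFun h.inj
  have key := ringKrullDim_le_card_of_surjective
    (Ideal.Quotient.mk (mixedIdeal K G (labelVars l T) ∅ Set.univ)) Ideal.Quotient.mk_surjective
    (mixedIdeal K G (labelVars l T) ∅ Set.univ) (mixedIdeal_componentClosed _ _ _)
    (fun q hq => Ideal.Quotient.eq_zero_iff_mem.2 hq)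
    (ι := (Finset.Icc 1 n \ T : Finset ℕ) ⊕ R)
    -- One form `x_i - y_{i+1}` for each remaining vertex, or just `x_i` at the right end of an
    -- interval, together with `y_i` for the left ends, which all lie in `R`.
    (Sum.elim (fun i => X (Sum.inl (vx i)) -
        if (i : ℕ) + 1 ≤ n ∧ (i : ℕ) + 1 ∉ T then X (Sum.inr (vx (i + 1))) else 0)
      (fun i => X (Sum.inr (vx i)))) ?_ ?_
  · rwa [Nat.card_sum, Nat.card_eq_fintype_card, Nat.card_eq_fintype_card, Fintype.card_coe,
      Fintype.card_coe] at key
  · rintro (i | i)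
    · refine (isHomogeneous_X _ _).sub ?_
      split_ifs
      · exact isHomogeneous_X _ _
      · exact isHomogeneous_zero _ _ _
    · exact isHomogeneous_X _ _
  · intro P hP hQP hθ
    have hT : ∀ s : V ⊕ V, Sum.elim l l s ∈ T → X s ∈ P := fun s hs =>
      hQP (X_mem_mixedIdeal hs)
    have hx : ∀ v, l v ∉ T → (X (Sum.inl v) -
        if l v + 1 ≤ n ∧ l v + 1 ∉ T then X (Sum.inr (vx (l v + 1))) else 0 :
          MvPolynomial (V ⊕ V) K) ∈ P := by
      intro v hv
      have := hθ (Sum.inl ⟨l v, by simp [h.one_le v, h.le_n v, hv]⟩)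
      simpa only [Sum.elim_inl, hvx] using this
    -- Induction along each interval: for consecutive `w`, `v` with `y_w ∈ P`, the minor gives `x_w
    -- y_v ∈ P`, and `x_w - y_v ∈ P` makes either factor yield `y_v`.
    have hy : ∀ k, ∀ v, l v = k → X (Sum.inr v) ∈ P := by
      intro k
      induction k using Nat.strong_induction_on with
      | _ k ih =>
        intro v hv
        by_cases hvT : l v ∈ T
        · exact hT _ hvT
        by_cases hvR : l v = 1 ∨ l v - 1 ∈ T
        · have := hθ (Sum.inr ⟨l v, hR _ (h.one_le v) (h.le_n v) hvT hvR⟩)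
          simpa only [Sum.elim_inr, hvx] using this
        push Not at hvR
        have hv1 := h.one_le v
        obtain ⟨w, hw⟩ := h.surj (l v - 1) (by omega) (by have := h.le_n v; omega)
        have hwv : l w + 1 = l v := by omega
        have h1 := hx w (by rw [hw]; exact hvR.2)
        rw [hwv, if_pos ⟨h.le_n v, hvT⟩, hvx] at h1
        have hadj : G.Adj w v := by
          rw [h.adj_iff w v (by omega), ← hwv]
          exact h.lt_r _ (h.one_le w) (by have := h.le_n v; omega)
        have h2 : edgeMinor K w v ∈ P := hQP (edgeMinor_mem_mixedIdeal trivial trivial hadj)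
        have h3 : X (Sum.inl w) * X (Sum.inr v) ∈ P := by
          have := add_mem h2 (Ideal.mul_mem_left _ (X (Sum.inl v)) (ih (l w) (by omega) w rfl))
          simpa [edgeMinor] using this
        rcases hP.mem_or_mem h3 with h4 | h4
        · simpa using sub_mem h4 h1
        · exact h4
    rintro (v | v)
    · by_cases hvT : l v ∈ T
      · exact hT _ hvT
      have h1 := hx v hvT
      split_ifs at h1
      · simpa using add_mem h1 (hy _ (vx (l v + 1)) rfl)
      · simpa using h1
    · exact hy _ v rfl

end Dimension

/-! ### Minors of nonadjacent vertices as classes with large annihilator. -/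

section Witness

open MvPolynomial

variable {V : Type u} {K : Type v} [Field K] {G : SimpleGraph V}

lemma edgeMinor_mem_binomialEdgeIdeal {i j : V} (h : G.Adj i j) :
    edgeMinor K i j ∈ binomialEdgeIdeal K G :=
  Ideal.subset_span ⟨i, j, h, rfl⟩

/-- The three-term Plücker relation: the variables of a common neighbour of `j` and `k` kill the
minor of `j` and `k`. -/
lemma X_mul_edgeMinor_mem {I : Ideal (MvPolynomial (V ⊕ V) K)} {i j k : V}
    (hij : edgeMinor K j i ∈ I) (hik : edgeMinor K i k ∈ I) {s : V ⊕ V}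
    (hs : s = Sum.inl i ∨ s = Sum.inr i) : X s * edgeMinor K j k ∈ I := by
  rcases hs with rfl | rfl
  · have : X (Sum.inl i) * edgeMinor K j k = X (Sum.inl j) * edgeMinor K i k +
        X (Sum.inl k) * edgeMinor K j i := by
      simp only [edgeMinor]; ring
    rw [this]
    exact add_mem (I.mul_mem_left _ hik) (I.mul_mem_left _ hij)
  · have : X (Sum.inr i) * edgeMinor K j k = X (Sum.inr j) * edgeMinor K i k +
        X (Sum.inr k) * edgeMinor K j i := by
      simp only [edgeMinor]; ring
    rw [this]
    exact add_mem (I.mul_mem_left _ hik) (I.mul_mem_left _ hij)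

open Classical in
/-- The points `(t, 0)` at the vertices in `A` and `(0, t)` at those in `B`. -/
noncomputable def axisHom (K : Type v) [Field K] (A B : Set V) :
    MvPolynomial (V ⊕ V) K →ₐ[K] Polynomial K :=
  aeval (Sum.elim (fun v => if v ∈ A then Polynomial.X else 0)
    (fun v => if v ∈ B then Polynomial.X else 0))

lemma axisHom_inl_of_mem {A B : Set V} {v : V} (h : v ∈ A) :
    axisHom K A B (X (Sum.inl v)) = Polynomial.X := by simp [axisHom, h]

lemma axisHom_inl_of_notMem {A B : Set V} {v : V} (h : v ∉ A) :
    axisHom K A B (X (Sum.inl v)) = 0 := by simp [axisHom, h]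

lemma axisHom_inr_of_mem {A B : Set V} {v : V} (h : v ∈ B) :
    axisHom K A B (X (Sum.inr v)) = Polynomial.X := by simp [axisHom, h]

lemma axisHom_inr_of_notMem {A B : Set V} {v : V} (h : v ∉ B) :
    axisHom K A B (X (Sum.inr v)) = 0 := by simp [axisHom, h]

/-- Specialising `t = 0` recovers the constant coefficient. So elements outside the maximal ideal
cannot kill a class with nonzero image, which replaces a check in the localization. -/
lemma axisHom_ne_zero {A B : Set V} {s : MvPolynomial (V ⊕ V) K} (hs : s ∉ idealOfVars _ K) :
    axisHom K A B s ≠ 0 := by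
  have h : (Polynomial.evalRingHom (0 : K)).comp (axisHom K A B).toRingHom = constantCoeff := by
    apply ringHom_ext
    · intro a
      simp [axisHom]
    · rintro (v | v)
      · by_cases hv : v ∈ A <;> simp [axisHom, hv]
      · by_cases hv : v ∈ B <;> simp [axisHom, hv]
  rw [mem_idealOfVars_iff, ← h] at hs
  intro h0
  apply hs
  simp [h0]

/-- Already each product `x_i y_j` over an edge has a zero factor, as no edge joins `A` to `B`. -/
lemma axisHom_binomialEdgeIdeal {A B : Set V} (hAB : ∀ a ∈ A, ∀ b ∈ B, ¬ G.Adj a b)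
    {f : MvPolynomial (V ⊕ V) K} (hf : f ∈ binomialEdgeIdeal K G) : axisHom K A B f = 0 := by
  have hle : binomialEdgeIdeal K G ≤ RingHom.ker (axisHom K A B) := by
    refine Ideal.span_le.2 ?_
    rintro _ ⟨i, j, hij, rfl⟩
    rw [SetLike.mem_coe, RingHom.mem_ker, map_sub, map_mul, map_mul]
    have h1 : axisHom K A B (X (Sum.inl i)) * axisHom K A B (X (Sum.inr j)) = 0 := by
      by_cases hi : i ∈ A
      · rw [axisHom_inr_of_notMem (fun hj => hAB i hi j hj hij), mul_zero]
      · rw [axisHom_inl_of_notMem hi, zero_mul]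
    have h2 : axisHom K A B (X (Sum.inl j)) * axisHom K A B (X (Sum.inr i)) = 0 := by
      by_cases hj : j ∈ A
      · rw [axisHom_inr_of_notMem (fun hi => hAB j hj i hi hij.symm), mul_zero]
      · rw [axisHom_inl_of_notMem hj, zero_mul]
    rw [h1, h2, sub_zero]
  exact hle hf

lemma mul_notMem_binomialEdgeIdeal {A B : Set V} (hAB : ∀ a ∈ A, ∀ b ∈ B, ¬ G.Adj a b)
    {g : MvPolynomial (V ⊕ V) K} (hg : axisHom K A B g ≠ 0) (s : MvPolynomial (V ⊕ V) K)
    (hs : s ∉ idealOfVars _ K) : s * g ∉ binomialEdgeIdeal K G := by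
  intro h
  have := axisHom_binomialEdgeIdeal hAB h
  rw [map_mul] at this
  exact (mul_ne_zero (axisHom_ne_zero hs) hg) this

lemma axisHom_edgeMinor {A B : Set V} {a b : V} (ha : a ∈ A) (haB : a ∉ B) (hb : b ∈ B) :
    axisHom K A B (edgeMinor K a b) = Polynomial.X ^ 2 := by
  rw [edgeMinor, map_sub, map_mul, map_mul, axisHom_inl_of_mem ha, axisHom_inr_of_mem hb,
    axisHom_inr_of_notMem haB]
  ring

lemma axisHom_edgeMinor' {A B : Set V} {a b : V} (ha : a ∈ B) (haA : a ∉ A) (hb : b ∈ A) :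
    axisHom K A B (edgeMinor K a b) = - Polynomial.X ^ 2 := by
  rw [edgeMinor, map_sub, map_mul, map_mul, axisHom_inl_of_mem hb, axisHom_inr_of_mem ha,
    axisHom_inl_of_notMem haA]
  ring

lemma one_notMem_of_notMem {σ : Type u} {J : Ideal (MvPolynomial σ K)} (hJ : J ≤ idealOfVars σ K)
    (s : MvPolynomial σ K) (hs : s ∉ idealOfVars _ K) : s * 1 ∉ J := by
  rw [mul_one]
  exact fun h => hs (hJ h)

end Witness

/-! ### Exact dimension, and the obstructions from wide or distant overlaps. -/

section Upper

open MvPolynomial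

variable {V : Type u} {K : Type v} [Field K] {G : SimpleGraph V} {n : ℕ} {l : V → ℕ} {r : ℕ → ℕ}

lemma labelVars_empty : labelVars l ∅ = ∅ := by
  ext s
  simp [labelVars]

/-- The minors of edges annihilate every class modulo `I`, so only the variables at `T` have to be
tested. -/
lemma mul_mem_of_mem_mixedIdeal {T : Finset ℕ} {g : MvPolynomial (V ⊕ V) K}
    {I : Ideal (MvPolynomial (V ⊕ V) K)} (hI : binomialEdgeIdeal K G ≤ I)
    (hT : ∀ i, l i ∈ T → ∀ s, s = Sum.inl i ∨ s = Sum.inr i → X s * g ∈ I) :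
    ∀ q ∈ mixedIdeal K G (labelVars l T) ∅ Set.univ, q * g ∈ I := by
  have hle : mixedIdeal K G (labelVars l T) ∅ Set.univ ≤ I.colon {g} := by
    refine mixedIdeal_le ?_ (by simp) fun i _ j _ hij => ?_
    · rintro (i | i) hi
      · rw [Submodule.mem_colon_singleton]
        exact hT i hi _ (Or.inl rfl)
      · rw [Submodule.mem_colon_singleton]
        exact hT i hi _ (Or.inr rfl)
    · rw [Submodule.mem_colon_singleton]
      exact I.mul_mem_right _ (hI (edgeMinor_mem_binomialEdgeIdeal hij))
  intro q hq
  have := hle hq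
  rwa [Submodule.mem_colon_singleton] at this

/-- From above, `n + 1` linear forms suffice when nothing is deleted. From below, `S / J_G` surjects
onto the quotient for the complete graph, whose depth is at least `n + 1` because it has a single
clique. -/
lemma IntervalLabelling.ringKrullDim_binomialEdgeIdeal [Finite V] (h : IntervalLabelling G n l r)
    (hn : 1 ≤ n) :
    ringKrullDim (MvPolynomial (V ⊕ V) K ⧸ binomialEdgeIdeal K G) = ((n + 1 : ℕ) : WithBot ℕ∞) := by
  apply le_antisymm
  · have := h.ringKrullDim_le (K := K) hn ∅ {1} (by simp)
    rw [labelVars_empty, ← binomialEdgeIdeal_eq_mixedIdeal] at this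
    simpa using this
  · have htop : IntervalLabelling (⊤ : SimpleGraph V) n l (fun _ => n) := by
      refine ⟨h.inj, h.surj, h.one_le, h.le_n, fun _ _ _ => le_rfl, fun _ => le_rfl, fun _ hi => hi,
        fun _ _ hi => hi, fun u v huv => ?_⟩
      simp only [h.le_n v, iff_true, SimpleGraph.top_adj]
      rintro rfl
      omega
    have h1 := htop.hasRegularSeq_of_singleOverlap (K := K) hn (fun j _ hj => (lt_irrefl _ hj).elim)
    refine (h1.le_ringKrullDim (g := 1) (Q := binomialEdgeIdeal K ⊤) (one_notMem_of_notMem ?_)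
      (by simp)).trans ?_
    · rw [binomialEdgeIdeal_eq_mixedIdeal]
      exact mixedIdeal_le_idealOfVars _ _ _
    · have hle : binomialEdgeIdeal K G ≤ binomialEdgeIdeal K ⊤ := by
        refine Ideal.span_le.2 ?_
        rintro _ ⟨i, j, hij, rfl⟩
        exact edgeMinor_mem_binomialEdgeIdeal (G := ⊤) hij.ne
      exact ringKrullDim_le_of_surjective (Ideal.Quotient.factor hle)
        (Ideal.Quotient.factor_surjective hle)

/-- A maximal clique sharing three vertices with a later one lowers the depth below `n`. -/
lemma IntervalLabelling.not_hasRegularSeq_of_overlap_three [Finite V]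
    (h : IntervalLabelling G n l r) {j : ℕ} (hj : 1 ≤ j) (hjn : r j < n) (hr : r j < r (r j - 2)) :
    ¬ HasRegularSeq (idealOfVars (V ⊕ V) K) (binomialEdgeIdeal K G) n := by
  intro hseq
  classical
  set q := r j with hq
  have hex : ∃ a, q < r a := ⟨_, hr⟩
  -- `a` is the first vertex seeing beyond `q`, so `[a, q]` is the overlap with the next clique and
  -- separates the labels below `a` from those above `q`.
  obtain ⟨a, ha, hmin⟩ : ∃ a, q < r a ∧ ∀ i < a, r i ≤ q :=
    ⟨Nat.find hex, Nat.find_spec hex, fun i hi => not_lt.1 (Nat.find_min hex hi)⟩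
  have haq : a ≤ q - 2 := by
    by_contra hc
    have := hmin (q - 2) (by omega)
    omega
  have hja : j < a := by
    by_contra hc
    have := h.mono a j (by omega)
    omega
  have hra : r (a - 1) = q := le_antisymm (hmin _ (by omega)) (h.mono _ _ (by omega))
  obtain ⟨x, hx⟩ := h.surj (a - 1) (by omega) (by omega)
  obtain ⟨y, hy⟩ := h.surj (q + 1) (by omega) (by omega)
  have hdim := h.ringKrullDim_le (K := K) (by omega) (Finset.Icc a q) {1, q + 1} (by
    intro i hi hin hiT hi'
    simp only [Finset.mem_Icc, Finset.mem_insert, Finset.mem_singleton] at *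
    omega)
  have hcard : (Finset.Icc 1 n \ Finset.Icc a q).card + ({1, q + 1} : Finset ℕ).card ≤ n - 1 := by
    have h1 := Finset.card_sdiff_add_card_eq_card (s := Finset.Icc a q) (t := Finset.Icc 1 n)
      (Finset.Icc_subset_Icc (by omega) (by omega))
    have h2 := Finset.card_le_two (a := 1) (b := q + 1)
    rw [Nat.card_Icc, Nat.card_Icc] at h1
    omega
  -- `x = a - 1` and `y = q + 1` are adjacent to the whole overlap. Deleting at least three vertices
  -- leaves two intervals, hence dimension at most `n - 3 + 2`.
  have hle := hseq.le_ringKrullDim (g := edgeMinor K x y)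
    (Q := mixedIdeal K G (labelVars l (Finset.Icc a q)) ∅ Set.univ)
    (mul_notMem_binomialEdgeIdeal (A := {v | l v < a}) (B := {v | q < l v}) ?_ ?_)
    (mul_mem_of_mem_mixedIdeal le_rfl fun i hi s hs => X_mul_edgeMinor_mem ?_ ?_ hs)
  · have h2 : (n : WithBot ℕ∞) ≤ ((n - 1 : ℕ) : WithBot ℕ∞) :=
      (hle.trans hdim).trans (by exact_mod_cast hcard)
    have h3 : n ≤ n - 1 := by exact_mod_cast h2
    omega
  · intro u hu v hv
    simp only [Set.mem_ofPred_eq] at hu hv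
    rw [h.adj_iff u v (by omega)]
    have := h.mono (l u) (a - 1) (by omega)
    omega
  · rw [axisHom_edgeMinor]
    · simp
    · simp only [Set.mem_ofPred_eq]; omega
    · simp only [Set.mem_ofPred_eq]; omega
    · simp only [Set.mem_ofPred_eq]; omega
  · rw [Finset.mem_Icc] at hi
    apply edgeMinor_mem_binomialEdgeIdeal
    rw [h.adj_iff x i (by omega), hx]
    omega
  · rw [Finset.mem_Icc] at hi
    apply edgeMinor_mem_binomialEdgeIdeal
    rw [h.adj_iff i y (by omega)]
    have := h.mono _ _ hi.1
    omega

/-- A clique ending at `q` must start before `q - 1`, since `r (q - 1) > q`. -/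
lemma IsWideEnd.three_le {q : ℕ} (h : IntervalLabelling G n l r) (hq : IsWideEnd n r q) :
    3 ≤ q ∧ q ≤ r (q - 2) := by
  obtain ⟨⟨j, hj, rfl⟩, h1, h2⟩ := hq
  have h3 : j ≤ r j - 2 := by
    by_contra hc
    have := h.mono (r j - 1) j (by omega)
    omega
  exact ⟨by omega, h.mono _ _ h3⟩

/-- Two far apart pairs of maximal cliques sharing two vertices lower the depth below `n`. -/
lemma IntervalLabelling.not_hasRegularSeq_of_isWideEnd [Finite V]
    (h : IntervalLabelling G n l r) (hF : ∀ j, 1 ≤ j → r j < n → r (r j - 2) ≤ r j) {q q' : ℕ}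
    (hq : IsWideEnd n r q) (hq' : IsWideEnd n r q') (hqq' : q + 3 ≤ q') :
    ¬ HasRegularSeq (idealOfVars (V ⊕ V) K) (binomialEdgeIdeal K G) n := by
  intro hseq
  classical
  obtain ⟨hq3, hqr⟩ := hq.three_le h
  obtain ⟨-, hqr'⟩ := hq'.three_le h
  obtain ⟨⟨j, hj, hjq⟩, hqn, hqw⟩ := hq
  obtain ⟨⟨j', hj', hjq'⟩, hqn', hqw'⟩ := hq'
  have h1 : r (q - 2) ≤ q := by rw [← hjq]; exact hF j hj (by omega)
  have h2 : r (q' - 2) ≤ q' := by rw [← hjq']; exact hF j' hj' (by omega)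
  obtain ⟨x, hx⟩ := h.surj (q - 2) (by omega) (by omega)
  obtain ⟨y, hy⟩ := h.surj (q + 1) (by omega) (by omega)
  obtain ⟨x', hx'⟩ := h.surj (q' - 2) (by omega) (by omega)
  obtain ⟨y', hy'⟩ := h.surj (q' + 1) (by omega) (by omega)
  -- Two separating pairs, disjoint because of the distance: four vertices are deleted and three
  -- intervals remain, which gives `n - 4 + 3`.
  let T : Finset ℕ := {q - 1, q, q' - 1, q'}
  have hT : ∀ i, i ∈ T ↔ i = q - 1 ∨ i = q ∨ i = q' - 1 ∨ i = q' := by simp [T]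
  have hdim := h.ringKrullDim_le (K := K) (by omega) T {1, q + 1, q' + 1} (by
    intro i hi hin hiT hi'
    simp only [hT, Finset.mem_insert, Finset.mem_singleton] at *
    omega)
  have hcard : (Finset.Icc 1 n \ T).card + ({1, q + 1, q' + 1} : Finset ℕ).card ≤ n - 1 := by
    have h1 := Finset.card_sdiff_add_card_eq_card (s := T) (t := Finset.Icc 1 n) (by
      intro i hi
      rw [hT] at hi
      rw [Finset.mem_Icc]
      omega)
    have h2 := Finset.card_le_three (a := 1) (b := q + 1) (c := q' + 1)
    have h3 : T.card = 4 := by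
      rw [Finset.card_eq_succ]
      refine ⟨q - 1, {q, q' - 1, q'}, by simp; omega, rfl, ?_⟩
      rw [Finset.card_eq_three]
      exact ⟨q, q' - 1, q', by omega, by omega, by omega, rfl⟩
    rw [Nat.card_Icc] at h1
    omega
  -- Each factor is killed by the variables of its own pair. Putting the two outer intervals on one
  -- axis and the middle one on the other keeps both factors nonzero.
  have hle := hseq.le_ringKrullDim (g := edgeMinor K x y * edgeMinor K x' y')
    (Q := mixedIdeal K G (labelVars l T) ∅ Set.univ)
    (mul_notMem_binomialEdgeIdeal (A := {v | l v < q - 1 ∨ q' < l v})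
      (B := {v | q < l v ∧ l v < q' - 1}) ?_ ?_)
    (mul_mem_of_mem_mixedIdeal le_rfl fun i hi s hs => ?_)
  · have h2 : (n : WithBot ℕ∞) ≤ ((n - 1 : ℕ) : WithBot ℕ∞) :=
      (hle.trans hdim).trans (by exact_mod_cast hcard)
    have h3 : n ≤ n - 1 := by exact_mod_cast h2
    omega
  · intro u hu v hv
    simp only [Set.mem_ofPred_eq] at hu hv
    rcases hu with hu | hu
    · rw [h.adj_iff u v (by omega)]
      have := h.mono (l u) (q - 2) (by omega)
      omega
    · rw [G.adj_comm, h.adj_iff v u (by omega)]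
      have := h.mono (l v) (q' - 2) (by omega)
      omega
  · rw [map_mul, axisHom_edgeMinor, axisHom_edgeMinor']
    · simp
    all_goals simp only [Set.mem_ofPred_eq]; omega
  · have hadj : ∀ u v, l u < l v → l v ≤ r (l u) → edgeMinor K u v ∈ binomialEdgeIdeal K G :=
      fun u v huv hr => edgeMinor_mem_binomialEdgeIdeal ((h.adj_iff u v huv).2 hr)
    rw [hT] at hi
    have hcase : (l i = q - 1 ∨ l i = q) ∨ l i = q' - 1 ∨ l i = q' := by tauto
    rcases hcase with hi | hi
    · rw [← mul_assoc]
      refine Ideal.mul_mem_right _ _ (X_mul_edgeMinor_mem (hadj x i (by omega) ?_)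
        (hadj i y (by omega) ?_) hs)
      · rw [hx]; omega
      · have := h.mono (q - 1) (l i) (by omega)
        omega
    · rw [mul_left_comm]
      refine Ideal.mul_mem_left _ _ (X_mul_edgeMinor_mem (hadj x' i (by omega) ?_)
        (hadj i y' (by omega) ?_) hs)
      · rw [hx']; omega
      · have := h.mono (q' - 1) (l i) (by omega)
        omega

end Upper

/-! ### Regularity of the form `x_b - y_c` for the middle of a clique `[b - 1, b + 2]`. -/

section RegularMod

open MvPolynomial

lemma RegularMod.of_colon {R : Type u} [CommRing R] {I N : Ideal R} {x f : R}
    (hN : ∀ g, x * g ∈ I ↔ g ∈ N) (h₁ : RegularMod N f)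
    (h₂ : RegularMod (I ⊔ Ideal.span {x}) f) : RegularMod I f := by
  intro g hg
  obtain ⟨a, ha, b, hb, rfl⟩ := Submodule.mem_sup.1 (h₂ g (Ideal.mem_sup_left hg))
  obtain ⟨c, rfl⟩ := Ideal.mem_span_singleton'.1 hb
  have h3 : x * (f * c) ∈ I := by
    have := sub_mem hg (I.mul_mem_left f ha)
    have h4 : f * (a + c * x) - f * a = x * (f * c) := by ring
    rwa [h4] at this
  refine add_mem ha ?_
  rw [mul_comm]
  exact (hN c).2 (h₁ c ((hN _).1 h3))

lemma RegularMod.of_sub_mem {R : Type u} [CommRing R] {I : Ideal R} {f f' : R}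
    (h : RegularMod I f') (hf : f - f' ∈ I) : RegularMod I f := by
  intro g hg
  apply h
  have := sub_mem hg (I.mul_mem_right g hf)
  have h4 : f * g - (f - f') * g = f' * g := by ring
  rwa [h4] at this

lemma RegularMod.neg {R : Type u} [CommRing R] {I : Ideal R} {f : R}
    (h : RegularMod I f) : RegularMod I (-f) := by
  intro g hg
  apply h
  rwa [neg_mul, neg_mem_iff] at hg

/-- For linear forms `f, y` and a homogeneous ideal `I`: if `y` is regular modulo `I` and `f` is
regular modulo `I + (y)`, then `f` is regular modulo `I`. -/
lemma RegularMod.of_sup_span {σ : Type u} {K : Type v} [Field K] {I : Ideal (MvPolynomial σ K)}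
    (hI : ComponentClosed I) {f y : MvPolynomial σ K} (hf : f.IsHomogeneous 1)
    (hy : y.IsHomogeneous 1) (h₁ : RegularMod I y) (h₂ : RegularMod (I ⊔ Ideal.span {y}) f) :
    RegularMod I f := by
  -- Induction on degree: `g` is congruent modulo `I` to `c * y` with `c` of lower degree, and
  -- cancelling `y` from `y * (f * c) ∈ I` puts `f * c` in `I`.
  have key : ∀ d, ∀ g : MvPolynomial σ K, g.IsHomogeneous d → f * g ∈ I → g ∈ I := by
    intro d
    induction d with
    | zero =>
      intro g hg hfg
      obtain ⟨a, ha, b, hb, hab⟩ := Submodule.mem_sup.1 (h₂ g (Ideal.mem_sup_left hfg))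
      obtain ⟨c, rfl⟩ := Ideal.mem_span_singleton'.1 hb
      rw [← homogeneousComponent_eq_self hg, ← hab, map_add,
        homogeneousComponent_mul_of_isHomogeneous _ _ hy, if_neg (by omega), add_zero]
      exact hI a ha 0
    | succ d ih =>
      intro g hg hfg
      obtain ⟨a, ha, b, hb, hab⟩ := Submodule.mem_sup.1 (h₂ g (Ideal.mem_sup_left hfg))
      obtain ⟨c, rfl⟩ := Ideal.mem_span_singleton'.1 hb
      have hgd : g = homogeneousComponent (d + 1) a + homogeneousComponent d c * y := by
        rw [← homogeneousComponent_eq_self hg, ← hab, map_add,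
          homogeneousComponent_mul_of_isHomogeneous _ _ hy, if_pos (by omega)]
        simp
      have ha' := hI a ha (d + 1)
      rw [hgd]
      refine add_mem ha' (I.mul_mem_right _ (ih _ (homogeneousComponent_isHomogeneous _ _) ?_))
      apply h₁
      have := sub_mem hfg (I.mul_mem_left f ha')
      rw [hgd] at this
      have h4 : f * (homogeneousComponent (d + 1) a + homogeneousComponent d c * y) -
          f * homogeneousComponent (d + 1) a = y * (f * homogeneousComponent d c) := by ring
      rwa [h4] at this
  intro g hg
  rw [← sum_homogeneousComponent g]
  refine sum_mem fun d _ => key d _ (homogeneousComponent_isHomogeneous _ _) ?_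
  have := hI _ hg (d + 1)
  rw [mul_comm, homogeneousComponent_mul_of_isHomogeneous _ _ hf, if_pos (by omega),
    Nat.add_sub_cancel, mul_comm] at this
  exact this

variable {V : Type u} {K : Type v} [Field K] {G : SimpleGraph V} {n : ℕ} {l : V → ℕ} {r : ℕ → ℕ}

lemma IntervalLabelling.mixedIdeal_eq_of_forall_lt (h : IntervalLabelling G n l r)
    {Z : Set (V ⊕ V)} {A : Set V} {p : ℕ} (hA : ∀ a ∈ A, l a < p) (hr : ∀ a ∈ A, r (l a) < p) :
    mixedIdeal K G Z A (labelIci l p) = mixedIdeal K G Z ∅ (labelIci l p) := by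
  apply le_antisymm
  · refine mixedIdeal_le (fun z hz => X_mem_mixedIdeal hz) (fun i hi j hj hij => ?_)
      (fun i hi j hj hij => edgeMinor_mem_mixedIdeal hi hj hij)
    have h1 := hA i hi
    have h2 := hr i hi
    simp only [labelIci, Set.mem_ofPred_eq] at hj
    rw [h.adj_iff i j (by omega)] at hij
    omega
  · exact mixedIdeal_le (fun z hz => X_mem_mixedIdeal hz) (by simp)
      (fun i hi j hj hij => edgeMinor_mem_mixedIdeal hi hj hij)

variable {Z : Set (V ⊕ V)} {A : Set V} {b c : V}

lemma IntervalLabelling.regularMod_step (h : IntervalLabelling G n l r) {p : ℕ} {a : V}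
    {f : MvPolynomial (V ⊕ V) K} (ha : a ∈ A) (haZ : Sum.inl a ∉ Z) (hap : l a < p)
    (hpa : p ≤ r (l a))
    (h₁ : RegularMod (mixedIdeal K G (insert (Sum.inl a) Z) (A \ {a}) (labelIci l p)) f)
    (h₂ : RegularMod (mixedIdeal K G (Z ∪ Sum.inr '' (labelIci l p ∩ G.neighborSet a))
      ((A \ {a}) ∪ (labelIci l p ∩ G.neighborSet a)) (labelIci l (r (l a) + 1))) f) :
    RegularMod (mixedIdeal K G Z A (labelIci l p)) f := by
  refine RegularMod.of_colon (X_mul_mem_mixedIdeal_iff ha ?_ haZ) ?_ ?_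
  · simp only [labelIci, Set.mem_ofPred_eq]
    omega
  · rwa [h.labelIci_diff_neighborSet hap hpa]
  · rwa [mixedIdeal_sup_span_X]

/-- `x_b - y_c` is regular when `y_c` vanishes and `x_b` is not involved. -/
lemma IntervalLabelling.regularMod_sub_of_mem (h : IntervalLabelling G n l r) {p : ℕ}
    (hb : Sum.inl b ∉ Z) (hc : Sum.inr c ∈ Z) (hbp : l b < p) (hrb : r (l b) < p) :
    RegularMod (mixedIdeal K G Z A (labelIci l p)) (X (Sum.inl b) - X (Sum.inr c)) := by
  refine RegularMod.of_sub_mem (f' := X (Sum.inl b)) ?_ ?_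
  · refine regularMod_mixedIdeal_X hb (fun i hi j hj hij => ⟨?_, by simp⟩)
      (fun i hi j hj hij => ⟨?_, by simp⟩)
    · intro hib
      cases hib
      simp only [labelIci, Set.mem_ofPred_eq] at hj
      rw [h.adj_iff b j (by omega)] at hij
      omega
    · intro hib
      cases hib
      simp only [labelIci, Set.mem_ofPred_eq] at hi
      omega
  · rw [sub_sub_cancel_left, neg_mem_iff]
    exact X_mem_mixedIdeal hc

/-- The step at `b` makes one term of the form vanish on each side: with `x_b` killed, `-y_c`
remains and `c` is the first vertex of `U`; in the colon `y_c` is killed, and `x_b` occurs in no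
generator other than those in `Z`. -/
lemma IntervalLabelling.regularMod_sub_single [Finite V] (h : IntervalLabelling G n l r)
    (hbc : l c = l b + 1) (hrb : r (l b) = l b + 2)
    (hZ : ∀ u ∈ labelIci l (l b + 1), Sum.inl u ∉ Z ∧ Sum.inr u ∉ Z) (hA : ∀ a ∈ A, l a < l b + 1)
    (hAr : ∀ a ∈ A, l b + 1 ≤ r (l a) → a = b) (hbA : b ∈ A) (hbZ : Sum.inl b ∉ Z) :
    RegularMod (mixedIdeal K G Z A (labelIci l (l b + 1))) (X (Sum.inl b) - X (Sum.inr c)) := by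
  refine h.regularMod_step hbA hbZ (by omega) (by omega) ?_ ?_
  · rw [h.mixedIdeal_eq_of_forall_lt (fun a ha => hA a ha.1) (fun a ha => ?_)]
    · refine RegularMod.of_sub_mem (f' := - X (Sum.inr c)) (RegularMod.neg ?_) ?_
      · rw [← hbc]
        refine h.regularMod c _ fun u hu => ?_
        have h1 := hZ u (by rwa [hbc] at hu)
        simp only [labelIci, Set.mem_ofPred_eq] at hu
        simp only [Set.mem_insert_iff, Sum.inl.injEq, reduceCtorEq, false_or, not_or]
        exact ⟨⟨by rintro rfl; omega, h1.1⟩, h1.2⟩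
      · rw [sub_neg_eq_add, sub_add_cancel]
        exact X_mem_mixedIdeal (Or.inl rfl)
    · by_contra hcon
      exact ha.2 (hAr a ha.1 (by omega))
  · refine h.regularMod_sub_of_mem ?_ ?_ (by omega) (by omega)
    · simpa using hbZ
    · refine Or.inr ⟨c, ?_, rfl⟩
      rw [h.mem_labelIci_inter_neighborSet (by omega)]
      omega

lemma IntervalLabelling.regularMod_sub_pair [Finite V] (h : IntervalLabelling G n l r)
    (hbc : l c = l b + 1) (hrb : r (l b) = l b + 2) (hrb' : r (l b - 1) = l b + 2)
    (hZ : ∀ u ∈ labelIci l (l b + 1), Sum.inl u ∉ Z ∧ Sum.inr u ∉ Z) (hA : ∀ a ∈ A, l a < l b + 1)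
    (hAZ : ∀ a ∈ A, Sum.inl a ∉ Z)
    (hAr : ∀ a ∈ A, l b + 1 ≤ r (l a) → l a = l b - 1 ∨ a = b) (hbA : b ∈ A) :
    RegularMod (mixedIdeal K G Z A (labelIci l (l b + 1))) (X (Sum.inl b) - X (Sum.inr c)) := by
  by_cases hex : ∃ a ∈ A, l a = l b - 1
  swap
  · push Not at hex
    exact h.regularMod_sub_single hbc hrb hZ hA
      (fun a ha har => (hAr a ha har).resolve_left (hex a ha)) hbA (hAZ b hbA)
  obtain ⟨a, ha, hab⟩ := hex
  have hb1 := h.one_le b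
  have ha1 := h.one_le a
  have hbZ := hAZ b hbA
  have hne : b ≠ a := by rintro rfl; omega
  refine h.regularMod_step ha (hAZ a ha) (by omega) (by rw [hab]; omega) ?_ ?_
  · refine h.regularMod_sub_single hbc hrb ?_ (fun x hx => hA x hx.1) ?_ ⟨hbA, hne⟩ ?_
    · intro u hu
      have h1 := hZ u hu
      simp only [labelIci, Set.mem_ofPred_eq] at hu
      simp only [Set.mem_insert_iff, Sum.inl.injEq, reduceCtorEq, false_or, not_or]
      exact ⟨⟨by rintro rfl; omega, h1.1⟩, h1.2⟩
    · intro x hx hxr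
      refine (hAr x hx.1 hxr).resolve_left fun hxb => hx.2 (h.inj (by omega))
    · simpa [hne] using hbZ
  · rw [hab, hrb']
    refine h.regularMod_sub_of_mem ?_ ?_ (by omega) (by omega)
    · simpa using hbZ
    · refine Or.inr ⟨c, ?_, rfl⟩
      rw [h.mem_labelIci_inter_neighborSet (by omega), hab]
      omega

/-- The recursion is that of the depth bounds, now transporting regularity. Before it passes `b` it
either reaches the colon at `b - 1`, which kills `y_c` and leaves `x_b` free, or arrives at `U = [b
+ 1, n]` with `b` and possibly `b - 1` as effective vertices. -/
lemma IntervalLabelling.regularMod_sub [Finite V] (h : IntervalLabelling G n l r)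
    (hbc : l c = l b + 1) (hrb : r (l b) = l b + 2) (hrb' : r (l b - 1) = l b + 2)
    (hrb'' : r (l b - 2) = l b) :
    ∀ p, 1 ≤ p → p ≤ l b → ∀ (A : Set V) (Z : Set (V ⊕ V)),
    (∀ u ∈ labelIci l p, Sum.inl u ∉ Z ∧ Sum.inr u ∉ Z) → (∀ a ∈ A, l a < p) →
    (∀ a ∈ A, Sum.inl a ∉ Z) →
    RegularMod (mixedIdeal K G Z A (labelIci l p)) (X (Sum.inl b) - X (Sum.inr c)) := by
  intro p
  obtain ⟨d, hd⟩ : ∃ d, l b - p = d := ⟨_, rfl⟩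
  induction d using Nat.strong_induction_on generalizing p with
  | _ d ih =>
  intro hp hpb
  -- Here `y_p` is regular as well, so homogeneity allows testing the form after dividing by `y_p`.
  have hempty : ∀ Z : Set (V ⊕ V), (∀ u ∈ labelIci l p, Sum.inl u ∉ Z ∧ Sum.inr u ∉ Z) →
      RegularMod (mixedIdeal K G Z ∅ (labelIci l p)) (X (Sum.inl b) - X (Sum.inr c)) := by
    intro Z hZ
    obtain ⟨v, rfl⟩ := h.surj p hp (hpb.trans (h.le_n b))
    refine RegularMod.of_sup_span (mixedIdeal_componentClosed _ _ _)
      ((isHomogeneous_X _ _).sub (isHomogeneous_X _ _)) (isHomogeneous_X _ _)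
      (h.regularMod v Z hZ) ?_
    rw [mixedIdeal_empty_sup_span_X (mem_labelIci_self l v), h.labelIci_diff_singleton]
    have hZ' : ∀ u ∈ labelIci l (l v + 1), Sum.inl u ∉ insert (Sum.inr v) Z ∧
        Sum.inr u ∉ insert (Sum.inr v) Z := by
      intro u hu
      simp only [labelIci, Set.mem_ofPred_eq] at hu
      have h1 := hZ u (by simp only [labelIci, Set.mem_ofPred_eq]; omega)
      simp only [Set.mem_insert_iff, Sum.inr.injEq, reduceCtorEq, false_or, not_or]
      exact ⟨h1.1, by rintro rfl; omega, h1.2⟩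
    have hvZ : Sum.inl v ∉ insert (Sum.inr v) Z := by
      simpa using (hZ v (mem_labelIci_self l v)).1
    by_cases hvb : v = b
    · subst hvb
      exact h.regularMod_sub_single hbc hrb hZ' (by simp) (by simp) rfl hvZ
    · have hlt : l v < l b := lt_of_le_of_ne hpb fun e => hvb (h.inj e)
      exact ih _ (by omega) (l v + 1) rfl (by omega) (by omega) _ _ hZ' (by simp)
        (by simpa using hvZ)
  intro A
  obtain ⟨N, hN⟩ : ∃ N, A.ncard = N := ⟨_, rfl⟩
  induction N generalizing A with
  | zero =>
    intro Z hZ _ _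
    rw [Set.ncard_eq_zero (Set.toFinite A)] at hN
    rw [hN]
    exact hempty Z hZ
  | succ N ihN =>
    intro Z hZ hA hAZ
    by_cases hex : ∃ a ∈ A, p ≤ r (l a)
    swap
    · push Not at hex
      rw [h.mixedIdeal_eq_of_forall_lt hA hex]
      exact hempty Z hZ
    obtain ⟨a, ha, hpa⟩ := hex
    have hap := hA a ha
    have ha1 := h.one_le a
    refine h.regularMod_step ha (hAZ a ha) hap hpa ?_ ?_
    · refine ihN _ ?_ _ ?_ (fun x hx => hA x hx.1) ?_
      · have := Set.ncard_sdiff_singleton_add_one ha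
        omega
      · intro u hu
        have h1 := hZ u hu
        simp only [labelIci, Set.mem_ofPred_eq] at hu
        simp only [Set.mem_insert_iff, Sum.inl.injEq, reduceCtorEq, false_or, not_or]
        exact ⟨⟨by rintro rfl; omega, h1.1⟩, h1.2⟩
      · rintro x hx (hxa | hxZ)
        · cases hxa
          exact hx.2 rfl
        · exact hAZ x hx.1 hxZ
    · have hbZ := hZ b hpb
      have hZ' : ∀ u ∈ labelIci l (r (l a) + 1),
          Sum.inl u ∉ Z ∪ Sum.inr '' (labelIci l p ∩ G.neighborSet a) ∧
          Sum.inr u ∉ Z ∪ Sum.inr '' (labelIci l p ∩ G.neighborSet a) := by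
        intro u hu
        simp only [labelIci, Set.mem_ofPred_eq] at hu
        have h1 := hZ u (by simp only [labelIci, Set.mem_ofPred_eq]; omega)
        refine ⟨?_, ?_⟩
        · rintro (h2 | ⟨_, _, h2⟩)
          · exact h1.1 h2
          · cases h2
        · rintro (h2 | ⟨w, hw, h2⟩)
          · exact h1.2 h2
          · cases h2
            rw [h.mem_labelIci_inter_neighborSet hap] at hw
            omega
      have hA' : ∀ x ∈ (A \ {a}) ∪ (labelIci l p ∩ G.neighborSet a), l x < r (l a) + 1 := by
        rintro x (hx | hx)
        · have := hA x hx.1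
          omega
        · rw [h.mem_labelIci_inter_neighborSet hap] at hx
          omega
      have hAZ' : ∀ x ∈ (A \ {a}) ∪ (labelIci l p ∩ G.neighborSet a),
          Sum.inl x ∉ Z ∪ Sum.inr '' (labelIci l p ∩ G.neighborSet a) := by
        rintro x hx (h2 | ⟨_, _, h2⟩)
        · rcases hx with hx | hx
          · exact hAZ x hx.1 h2
          · exact (hZ x hx.1).1 h2
        · cases h2
      by_cases hrab : r (l a) < l b
      · exact ih _ (by omega) (r (l a) + 1) rfl (by omega) (by omega) _ _ hZ' hA' hAZ'
      by_cases hab : l a = l b - 1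
      · rw [hab, hrb']
        refine h.regularMod_sub_of_mem ?_ ?_ (by omega) (by omega)
        · simpa using hbZ.1
        · refine Or.inr ⟨c, ?_, rfl⟩
          rw [h.mem_labelIci_inter_neighborSet hap, hab]
          omega
      -- The remaining `a` is at most `b - 2`, so it sees no further than `r (b - 2) = b`.
      · have hra : r (l a) = l b := by
          have := h.mono (l a) (l b - 2) (by omega)
          omega
        rw [hra] at hZ' hA' ⊢
        refine h.regularMod_sub_pair hbc hrb hrb' hZ' hA' hAZ' ?_ (Or.inr ?_)
        · intro x hx hxr
          have h1 := hA' x hx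
          by_cases hxb : l x ≤ l b - 2
          · have := h.mono _ _ hxb
            omega
          · by_cases hxb' : l x = l b
            · exact Or.inr (h.inj hxb')
            · left; omega
        · rw [h.mem_labelIci_inter_neighborSet hap]
          omega

end RegularMod

/-! ### The obstruction from a clique `[q - 1, q + 2]` between two wide ends. -/

section DualWitness

open MvPolynomial

variable {V : Type u} {K : Type v} [Field K] {G : SimpleGraph V} {n : ℕ} {l : V → ℕ} {r : ℕ → ℕ}

open Classical in
/-- The points `(t, 0)` at the vertices in `A`, `(0, t)` at those in `B`, and the infinitesimal
points `(ε, 0)` at `b` and `(0, ε)` at `c`. -/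
noncomputable def dualHom (K : Type v) [Field K] (A B : Set V) (b c : V) :
    MvPolynomial (V ⊕ V) K →+* DualNumber (Polynomial K) :=
  eval₂Hom ((TrivSqZeroExt.inlHom (Polynomial K) (Polynomial K)).comp Polynomial.C)
    (Sum.elim
      (fun v => if v ∈ A then TrivSqZeroExt.inl Polynomial.X
        else if v = b then DualNumber.eps else 0)
      (fun v => if v ∈ B then TrivSqZeroExt.inl Polynomial.X
        else if v = c then DualNumber.eps else 0))

lemma dualHom_fst_ne_zero {A B : Set V} {b c : V} {s : MvPolynomial (V ⊕ V) K}
    (hs : s ∉ idealOfVars _ K) : (dualHom K A B b c s).fst ≠ 0 := by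
  have h : (Polynomial.evalRingHom (0 : K)).comp
      ((TrivSqZeroExt.fstHom (Polynomial K) (Polynomial K) (Polynomial K)).toRingHom.comp
        (dualHom K A B b c)) = constantCoeff := by
    apply ringHom_ext
    · intro a
      simp [dualHom]
    · rintro (v | v)
      · by_cases hv : v ∈ A
        · simp [dualHom, hv]
        · by_cases hv' : v = b
          · subst hv'
            simp [dualHom, hv]
          · simp [dualHom, hv, hv']
      · by_cases hv : v ∈ B
        · simp [dualHom, hv]
        · by_cases hv' : v = c
          · subst hv'
            simp [dualHom, hv]
          · simp [dualHom, hv, hv']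
  rw [mem_idealOfVars_iff, ← h] at hs
  intro h0
  apply hs
  simp [h0]

/-- Compared with the axis points, the only new product that could be nonzero is `x_b y_c`, and it
maps to `ε ^ 2 = 0`. So `b` and `c` may be adjacent. -/
lemma dualHom_mul_eq_zero {A B : Set V} {b c i j : V} (hAB : ∀ x ∈ A, ∀ y ∈ B, ¬ G.Adj x y)
    (hb : ∀ y ∈ B, ¬ G.Adj b y) (hc : ∀ x ∈ A, ¬ G.Adj x c) (h : G.Adj i j) :
    dualHom K A B b c (X (Sum.inl i)) * dualHom K A B b c (X (Sum.inr j)) = 0 := by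
  by_cases hi : i ∈ A
  · have hj : j ∉ B := fun hj => hAB i hi j hj h
    have hjc : j ≠ c := fun e => hc i hi (e ▸ h)
    simp [dualHom, hj, hjc]
  by_cases hib : i = b
  swap
  · simp [dualHom, hi, hib]
  subst hib
  have hj : j ∉ B := fun hj => hb j hj h
  by_cases hjc : j = c
  · simp only [dualHom, coe_eval₂Hom, eval₂_X, Sum.elim_inl, Sum.elim_inr, hi, hjc, if_false,
      if_true]
    rw [if_neg (hjc ▸ hj)]
    exact DualNumber.eps_mul_eps
  · simp [dualHom, hj, hjc]

/-- The class maps to `ε t ^ 2`, while `s` has nonzero finite part. The form dies because `x_b` and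
`y_c` both map to `ε`. -/
lemma mul_notMem_of_dualHom {A B : Set V} {b c x y : V} (hAB : ∀ x ∈ A, ∀ y ∈ B, ¬ G.Adj x y)
    (hb : ∀ y ∈ B, ¬ G.Adj b y) (hc : ∀ x ∈ A, ¬ G.Adj x c) (hbA : b ∉ A) (hcB : c ∉ B)
    (hx : x ∈ A) (hxB : x ∉ B) (hxc : x ≠ c) (hy : y ∈ B)
    (s : MvPolynomial (V ⊕ V) K) (hs : s ∉ idealOfVars _ K) :
    s * (X (Sum.inl b) * edgeMinor K x y) ∉
      binomialEdgeIdeal K G ⊔ Ideal.span {X (Sum.inl b) - X (Sum.inr c)} := by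
  intro h
  have hle : binomialEdgeIdeal K G ⊔ Ideal.span {X (Sum.inl b) - X (Sum.inr c)} ≤
      RingHom.ker (dualHom K A B b c) := by
    refine sup_le (Ideal.span_le.2 ?_) ?_
    · rintro _ ⟨i, j, hij, rfl⟩
      rw [SetLike.mem_coe, RingHom.mem_ker, map_sub, map_mul, map_mul,
        dualHom_mul_eq_zero hAB hb hc hij, dualHom_mul_eq_zero hAB hb hc hij.symm, sub_zero]
    · rw [Ideal.span_singleton_le_iff_mem, RingHom.mem_ker]
      simp [dualHom, hbA, hcB]
  have h1 := congrArg TrivSqZeroExt.snd ((RingHom.mem_ker).1 (hle h))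
  rw [map_mul, TrivSqZeroExt.snd_mul] at h1
  have h2 : dualHom K A B b c (X (Sum.inl b) * edgeMinor K x y) =
      TrivSqZeroExt.inr (Polynomial.X ^ 2) := by
    have h3 : dualHom K A B b c (X (Sum.inl b)) = DualNumber.eps := by simp [dualHom, hbA]
    have h4 : dualHom K A B b c (X (Sum.inl x)) = TrivSqZeroExt.inl Polynomial.X := by
      simp [dualHom, hx]
    have h5 : dualHom K A B b c (X (Sum.inr y)) = TrivSqZeroExt.inl Polynomial.X := by
      simp [dualHom, hy]
    have h6 : dualHom K A B b c (X (Sum.inr x)) = 0 := by simp [dualHom, hxB, hxc]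
    rw [edgeMinor, map_mul, map_sub, map_mul, map_mul, h3, h4, h5, h6, mul_zero, sub_zero,
      DualNumber.eps, ← TrivSqZeroExt.inl_mul, TrivSqZeroExt.inr_mul_inl, ← pow_two]
    simp
  rw [h2] at h1
  simp [dualHom_fst_ne_zero hs] at h1

/-- Two maximal cliques `[·, b]`, `[b - 1, b + 2]`, `[b + 1, ·]` lower the depth below `n`. -/
lemma IntervalLabelling.not_hasRegularSeq_of_isWideEnd_add_two [Finite V]
    (h : IntervalLabelling G n l r) (hF : ∀ j, 1 ≤ j → r j < n → r (r j - 2) ≤ r j) {q : ℕ}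
    (hq : IsWideEnd n r q) (hq' : IsWideEnd n r (q + 2)) (hr : r (q - 1) ≠ q + 1) :
    ¬ HasRegularSeq (idealOfVars (V ⊕ V) K) (binomialEdgeIdeal K G) n := by
  intro hseq
  classical
  obtain ⟨hq3, hqr⟩ := hq.three_le h
  obtain ⟨⟨j, hj, hjq⟩, hqn, hqw⟩ := hq
  obtain ⟨⟨j', hj', hjq'⟩, hqn', hqw'⟩ := hq'
  have h1 : r (q - 2) = q := le_antisymm (by rw [← hjq]; exact hF j hj (by omega)) hqr
  have h2 : r q ≤ q + 2 := by have := hF j' hj' (by omega); rwa [hjq'] at this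
  have h3 := h.mono (q - 1) q (by omega)
  have h4 : r (q - 1) = q + 2 := by omega
  have h5 : r q = q + 2 := by omega
  have h6 : q + 2 < r (q + 1) := hqw'
  obtain ⟨b, hb⟩ := h.surj q (by omega) (by omega)
  obtain ⟨c, hc⟩ := h.surj (q + 1) (by omega) (by omega)
  obtain ⟨x, hx⟩ := h.surj (q - 2) (by omega) (by omega)
  obtain ⟨y, hy⟩ := h.surj (q + 3) (by omega) (by omega)
  set f : MvPolynomial (V ⊕ V) K := X (Sum.inl b) - X (Sum.inr c) with hf
  have hreg : RegularMod (binomialEdgeIdeal K G) f := by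
    have h7 : labelIci l 1 = Set.univ := Set.eq_univ_of_forall fun v => h.one_le v
    rw [binomialEdgeIdeal_eq_mixedIdeal, ← h7]
    subst hb
    exact h.regularMod_sub hc h5 h4 h1 1 le_rfl (by omega) ∅ ∅ (by simp) (by simp) (by simp)
  have hJ : binomialEdgeIdeal K G ≤ idealOfVars (V ⊕ V) K := by
    rw [binomialEdgeIdeal_eq_mixedIdeal]
    exact mixedIdeal_le_idealOfVars _ _ _
  obtain ⟨k, rfl⟩ : ∃ k, n = k + 1 := ⟨n - 1, by omega⟩
  -- Cutting by `f` leaves length `k = n - 1`. Deleting the four vertices of the middle clique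
  -- leaves two intervals and dimension at most `k - 1`.
  have hseq' := hseq.quotient_of_regularMod (idealOfVars_ne_top _ _) hJ
    (sub_mem (X_mem_idealOfVars K (Sum.inl b)) (X_mem_idealOfVars K (Sum.inr c))) hreg
  rw [← hf] at hseq'
  let T : Finset ℕ := Finset.Icc (q - 1) (q + 2)
  have hdim := h.ringKrullDim_le (K := K) (by omega) T {1, q + 3} (by
    intro i hi hin hiT hi'
    simp only [T, Finset.mem_Icc, Finset.mem_insert, Finset.mem_singleton] at *
    omega)
  have hcard : (Finset.Icc 1 (k + 1) \ T).card + ({1, q + 3} : Finset ℕ).card ≤ k - 1 := by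
    have h1 := Finset.card_sdiff_add_card_eq_card (s := T) (t := Finset.Icc 1 (k + 1))
      (Finset.Icc_subset_Icc (by omega) (by omega))
    have h2 := Finset.card_le_two (a := 1) (b := q + 3)
    rw [Nat.card_Icc, Nat.card_Icc] at h1
    omega
  have hadj : ∀ u v, l u < l v → l v ≤ r (l u) → edgeMinor K u v ∈ binomialEdgeIdeal K G :=
    fun u v huv hr => edgeMinor_mem_binomialEdgeIdeal ((h.adj_iff u v huv).2 hr)
  have hle := hseq'.le_ringKrullDim (g := X (Sum.inl b) * edgeMinor K x y)
    (Q := mixedIdeal K G (labelVars l T) ∅ Set.univ)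
    (mul_notMem_of_dualHom (A := {v | l v ≤ q - 2}) (B := {v | q + 3 ≤ l v})
      ?_ ?_ ?_ ?_ ?_ ?_ ?_ ?_ ?_)
    (mul_mem_of_mem_mixedIdeal le_sup_left fun i hi s hs => ?_)
  · have h2 : (k : WithBot ℕ∞) ≤ ((k - 1 : ℕ) : WithBot ℕ∞) :=
      (hle.trans hdim).trans (by exact_mod_cast hcard)
    have h3 : k ≤ k - 1 := by exact_mod_cast h2
    omega
  · intro u hu v hv
    simp only [Set.mem_ofPred_eq] at hu hv
    rw [h.adj_iff u v (by omega)]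
    have := h.mono _ _ hu
    omega
  · intro v hv
    simp only [Set.mem_ofPred_eq] at hv
    rw [h.adj_iff b v (by omega), hb]
    omega
  · intro u hu
    simp only [Set.mem_ofPred_eq] at hu
    rw [h.adj_iff u c (by omega)]
    have := h.mono _ _ hu
    omega
  · simp only [Set.mem_ofPred_eq]; omega
  · simp only [Set.mem_ofPred_eq]; omega
  · simp only [Set.mem_ofPred_eq]; omega
  · simp only [Set.mem_ofPred_eq]; omega
  · rintro rfl; omega
  · simp only [Set.mem_ofPred_eq]; omega
  · rw [Finset.mem_Icc] at hi
    set I := binomialEdgeIdeal K G ⊔ Ideal.span {f} with hI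
    have hJI : binomialEdgeIdeal K G ≤ I := le_sup_left
    -- On the left half of `T`, `x_b` is replaced by `y_c` modulo `f` before using the Plücker
    -- relation through `c`. On the right half the relation through `b` suffices without `f`.
    by_cases hiq : l i ≤ q
    · have h7 : X s * edgeMinor K x c ∈ I := by
        refine hJI (X_mul_edgeMinor_mem (hadj x i (by omega) ?_) (hadj i c (by omega) ?_) hs)
        · rw [hx]; omega
        · have := h.mono _ _ hi.1
          omega
      have h8 : edgeMinor K c y ∈ I := hJI (hadj c y (by omega) (by rw [hc]; omega))
      have h9 : f ∈ I := Ideal.mem_sup_right (Ideal.mem_span_singleton_self f)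
      have h10 : X s * (X (Sum.inl b) * edgeMinor K x y) = X s * edgeMinor K x y * f +
          X s * X (Sum.inr x) * edgeMinor K c y + X (Sum.inr y) * (X s * edgeMinor K x c) := by
        simp only [edgeMinor, hf]
        ring
      rw [h10]
      exact add_mem (add_mem (I.mul_mem_left _ h9) (I.mul_mem_left _ h8)) (I.mul_mem_left _ h7)
    · have h7 : X s * edgeMinor K b y ∈ I := by
        refine hJI (X_mul_edgeMinor_mem (hadj b i (by omega) ?_) (hadj i y (by omega) ?_) hs)
        · rw [hb]; omega
        · have := h.mono (q + 1) (l i) (by omega)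
          omega
      have h8 : edgeMinor K x b ∈ I := hJI (hadj x b (by omega) (by rw [hx]; omega))
      have h10 : X s * (X (Sum.inl b) * edgeMinor K x y) =
          X (Sum.inl x) * (X s * edgeMinor K b y) +
          X s * X (Sum.inl y) * edgeMinor K x b := by
        simp only [edgeMinor]
        ring
      rw [h10]
      exact add_mem (I.mul_mem_left _ h7) (I.mul_mem_left _ h8)

lemma IntervalLabelling.isNarrow_of_hasRegularSeq [Finite V] (h : IntervalLabelling G n l r)
    (hseq : HasRegularSeq (idealOfVars (V ⊕ V) K) (binomialEdgeIdeal K G) n) : IsNarrow n r := by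
  have hF : ∀ j, 1 ≤ j → r j < n → r (r j - 2) ≤ r j := by
    intro j hj hjn
    by_contra hc
    exact h.not_hasRegularSeq_of_overlap_three hj hjn (by omega) hseq
  refine ⟨hF, fun q q' hq hq' hqq' => ?_⟩
  have h1 : q' ≤ q + 2 := by
    by_contra hc
    exact h.not_hasRegularSeq_of_isWideEnd hF hq hq' (by omega) hseq
  refine ⟨h1, ?_⟩
  rintro rfl
  by_contra hc
  exact h.not_hasRegularSeq_of_isWideEnd_add_two hF hq hq' hc hseq

end DualWitness

/-! ### Almost Cohen-Macaulayness in terms of the labelling. -/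

section Depth

open MvPolynomial

variable {V : Type u} {K : Type v} [Field K] {G : SimpleGraph V} {n : ℕ} {l : V → ℕ} {r : ℕ → ℕ}

lemma HasRegularSeq.le_gradedDepth {σ : Type u} {J : Ideal (MvPolynomial σ K)} {k : ℕ}
    (h : HasRegularSeq (idealOfVars σ K) J k) :
    (k : ℕ∞) ≤ gradedDepth σ K (MvPolynomial σ K ⧸ J) := by
  obtain ⟨rs, rfl, hmem, hrs⟩ := h
  exact le_iSup₂_of_le rs ⟨hrs, hmem⟩ le_rfl

lemma gradedDepth_le {σ : Type u} {J : Ideal (MvPolynomial σ K)} {k : ℕ}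
    (h : ∀ j, HasRegularSeq (idealOfVars σ K) J j → j ≤ k) :
    gradedDepth σ K (MvPolynomial σ K ⧸ J) ≤ k :=
  iSup₂_le fun rs hrs => by exact_mod_cast h _ ⟨rs, rfl, hrs.2, hrs.1⟩

lemma binomialEdgeIdeal_le_idealOfVars : binomialEdgeIdeal K G ≤ idealOfVars (V ⊕ V) K := by
  rw [binomialEdgeIdeal_eq_mixedIdeal]
  exact mixedIdeal_le_idealOfVars _ _ _

lemma IntervalLabelling.supportDim_eq [Finite V] (h : IntervalLabelling G n l r) (hn : 1 ≤ n) :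
    Module.supportDim (MvPolynomial (V ⊕ V) K) (MvPolynomial (V ⊕ V) K ⧸ binomialEdgeIdeal K G) =
      ((n + 1 : ℕ) : WithBot ℕ∞) := by
  rw [Module.supportDim_quotient_eq_ringKrullDim, h.ringKrullDim_binomialEdgeIdeal hn]

lemma IntervalLabelling.isCohenMacaulayIdeal [Finite V] (h : IntervalLabelling G n l r)
    (hn : 1 ≤ n) (hC : SingleOverlapFrom n r 1) : IsCohenMacaulayIdeal (binomialEdgeIdeal K G) := by
  rw [IsCohenMacaulayIdeal, h.supportDim_eq hn]
  have h1 : gradedDepth (V ⊕ V) K (MvPolynomial (V ⊕ V) K ⧸ binomialEdgeIdeal K G) =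
      ((n + 1 : ℕ) : ℕ∞) := by
    refine le_antisymm (gradedDepth_le fun j hj => ?_)
      (h.hasRegularSeq_of_singleOverlap hn hC).le_gradedDepth
    have h2 := hj.le_ringKrullDim (g := 1) (Q := binomialEdgeIdeal K G)
      (one_notMem_of_notMem binomialEdgeIdeal_le_idealOfVars) (by simp)
    rw [h.ringKrullDim_binomialEdgeIdeal hn] at h2
    exact_mod_cast h2
  rw [h1]
  rfl

lemma IntervalLabelling.isAlmostCohenMacaulayIdeal_iff [Finite V] (h : IntervalLabelling G n l r)
    (hn : 1 ≤ n) : IsAlmostCohenMacaulayIdeal (binomialEdgeIdeal K G) ↔ IsNarrow n r := by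
  rw [IsAlmostCohenMacaulayIdeal, h.supportDim_eq hn]
  constructor
  · intro hle
    apply h.isNarrow_of_hasRegularSeq (K := K)
    by_contra hc
    have h1 : gradedDepth (V ⊕ V) K (MvPolynomial (V ⊕ V) K ⧸ binomialEdgeIdeal K G) ≤
        ((n - 1 : ℕ) : ℕ∞) := by
      refine gradedDepth_le fun j hj => ?_
      by_contra hjn
      exact hc (hj.mono (idealOfVars_ne_top _ _) binomialEdgeIdeal_le_idealOfVars (by omega))
    have h2 : ((n + 1 : ℕ) : WithBot ℕ∞) ≤ (((n - 1 : ℕ) : ℕ∞) : WithBot ℕ∞) + 1 :=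
      hle.trans (by gcongr; exact_mod_cast h1)
    have h3 : n + 1 ≤ n - 1 + 1 := by exact_mod_cast h2
    omega
  · intro hN
    have h1 := (h.hasRegularSeq_of_isNarrow (K := K) hN).le_gradedDepth
    have h2 : (((n : ℕ) : ℕ∞) : WithBot ℕ∞) ≤
      (gradedDepth (V ⊕ V) K (MvPolynomial (V ⊕ V) K ⧸ binomialEdgeIdeal K G) : WithBot ℕ∞) := by
      exact_mod_cast h1
    calc ((n + 1 : ℕ) : WithBot ℕ∞) = (((n : ℕ) : ℕ∞) : WithBot ℕ∞) + 1 := by push_cast; rfl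
      _ ≤ _ := by gcongr

end Depth

/-! ### From closed labellings to interval labellings. -/

section Labelling

variable {V : Type u} {G : SimpleGraph V}

open Relation

/-- In an order satisfying half of the closedness condition, two vertices reachable from a common
one by increasing paths are joined by an increasing path. -/
lemma reflTransGen_comparable {R : V → V → Prop}
    (hR : ∀ u v w, R u v → R u w → v ≠ w → R v w ∨ R w v) {w u v : V}
    (hwu : ReflTransGen R w u) (hwv : R w v) : ReflTransGen R u v ∨ ReflTransGen R v u := by
  induction hwu using ReflTransGen.head_induction_on with
  | refl => exact Or.inl (.single hwv)
  | head h h' ih =>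
    rename_i a c
    by_cases hcv : c = v
    · exact Or.inr (hcv ▸ h')
    · rcases hR a c v h hwv hcv with h1 | h1
      · exact ih h1
      · exact Or.inr (.head h1 h')

/-- Induction along a walk: where it turns, one of the two closedness conditions shows that the two
increasing paths sharing an end can be compared. -/
lemma SimpleGraph.Connected.reflTransGen_comparable (hconn : G.Connected) {l : V → ℕ}
    (hl : Function.Injective l)
    (h₁ : ∀ u v w, G.Adj u v → G.Adj u w → l u < l v → l u < l w → v ≠ w → G.Adj v w)
    (h₂ : ∀ u v w, G.Adj v u → G.Adj w u → l v < l u → l w < l u → v ≠ w → G.Adj v w) (u v : V) :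
    ReflTransGen (fun a b => G.Adj a b ∧ l a < l b) u v ∨
      ReflTransGen (fun a b => G.Adj a b ∧ l a < l b) v u := by
  obtain ⟨p⟩ := hconn.preconnected u v
  induction p with
  | nil => exact Or.inl .refl
  | cons h p ih =>
    rename_i a b c
    have hne : l a ≠ l b := fun e => h.ne (hl e)
    rcases ih with ih | ih
    · rcases lt_or_gt_of_ne hne with hab | hab
      · exact Or.inl (.head ⟨h, hab⟩ ih)
      · rw [or_comm]
        refine _root_.reflTransGen_comparable ?_ ih ⟨h.symm, hab⟩
        rintro x y z ⟨hy, hy'⟩ ⟨hz, hz'⟩ hyz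
        have h3 := h₁ x y z hy hz hy' hz' hyz
        rcases lt_or_gt_of_ne (fun e => hyz (hl e) : l y ≠ l z) with h4 | h4
        exacts [Or.inl ⟨h3, h4⟩, Or.inr ⟨h3.symm, h4⟩]
    · rcases lt_or_gt_of_ne hne with hab | hab
      · have := _root_.reflTransGen_comparable (R := Function.swap fun a b => G.Adj a b ∧ l a < l b)
          (w := b) (u := c) (v := a) ?_ (reflTransGen_swap.2 ih) ⟨h, hab⟩
        · exact this.imp reflTransGen_swap.1 reflTransGen_swap.1
        rintro x y z ⟨hy, hy'⟩ ⟨hz, hz'⟩ hyz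
        have h3 := h₂ x y z hy hz hy' hz' hyz
        rcases lt_or_gt_of_ne (fun e => hyz (hl e) : l y ≠ l z) with h4 | h4
        exacts [Or.inr ⟨h3, h4⟩, Or.inl ⟨h3.symm, h4⟩]
      · exact Or.inr (ih.tail ⟨h.symm, hab⟩)

/-- A connected closed graph has a labelling for which the neighbours of every vertex with a larger
label are consecutive. -/
lemma exists_intervalLabelling [Finite V] (hconn : G.Connected) (hclosed : IsClosedGraph G) :
    ∃ n l r, 1 ≤ n ∧ IntervalLabelling G n l r := by
  classical
  have := Fintype.ofFinite V
  obtain ⟨n, lab, hlab⟩ := hclosed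
  obtain ⟨l, hl⟩ : ∃ l : V → ℕ, ∀ v, l v = lab v := ⟨_, fun _ => rfl⟩
  have hlt : ∀ u v, lab u < lab v ↔ l u < l v := fun u v => by rw [hl, hl]; rfl
  have hinj : Function.Injective l := fun u v huv => by
    rw [hl, hl] at huv
    exact lab.injective (Subtype.ext huv)
  have hsurj : ∀ i, 1 ≤ i → i ≤ n → ∃ v, l v = i := fun i h1 h2 =>
    ⟨lab.symm ⟨i, h1, h2⟩, by rw [hl]; simp⟩
  have hone : ∀ v, 1 ≤ l v := fun v => by rw [hl]; exact (lab v).2.1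
  have hle : ∀ v, l v ≤ n := fun v => by rw [hl]; exact (lab v).2.2
  have h₁ : ∀ u v w, G.Adj u v → G.Adj u w → l u < l v → l u < l w → v ≠ w → G.Adj v w :=
    fun u v w huv huw h1 h2 hvw =>
      (hlab u v u w huv huw ((hlt _ _).2 h1) ((hlt _ _).2 h2)).1 rfl hvw
  have h₂ : ∀ u v w, G.Adj v u → G.Adj w u → l v < l u → l w < l u → v ≠ w → G.Adj v w :=
    fun u v w huv huw h1 h2 hvw =>
      (hlab v u w u huv huw ((hlt _ _).2 h1) ((hlt _ _).2 h2)).2 rfl hvw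
  have hmono : ∀ u v, Relation.ReflTransGen (fun a b => G.Adj a b ∧ l a < l b) u v →
      l u ≤ l v := by
    intro u v huv
    induction huv with
    | refl => exact le_rfl
    | tail _ h ih => exact ih.trans h.2.le
  -- An increasing path between consecutive labels has no room for an intermediate vertex.
  have hsucc : ∀ u v, l v = l u + 1 → G.Adj u v := by
    intro u v huv
    rcases hconn.reflTransGen_comparable hinj h₁ h₂ u v with h | h
    · rcases h.cases_head with h | ⟨w, hw, hwv⟩
      · rw [h] at huv; omega
      · have h3 := hmono _ _ hwv
        have h4 : w = v := hinj (by have := hw.2; omega)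
        exact h4 ▸ hw.1
    · have := hmono _ _ h
      omega
  have hleft : ∀ u v, G.Adj u v → ∀ d w, l u < l w → l w + d = l v → G.Adj u w := by
    intro u v huv d
    induction d with
    | zero => intro w _ hw; exact hinj hw ▸ huv
    | succ d ih =>
      intro w huw hw
      obtain ⟨x, hx⟩ := hsurj (l w + 1) (by omega) (by have := hle v; omega)
      refine h₂ x u w (ih x (by omega) (by omega)) (hsucc w x hx) (by omega) (by omega) ?_
      rintro rfl
      omega
  have hright : ∀ u v, G.Adj u v → ∀ d w, l w < l v → l u + d = l w → G.Adj w v := by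
    intro u v huv d
    induction d with
    | zero => intro w _ hw; exact (hinj hw) ▸ huv
    | succ d ih =>
      intro w hwv hw
      obtain ⟨x, hx⟩ := hsurj (l w - 1) (by have := hone u; omega) (by have := hle w; omega)
      refine h₁ x w v (hsucc x w (by omega)) (ih x (by omega) (by omega)) (by omega) (by omega) ?_
      rintro rfl
      omega
  -- The supremum runs over all vertices of label at most `i` and their neighbours, which makes `r`
  -- monotone by construction; including the vertices themselves gives `i ≤ r i`.
  let r : ℕ → ℕ := fun i => Finset.sup {v | ∃ u, l u ≤ i ∧ (u = v ∨ G.Adj u v)} l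
  have hr : ∀ i v u, l u ≤ i → (u = v ∨ G.Adj u v) → l v ≤ r i := fun i v u hu huv =>
    Finset.le_sup (f := l) (by simpa using ⟨u, hu, huv⟩)
  have hV := hconn.nonempty
  refine ⟨n, l, r, (hone hV.some).trans (hle _), hinj, hsurj, hone, hle, ?_, ?_, ?_, ?_, ?_⟩
  · intro i j hij
    refine Finset.sup_mono fun v => ?_
    simp only [Finset.mem_filter, Finset.mem_univ, true_and]
    exact fun ⟨u, hu, huv⟩ => ⟨u, hu.trans hij, huv⟩
  · exact fun i => Finset.sup_le fun v _ => hle v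
  · intro i hi
    rcases Nat.eq_zero_or_pos i with rfl | hi0
    · exact Nat.zero_le _
    · obtain ⟨v, rfl⟩ := hsurj i hi0 hi
      exact hr _ v v le_rfl (Or.inl rfl)
  · intro i hi hin
    obtain ⟨u, rfl⟩ := hsurj i hi hin.le
    obtain ⟨v, hv⟩ := hsurj (l u + 1) (by omega) hin
    have := hr (l u) v u le_rfl (Or.inr (hsucc u v hv))
    omega
  · intro u v huv
    refine ⟨fun h => hr _ v u le_rfl (Or.inr h), fun h => ?_⟩
    rw [Finset.le_sup_iff (by have := hone v; exact this)] at h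
    obtain ⟨v', hv', hvv'⟩ := h
    simp only [Finset.mem_filter, Finset.mem_univ, true_and] at hv'
    obtain ⟨u', hu', rfl | hadj⟩ := hv'
    · omega
    -- The maximum may come from an edge starting before `u`: move its left end up to `u`, then its
    -- right end down to `v`.
    · exact hleft u v' (hright u' v' hadj (l u - l u') u (by omega) (by omega)) (l v' - l v) v huv
        (by omega)

end Labelling

/-! ### Free vertices and recognition of the maximal cliques. -/

section Facets

variable {W : Type u} {H : SimpleGraph W}

lemma cliqueDegree_eq_one {v : W} (h : H.IsClique (H.neighborSet v)) : cliqueDegree H v = 1 := by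
  rw [cliqueDegree, Set.ncard_eq_one]
  have hc : H.IsClique (insert v (H.neighborSet v)) := by
    rw [SimpleGraph.isClique_insert]
    exact ⟨h, fun b hb _ => hb⟩
  have hsub : ∀ C, H.IsClique C → v ∈ C → C ⊆ insert v (H.neighborSet v) := by
    intro C hC hv w hw
    by_cases hwv : w = v
    · exact Or.inl hwv
    · exact Or.inr (hC hv hw (Ne.symm hwv))
  refine ⟨insert v (H.neighborSet v), Set.ext fun F => ?_⟩
  constructor
  · rintro ⟨hF, hv⟩
    exact hF.eq_of_subset hc (hsub F hF.1 hv)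
  · rintro rfl
    exact ⟨⟨hc, fun C hC hle => hsub C hC (hle (Set.mem_insert _ _))⟩, Set.mem_insert _ _⟩

lemma exists_cliqueFacet_superset [Finite W] {C : Set W} (hC : H.IsClique C) :
    ∃ F ∈ cliqueFacets H, C ⊆ F := by
  obtain ⟨F, hCF, hF⟩ := (Set.toFinite {C : Set W | H.IsClique C}).exists_le_maximal hC
  exact ⟨F, hF, hCF⟩

lemma cliqueFacets_eq {𝓕 : Set (Set W)} (h₁ : ∀ F ∈ 𝓕, H.IsClique F)
    (h₂ : ∀ C, H.IsClique C → ∃ F ∈ 𝓕, C ⊆ F) (h₃ : ∀ F ∈ 𝓕, ∀ F' ∈ 𝓕, F ⊆ F' → F = F') :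
    cliqueFacets H = 𝓕 := by
  ext F
  constructor
  · intro hF
    obtain ⟨F', hF', hle⟩ := h₂ F hF.1
    rwa [hF.eq_of_subset (h₁ F' hF') hle]
  · intro hF
    refine ⟨h₁ F hF, fun C hC hle => ?_⟩
    obtain ⟨F', hF', hle'⟩ := h₂ C hC
    rw [h₃ F hF F' hF' (hle.trans hle')]
    exact hle'

end Facets

/-! ### The decomposition cuts `[1, n]` into blocks. -/

section IntervalPieces

variable {V : Type u} {G : SimpleGraph V} {n : ℕ} {l : V → ℕ} {r : ℕ → ℕ}

/-- The subgraph induced on the vertices with labels in `[s, t]`. -/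
def intervalSubgraph (G : SimpleGraph V) (l : V → ℕ) (s t : ℕ) : G.Subgraph :=
  (⊤ : G.Subgraph).induce {v | s ≤ l v ∧ l v ≤ t}

lemma mem_intervalSubgraph {s t : ℕ} {v : V} :
    v ∈ (intervalSubgraph G l s t).verts ↔ s ≤ l v ∧ l v ≤ t := Iff.rfl

lemma intervalSubgraph_adj {s t : ℕ} {v w : V} :
    (intervalSubgraph G l s t).Adj v w ↔
      (s ≤ l v ∧ l v ≤ t) ∧ (s ≤ l w ∧ l w ≤ t) ∧ G.Adj v w := by
  simp [intervalSubgraph]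

lemma intervalSubgraph_isInduced {s t : ℕ} : (intervalSubgraph G l s t).IsInduced := by
  intro v hv w hw h
  exact intervalSubgraph_adj.2 ⟨hv, hw, h⟩

lemma IntervalLabelling.intervalSubgraph_eq_top (h : IntervalLabelling G n l r) :
    intervalSubgraph G l 1 n = ⊤ := by
  ext v w
  · simp [mem_intervalSubgraph, h.one_le, h.le_n]
  · simp [intervalSubgraph_adj, h.one_le, h.le_n]

lemma IntervalLabelling.adj_of_le (h : IntervalLabelling G n l r) {u v : V} (huv : l u < l v)
    (hv : l v ≤ r (l u)) : G.Adj u v := (h.adj_iff u v huv).2 hv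

lemma IntervalLabelling.le_of_adj (h : IntervalLabelling G n l r) {u v : V} (huv : l u < l v)
    (hadj : G.Adj u v) : l v ≤ r (l u) := (h.adj_iff u v huv).1 hadj

/-- If `r (c - 1) ≤ c`, no edge jumps over `c`, and `c` is free on both sides because its neighbours
on one side form a clique in an interval labelling. -/
lemma IntervalLabelling.isIndecomposable_no_cut (h : IntervalLabelling G n l r) {s t : ℕ}
    (hs : 1 ≤ s) (ht : t ≤ n) (hind : IsIndecomposable (intervalSubgraph G l s t)) :
    ∀ c, s < c → c < t → c < r (c - 1) := by
  intro c hsc hct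
  by_contra hcut
  apply hind
  obtain ⟨v, rfl⟩ := h.surj c (by omega) (by omega)
  have hno : ∀ x y, l x < l v → l v < l y → ¬ G.Adj x y := by
    intro x y hx hy hadj
    have h1 := h.le_of_adj (by omega) hadj
    have h2 := h.mono (l x) (l v - 1) (by omega)
    omega
  refine ⟨intervalSubgraph G l s (l v), intervalSubgraph G l (l v) t, ?_, ?_, ?_, v, ?_, ?_, ?_⟩
  · ext x y
    · simp only [SimpleGraph.Subgraph.verts_sup, Set.mem_union, mem_intervalSubgraph]
      omega
    · rw [SimpleGraph.Subgraph.sup_adj]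
      simp only [intervalSubgraph_adj]
      constructor
      · rintro ⟨hx, hy, hadj⟩
        have h1 := hno x y
        have h2 := hno y x
        have h3 := hadj.symm
        by_cases hxv : l x < l v
        · by_cases hyv : l v < l y
          · exact (h1 hxv hyv hadj).elim
          · exact Or.inl ⟨⟨hx.1, by omega⟩, ⟨hy.1, by omega⟩, hadj⟩
        · by_cases hyv : l y < l v
          · by_cases hxv' : l v < l x
            · exact (h2 hyv hxv' h3).elim
            · exact Or.inl ⟨⟨hx.1, by omega⟩, ⟨hy.1, by omega⟩, hadj⟩
          · exact Or.inr ⟨⟨by omega, hx.2⟩, ⟨by omega, hy.2⟩, hadj⟩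
      · rintro (⟨hx, hy, hadj⟩ | ⟨hx, hy, hadj⟩)
        · exact ⟨⟨hx.1, by omega⟩, ⟨hy.1, by omega⟩, hadj⟩
        · exact ⟨⟨by omega, hx.2⟩, ⟨by omega, hy.2⟩, hadj⟩
  · obtain ⟨x, hx⟩ := h.surj s hs (by omega)
    refine ⟨x, ⟨hx.ge, by omega⟩, v, ⟨by omega, le_rfl⟩, ?_⟩
    rintro rfl
    omega
  · obtain ⟨x, hx⟩ := h.surj t (by omega) ht
    refine ⟨v, ⟨le_rfl, by omega⟩, x, ⟨by omega, hx.le⟩, ?_⟩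
    rintro rfl
    omega
  · ext x
    simp only [Set.mem_inter_iff, mem_intervalSubgraph, Set.mem_singleton_iff]
    constructor
    · intro hx
      exact h.inj (by omega)
    · rintro rfl
      omega
  · refine ⟨⟨by omega, le_rfl⟩, cliqueDegree_eq_one ?_⟩
    rintro ⟨x, hx⟩ hxv ⟨y, hy⟩ hyv hxy
    simp only [SimpleGraph.mem_neighborSet, SimpleGraph.Subgraph.coe_adj,
      intervalSubgraph_adj] at hxv hyv ⊢
    rw [mem_intervalSubgraph] at hx hy
    refine ⟨hx, hy, ?_⟩
    have hxv' : l x ≠ l v := fun e => hxv.2.2.ne' (h.inj e)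
    have hyv' : l y ≠ l v := fun e => hyv.2.2.ne' (h.inj e)
    have hxy' : l x ≠ l y := fun e => hxy (Subtype.ext (h.inj e))
    have h1 := h.le_of_adj (by omega) hxv.2.2.symm
    have h2 := h.le_of_adj (by omega) hyv.2.2.symm
    rcases lt_or_gt_of_ne hxy' with h3 | h3
    · exact h.adj_of_le h3 (by omega)
    · exact (h.adj_of_le h3 (by omega)).symm
  · refine ⟨⟨le_rfl, by omega⟩, cliqueDegree_eq_one ?_⟩
    rintro ⟨x, hx⟩ hxv ⟨y, hy⟩ hyv hxy
    simp only [SimpleGraph.mem_neighborSet, SimpleGraph.Subgraph.coe_adj,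
      intervalSubgraph_adj] at hxv hyv ⊢
    rw [mem_intervalSubgraph] at hx hy
    refine ⟨hx, hy, ?_⟩
    have hxv' : l x ≠ l v := fun e => hxv.2.2.ne' (h.inj e)
    have hyv' : l y ≠ l v := fun e => hyv.2.2.ne' (h.inj e)
    have hxy' : l x ≠ l y := fun e => hxy (Subtype.ext (h.inj e))
    have h1 := h.le_of_adj (by omega) hxv.2.2
    have h2 := h.le_of_adj (by omega) hyv.2.2
    rcases lt_or_gt_of_ne hxy' with h3 | h3
    · exact h.adj_of_le h3 (h2.trans (h.mono _ _ (by omega)))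
    · exact (h.adj_of_le h3 (h1.trans (h.mono _ _ (by omega)))).symm

/-- In a gluing of an interval at `v`, the vertices before `v` lie in the same part. -/
lemma IntervalLabelling.mem_left_of_gluing (h : IntervalLabelling G n l r) {s t : ℕ}
    (hs : 1 ≤ s) (ht : t ≤ n) {H₁ H₂ : G.Subgraph} (hH : intervalSubgraph G l s t = H₁ ⊔ H₂) {v : V}
    (hv : H₁.verts ∩ H₂.verts = {v}) {x : V} (hx : x ∈ H₁.verts) (hxv : x ≠ v) (y : V)
    (hy : s ≤ l y ∧ l y ≤ t) (hxy : (l x < l v ∧ l y < l v) ∨ (l v < l x ∧ l v < l y)) :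
    y ∈ H₁.verts := by
  have hxst : s ≤ l x ∧ l x ≤ t := by
    rw [← mem_intervalSubgraph (G := G), hH]
    exact Or.inl hx
  have hstep : ∀ a b, a ∈ H₁.verts → a ≠ v → (s ≤ l a ∧ l a ≤ t) → (s ≤ l b ∧ l b ≤ t) →
      G.Adj a b → b ∈ H₁.verts := by
    intro a b ha hav hast hbst hab
    have h1 : (intervalSubgraph G l s t).Adj a b := intervalSubgraph_adj.2 ⟨hast, hbst, hab⟩
    rw [hH, SimpleGraph.Subgraph.sup_adj] at h1
    rcases h1 with h1 | h1
    · exact h1.snd_mem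
    · have h2 : a ∈ H₁.verts ∩ H₂.verts := ⟨ha, h1.fst_mem⟩
      rw [hv] at h2
      exact (hav h2).elim
  have hsucc : ∀ a b, l b = l a + 1 → G.Adj a b := fun a b hab =>
    h.adj_of_le (by omega) (by
      rw [hab]; exact h.lt_r _ (h.one_le a) (by have := h.le_n b; omega))
  have hup : ∀ d y, l y = l x + d → (s ≤ l y ∧ l y ≤ t) →
      ((l x < l v ∧ l y < l v) ∨ (l v < l x ∧ l v < l y)) → y ∈ H₁.verts := by
    intro d
    induction d with
    | zero => intro y hy _ _; rw [h.inj hy]; exact hx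
    | succ d ih =>
      intro y hy hyst hxy
      obtain ⟨z, hz⟩ := h.surj (l x + d) (by omega) (by omega)
      refine hstep z y (ih z hz (by omega) (by omega)) ?_ (by omega) hyst (hsucc _ _ (by omega))
      rintro rfl
      omega
  have hdown : ∀ d y, l y + d = l x → (s ≤ l y ∧ l y ≤ t) →
      ((l x < l v ∧ l y < l v) ∨ (l v < l x ∧ l v < l y)) → y ∈ H₁.verts := by
    intro d
    induction d with
    | zero => intro y hy _ _; rw [h.inj hy]; exact hx
    | succ d ih =>
      intro y hy hyst hxy
      obtain ⟨z, hz⟩ := h.surj (l y + 1) (by omega) (by omega)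
      refine hstep z y (ih z (by omega) (by omega) (by omega)) ?_ (by omega) hyst
        (hsucc _ _ (by omega)).symm
      rintro rfl
      omega
  rcases le_total (l x) (l y) with hle | hle
  · exact hup (l y - l x) y (by omega) hy hxy
  · exact hdown (l x - l y) y (by omega) hy hxy

/-- The parts share a single vertex, so no edge between vertices of `H₁` can come from `H₂` alone: a
part of an induced subgraph is again induced. -/
lemma eq_intervalSubgraph_of_sup {s t a b : ℕ} {H₁ H₂ : G.Subgraph}
    (hH : intervalSubgraph G l s t = H₁ ⊔ H₂) {v : V} (hv : H₁.verts ∩ H₂.verts = {v})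
    (hverts : ∀ x, x ∈ H₁.verts ↔ a ≤ l x ∧ l x ≤ b) (hsa : s ≤ a) (hbt : b ≤ t) :
    H₁ = intervalSubgraph G l a b := by
  ext x y
  · rw [hverts, mem_intervalSubgraph]
  · rw [intervalSubgraph_adj]
    constructor
    · intro hxy
      exact ⟨(hverts x).1 hxy.fst_mem, (hverts y).1 hxy.snd_mem, hxy.adj_sub⟩
    · rintro ⟨hx, hy, hxy⟩
      have h1 : (intervalSubgraph G l s t).Adj x y :=
        intervalSubgraph_adj.2 ⟨by omega, by omega, hxy⟩
      rw [hH, SimpleGraph.Subgraph.sup_adj] at h1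
      rcases h1 with h1 | h1
      · exact h1
      · have h2 : x ∈ H₁.verts ∩ H₂.verts := ⟨(hverts x).2 hx, h1.fst_mem⟩
        have h3 : y ∈ H₁.verts ∩ H₂.verts := ⟨(hverts y).2 hy, h1.snd_mem⟩
        rw [hv] at h2 h3
        exact (hxy.ne (h2.trans h3.symm)).elim

/-- An interval can only be glued from two intervals, at a cut vertex. -/
lemma IntervalLabelling.gluing_eq (h : IntervalLabelling G n l r) {s t : ℕ} (hs : 1 ≤ s)
    (ht : t ≤ n) {H₁ H₂ : G.Subgraph} (hg : IsGluing (intervalSubgraph G l s t) H₁ H₂) :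
    ∃ c, s < c ∧ c < t ∧ r (c - 1) ≤ c ∧
      ((H₁ = intervalSubgraph G l s c ∧ H₂ = intervalSubgraph G l c t) ∨
        (H₁ = intervalSubgraph G l c t ∧ H₂ = intervalSubgraph G l s c)) := by
  obtain ⟨hH, hn₁, hn₂, v, hv, -, -⟩ := hg
  have hH' : intervalSubgraph G l s t = H₂ ⊔ H₁ := by rw [hH, sup_comm]
  have hv' : H₂.verts ∩ H₁.verts = {v} := by rw [Set.inter_comm, hv]
  have hst : ∀ x, s ≤ l x ∧ l x ≤ t ↔ x ∈ H₁.verts ∨ x ∈ H₂.verts := by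
    intro x
    rw [← mem_intervalSubgraph (G := G), hH]
    rfl
  have hinter : ∀ x, x ∈ H₁.verts → x ∈ H₂.verts → x = v := by
    intro x h1 h2
    have h3 : x ∈ H₁.verts ∩ H₂.verts := ⟨h1, h2⟩
    rwa [hv] at h3
  have hvm : v ∈ H₁.verts ∩ H₂.verts := by rw [hv]; rfl
  obtain ⟨x, hx, hxv⟩ := hn₁.exists_ne v
  obtain ⟨y, hy, hyv⟩ := hn₂.exists_ne v
  have hxl : l x ≠ l v := fun e => hxv (h.inj e)
  have hyl : l y ≠ l v := fun e => hyv (h.inj e)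
  have hxst := (hst x).2 (Or.inl hx)
  have hyst := (hst y).2 (Or.inr hy)
  have hx' := h.mem_left_of_gluing hs ht hH hv hx hxv
  have hy' := h.mem_left_of_gluing hs ht hH' hv' hy hyv
  -- An edge between the two parts that avoids the common vertex would lie in one of them and put a
  -- second vertex into the intersection.
  have hcut : ∀ a b, l a < l v → l v < l b → (s ≤ l a ∧ l a ≤ t) → (s ≤ l b ∧ l b ≤ t) →
      ((a ∈ H₁.verts ∧ b ∈ H₂.verts) ∨ (a ∈ H₂.verts ∧ b ∈ H₁.verts)) → ¬ G.Adj a b := by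
    intro a b hav hvb ha hb hmem hab
    have h1 : (intervalSubgraph G l s t).Adj a b := intervalSubgraph_adj.2 ⟨ha, hb, hab⟩
    rw [hH, SimpleGraph.Subgraph.sup_adj] at h1
    have hav' : a ≠ v := by rintro rfl; omega
    have hbv' : b ≠ v := by rintro rfl; omega
    rcases hmem with ⟨h2, h3⟩ | ⟨h2, h3⟩ <;> rcases h1 with h1 | h1
    · exact hbv' (hinter b h1.snd_mem h3)
    · exact hav' (hinter a h2 h1.fst_mem)
    · exact hav' (hinter a h1.fst_mem h2)
    · exact hbv' (hinter b h3 h1.snd_mem)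
  have hr : (∀ a b, l a < l v → l v < l b → (s ≤ l a ∧ l a ≤ t) → (s ≤ l b ∧ l b ≤ t) →
      ((a ∈ H₁.verts ∧ b ∈ H₂.verts) ∨ (a ∈ H₂.verts ∧ b ∈ H₁.verts))) → s < l v → l v < t →
      r (l v - 1) ≤ l v := by
    intro hmem hsv hvt
    by_contra hcon
    have h1 := h.r_le (l v - 1)
    obtain ⟨a, ha⟩ := h.surj (l v - 1) (by omega) (by omega)
    obtain ⟨b, hb⟩ := h.surj (l v + 1) (by omega) (by omega)
    refine hcut a b (by omega) (by omega) (by omega) (by omega)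
      (hmem a b (by omega) (by omega) (by omega) (by omega)) (h.adj_of_le (by omega) ?_)
    rw [ha]
    omega
  -- Both parts reach beyond `v`; on the same side they would overlap there, so they occupy opposite
  -- sides.
  rcases lt_or_gt_of_ne hxl with h1 | h1 <;> rcases lt_or_gt_of_ne hyl with h2 | h2
  · exact (hyv (hinter y (hx' y hyst (by omega)) hy)).elim
  · refine ⟨l v, by omega, by omega, hr (fun a b ha hb hast hbst => Or.inl
      ⟨hx' a hast (by omega), hy' b hbst (by omega)⟩) (by omega) (by omega), Or.inl ⟨?_, ?_⟩⟩
    · refine eq_intervalSubgraph_of_sup hH hv (fun z => ⟨fun hz => ?_, fun hz => ?_⟩) le_rfl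
        (by omega)
      · have hzst := (hst z).2 (Or.inl hz)
        refine ⟨hzst.1, ?_⟩
        by_contra hcon
        have := hinter z hz (hy' z hzst (by omega))
        subst this
        omega
      · by_cases hzv : l z = l v
        · rw [h.inj hzv]; exact hvm.1
        · exact hx' z (by omega) (by omega)
    · refine eq_intervalSubgraph_of_sup hH' hv' (fun z => ⟨fun hz => ?_, fun hz => ?_⟩) (by omega)
        le_rfl
      · have hzst := (hst z).2 (Or.inr hz)
        refine ⟨?_, hzst.2⟩
        by_contra hcon
        have := hinter z (hx' z hzst (by omega)) hz
        subst this
        omega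
      · by_cases hzv : l z = l v
        · rw [h.inj hzv]; exact hvm.2
        · exact hy' z (by omega) (by omega)
  · refine ⟨l v, by omega, by omega, hr (fun a b ha hb hast hbst => Or.inr
      ⟨hy' a hast (by omega), hx' b hbst (by omega)⟩) (by omega) (by omega), Or.inr ⟨?_, ?_⟩⟩
    · refine eq_intervalSubgraph_of_sup hH hv (fun z => ⟨fun hz => ?_, fun hz => ?_⟩) (by omega)
        le_rfl
      · have hzst := (hst z).2 (Or.inl hz)
        refine ⟨?_, hzst.2⟩
        by_contra hcon
        have := hinter z hz (hy' z hzst (by omega))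
        subst this
        omega
      · by_cases hzv : l z = l v
        · rw [h.inj hzv]; exact hvm.1
        · exact hx' z (by omega) (by omega)
    · refine eq_intervalSubgraph_of_sup hH' hv' (fun z => ⟨fun hz => ?_, fun hz => ?_⟩) le_rfl
        (by omega)
      · have hzst := (hst z).2 (Or.inr hz)
        refine ⟨hzst.1, ?_⟩
        by_contra hcon
        have := hinter z (hx' z hzst (by omega)) hz
        subst this
        omega
      · by_cases hzv : l z = l v
        · rw [h.inj hzv]; exact hvm.2
        · exact hy' z (by omega) (by omega)
  · exact (hyv (hinter y (hx' y hyst (by omega)) hy)).elim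

/-- `[p, q]` is a maximal interval in `[s, t]` without interior cut vertices. -/
structure IsBlock (r : ℕ → ℕ) (s t p q : ℕ) : Prop where
  le_left : s ≤ p
  lt : p < q
  right_le : q ≤ t
  left : p = s ∨ r (p - 1) ≤ p
  right : q = t ∨ r (q - 1) ≤ q
  no_cut : ∀ c, p < c → c < q → c < r (c - 1)

/-- Induction on the splitting tree, with interval endpoints as coordinates. Either part of a gluing
may be the left one, so the list need not be sorted and disjointness is recorded symmetrically. -/
lemma IntervalLabelling.exists_blocks (h : IntervalLabelling G n l r) {H : G.Subgraph}
    {L : List G.Subgraph} (hL : IsDecomposition H L) : ∀ s t, H = intervalSubgraph G l s t →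
    1 ≤ s → s < t → t ≤ n → ∃ M : List (ℕ × ℕ),
      L = M.map (fun p => intervalSubgraph G l p.1 p.2) ∧
      (∀ p ∈ M, IsBlock r s t p.1 p.2) ∧ (∀ i, s ≤ i → i < t → ∃ p ∈ M, p.1 ≤ i ∧ i < p.2) ∧
      M.Pairwise (fun p q => p.2 ≤ q.1 ∨ q.2 ≤ p.1) := by
  induction hL with
  | single H hind =>
    rintro s t rfl hs hst ht
    refine ⟨[(s, t)], rfl, ?_, ?_, List.pairwise_singleton _ _⟩
    · intro p hp
      rw [List.mem_singleton] at hp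
      subst hp
      exact ⟨le_rfl, hst, le_rfl, Or.inl rfl, Or.inl rfl, h.isIndecomposable_no_cut hs ht hind⟩
    · exact fun i h1 h2 => ⟨(s, t), List.mem_singleton_self _, h1, h2⟩
  | split H H₁ H₂ L₁ L₂ hg _ _ ih₁ ih₂ =>
    rintro s t rfl hs hst ht
    obtain ⟨c, hsc, hct, hc, hcase⟩ := h.gluing_eq hs ht hg
    have hleft : ∀ p : ℕ × ℕ, IsBlock r s c p.1 p.2 → IsBlock r s t p.1 p.2 := fun p hp =>
      ⟨hp.le_left, hp.lt, hp.right_le.trans hct.le, hp.left,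
        Or.inr (hp.right.elim (fun e => e ▸ hc) id), hp.no_cut⟩
    have hright : ∀ p : ℕ × ℕ, IsBlock r c t p.1 p.2 → IsBlock r s t p.1 p.2 := fun p hp =>
      ⟨hsc.le.trans hp.le_left, hp.lt, hp.right_le,
        Or.inr (hp.left.elim (fun e => e ▸ hc) id), hp.right, hp.no_cut⟩
    rcases hcase with ⟨h1, h2⟩ | ⟨h1, h2⟩
    · obtain ⟨M₁, e₁, b₁, c₁, p₁⟩ := ih₁ s c h1 hs hsc (by omega)
      obtain ⟨M₂, e₂, b₂, c₂, p₂⟩ := ih₂ c t h2 (by omega) hct ht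
      refine ⟨M₁ ++ M₂, by rw [e₁, e₂, List.map_append], ?_, ?_, ?_⟩
      · intro p hp
        rcases List.mem_append.1 hp with hp | hp
        exacts [hleft p (b₁ p hp), hright p (b₂ p hp)]
      · intro i hsi hit
        by_cases hic : i < c
        · obtain ⟨p, hp, hpi⟩ := c₁ i hsi hic
          exact ⟨p, List.mem_append_left _ hp, hpi⟩
        · obtain ⟨p, hp, hpi⟩ := c₂ i (by omega) hit
          exact ⟨p, List.mem_append_right _ hp, hpi⟩
      · refine List.pairwise_append.2 ⟨p₁, p₂, fun p hp q hq => Or.inl ?_⟩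
        exact (b₁ p hp).right_le.trans (b₂ q hq).le_left
    · obtain ⟨M₁, e₁, b₁, c₁, p₁⟩ := ih₁ c t h1 (by omega) hct ht
      obtain ⟨M₂, e₂, b₂, c₂, p₂⟩ := ih₂ s c h2 hs hsc (by omega)
      refine ⟨M₁ ++ M₂, by rw [e₁, e₂, List.map_append], ?_, ?_, ?_⟩
      · intro p hp
        rcases List.mem_append.1 hp with hp | hp
        exacts [hright p (b₁ p hp), hleft p (b₂ p hp)]
      · intro i hsi hit
        by_cases hic : i < c
        · obtain ⟨p, hp, hpi⟩ := c₂ i hsi hic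
          exact ⟨p, List.mem_append_right _ hp, hpi⟩
        · obtain ⟨p, hp, hpi⟩ := c₁ i (by omega) hit
          exact ⟨p, List.mem_append_left _ hp, hpi⟩
      · refine List.pairwise_append.2 ⟨p₁, p₂, fun p hp q hq => Or.inr ?_⟩
        exact (b₂ q hq).right_le.trans (b₁ p hp).le_left

end IntervalPieces

/-! ### Label-free consequences of the exceptional forms. -/

section Forms

variable {W : Type u} {H : SimpleGraph W}

/-- This is what makes the exceptional index unique. -/
lemma HasExceptionalForm.not_isClique_univ (hH : HasExceptionalForm H) :
    ¬ H.IsClique Set.univ := by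
  intro hcl
  have huniv : ∀ F ∈ cliqueFacets H, F = Set.univ := fun F hF =>
    hF.eq_of_subset hcl (Set.subset_univ F)
  have hlab : ∀ (n : ℕ) (lab : W ≃ Set.Icc 1 n) (b : ℕ), 1 ≤ n → b < n →
      labelInterval lab 1 b ≠ Set.univ := by
    intro n lab b hn hb he
    have h1 : lab.symm ⟨n, hn, le_rfl⟩ ∈ labelInterval lab 1 b := by rw [he]; trivial
    simp only [labelInterval, Set.mem_ofPred_eq, Equiv.apply_symm_apply, Set.mem_Icc] at h1
    omega
  rcases hH with ⟨F₁, F₂, hne, he, -⟩ | ⟨n, lab, b, hb, hbn, he⟩ | ⟨n, lab, b, hb, hbn, he⟩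
  · exact hne ((huniv F₁ (by simp [he])).trans (huniv F₂ (by simp [he])).symm)
  · exact hlab n lab b (by omega) (by omega) (huniv _ (by simp [he]))
  · exact hlab n lab b (by omega) (by omega) (huniv _ (by simp [he]))

/-- `u` and `w` are distinct, not adjacent, and both adjacent to the ends of the edge `{x, y}`. -/
structure IsDiamond (H : SimpleGraph W) (x y u w : W) : Prop where
  xy : H.Adj x y
  ux : H.Adj u x
  uy : H.Adj u y
  wx : H.Adj w x
  wy : H.Adj w y
  ne : u ≠ w
  not_adj : ¬ H.Adj u w

/-- A diamond forces two maximal cliques through its edge, told apart by `u` and `w`. Since no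
labelling is involved, it can be found in the labelling of `G` and tested in that of the form. -/
lemma IsDiamond.exists_cliqueFacets [Finite W] {x y u w : W} (h : IsDiamond H x y u w) :
    ∃ F ∈ cliqueFacets H, ∃ F' ∈ cliqueFacets H, (u ∈ F ∧ x ∈ F ∧ y ∈ F ∧ w ∉ F) ∧
      (w ∈ F' ∧ x ∈ F' ∧ y ∈ F' ∧ u ∉ F') := by
  have key : ∀ a, H.Adj a x → H.Adj a y → ∃ F ∈ cliqueFacets H, a ∈ F ∧ x ∈ F ∧ y ∈ F := by
    intro a hax hay
    have hc : H.IsClique {a, x, y} := by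
      rw [SimpleGraph.isClique_insert, SimpleGraph.isClique_pair]
      refine ⟨fun _ => h.xy, ?_⟩
      rintro b (rfl | rfl) _
      exacts [hax, hay]
    obtain ⟨F, hF, hle⟩ := exists_cliqueFacet_superset hc
    exact ⟨F, hF, hle (by simp), hle (by simp), hle (by simp)⟩
  obtain ⟨F, hF, hu, hx, hy⟩ := key u h.ux h.uy
  obtain ⟨F', hF', hw, hx', hy'⟩ := key w h.wx h.wy
  exact ⟨F, hF, F', hF', ⟨hu, hx, hy, fun hw => h.not_adj (hF.1 hu hw h.ne)⟩,
    hw, hx', hy', fun hu => h.not_adj (hF'.1 hu hw h.ne)⟩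

lemma false_of_ncard_eq_two {s : Set W} (hs : s.ncard = 2) {x y z : W} (hx : x ∈ s) (hy : y ∈ s)
    (hz : z ∈ s) (hxy : x ≠ y) (hxz : x ≠ z) (hyz : y ≠ z) : False := by
  obtain ⟨a, b, -, rfl⟩ := Set.ncard_eq_two.1 hs
  simp only [Set.mem_insert_iff, Set.mem_singleton_iff] at hx hy hz
  rcases hx with rfl | rfl <;> rcases hy with rfl | rfl <;> rcases hz with rfl | rfl <;> simp_all

lemma IsDiamond.mem_inter [Finite W] {F₁ F₂ : Set W} (he : cliqueFacets H = {F₁, F₂})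
    {x y u w : W} (h : IsDiamond H x y u w) : x ∈ F₁ ∩ F₂ ∧ y ∈ F₁ ∩ F₂ := by
  obtain ⟨F, hF, F', hF', ⟨hu, hx, hy, hw⟩, hw', hx', hy', hu'⟩ := h.exists_cliqueFacets
  rw [he] at hF hF'
  rcases hF with rfl | rfl <;> rcases hF' with rfl | rfl
  · exact (hw hw').elim
  · exact ⟨⟨hx, hx'⟩, hy, hy'⟩
  · exact ⟨⟨hx', hx⟩, hy', hy⟩
  · exact (hw hw').elim

lemma mem_labelInterval {n : ℕ} {lab : W ≃ Set.Icc 1 n} {a b : ℕ} {w : W} :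
    w ∈ labelInterval lab a b ↔ a ≤ (lab w : ℕ) ∧ (lab w : ℕ) ≤ b := Iff.rfl

lemma IsDiamond.three [Finite W] {n : ℕ} {lab : W ≃ Set.Icc 1 n} {b : ℕ} (hb : 3 ≤ b)
    (he : cliqueFacets H =
      {labelInterval lab 1 b, labelInterval lab (b - 1) (b + 1), labelInterval lab b n})
    {x y u w : W} (h : IsDiamond H x y u w) :
    ((lab x : ℕ) + 1 = lab y ∨ (lab y : ℕ) + 1 = lab x) ∧ ((lab x : ℕ) = b ∨ (lab y : ℕ) = b) := by
  obtain ⟨F, hF, F', hF', ⟨hu, hx, hy, hw⟩, hw', hx', hy', hu'⟩ := h.exists_cliqueFacets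
  have hxy : (lab x : ℕ) ≠ lab y := fun e => h.xy.ne (lab.injective (Subtype.ext e))
  rw [he] at hF hF'
  rcases hF with rfl | rfl | rfl <;> rcases hF' with rfl | rfl | rfl <;>
    rw [mem_labelInterval] at hu hx hy hw hw' hx' hy' hu' <;> omega

/-- Checking all pairs of listed cliques leaves the shared edges `{b - 1, b}`, `{b, b + 1}`, `{b +
1, b + 2}`. For an outer edge, the tip lying in the next clique is determined. -/
lemma IsDiamond.four [Finite W] {n : ℕ} {lab : W ≃ Set.Icc 1 n} {b : ℕ} (hb : 3 ≤ b)
    (he : cliqueFacets H =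
      {labelInterval lab 1 b, labelInterval lab (b - 1) (b + 1), labelInterval lab b (b + 2),
        labelInterval lab (b + 1) n})
    {x y u w : W} (h : IsDiamond H x y u w) :
    ((lab x : ℕ) + 1 = lab y ∨ (lab y : ℕ) + 1 = lab x) ∧
      (((lab x : ℕ) + lab y = 2 * b - 1 ∧ ((lab u : ℕ) = b + 1 ∨ (lab w : ℕ) = b + 1)) ∨
        (lab x : ℕ) + lab y = 2 * b + 1 ∨
        ((lab x : ℕ) + lab y = 2 * b + 3 ∧ ((lab u : ℕ) = b ∨ (lab w : ℕ) = b))) := by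
  obtain ⟨F, hF, F', hF', ⟨hu, hx, hy, hw⟩, hw', hx', hy', hu'⟩ := h.exists_cliqueFacets
  have hxy : (lab x : ℕ) ≠ lab y := fun e => h.xy.ne (lab.injective (Subtype.ext e))
  rw [he] at hF hF'
  rcases hF with rfl | rfl | rfl | rfl <;> rcases hF' with rfl | rfl | rfl | rfl <;>
    rw [mem_labelInterval] at hu hx hy hw hw' hx' hy' hu' <;> omega

/-- In the exceptional forms, distinct maximal cliques share at most two vertices. -/
lemma HasExceptionalForm.false_of_three [Finite W] (hH : HasExceptionalForm H) {x y z u w : W}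
    (hxy : IsDiamond H x y u w) (hxz : IsDiamond H x z u w) (hyz : IsDiamond H y z u w) :
    False := by
  rcases hH with ⟨F₁, F₂, hne, he, hcard⟩ | ⟨n, lab, b, hb, hbn, he⟩ | ⟨n, lab, b, hb, hbn, he⟩
  · exact false_of_ncard_eq_two hcard (hxy.mem_inter he).1 (hxy.mem_inter he).2
      (hxz.mem_inter he).2 hxy.xy.ne hxz.xy.ne hyz.xy.ne
  · have h1 := (hxy.three hb he).1
    have h2 := (hxz.three hb he).1
    have h3 := (hyz.three hb he).1
    omega
  · have h1 := (hxy.four hb he).1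
    have h2 := (hxz.four hb he).1
    have h3 := (hyz.four hb he).1
    omega

/-- In the exceptional forms, two disjoint edges shared by two maximal cliques each are close to
each other, but not contained in a clique. -/
lemma HasExceptionalForm.of_disjoint [Finite W] (hH : HasExceptionalForm H)
    {x y u w x' y' u' w' : W} (hd : IsDiamond H x y u w) (hd' : IsDiamond H x' y' u' w')
    (hxx : x ≠ x') (hxy : x ≠ y') (hyx : y ≠ x') (hyy : y ≠ y') :
    ¬ (H.Adj x x' ∧ H.Adj x y' ∧ H.Adj y x' ∧ H.Adj y y') ∧
      (x' = u ∨ x' = w ∨ y' = u ∨ y' = w) := by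
  rcases hH with ⟨F₁, F₂, hne, he, hcard⟩ | ⟨n, lab, b, hb, hbn, he⟩ | ⟨n, lab, b, hb, hbn, he⟩
  · exact (false_of_ncard_eq_two hcard (hd.mem_inter he).1 (hd.mem_inter he).2
      (hd'.mem_inter he).1 hd.xy.ne hxx hyx).elim
  · have hinj : ∀ {a c : W}, (lab a : ℕ) = lab c → a = c :=
      fun e => lab.injective (Subtype.ext e)
    rcases (hd.three hb he).2 with h1 | h1 <;> rcases (hd'.three hb he).2 with h2 | h2
    · exact (hxx (hinj (h1.trans h2.symm))).elim
    · exact (hxy (hinj (h1.trans h2.symm))).elim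
    · exact (hyx (hinj (h1.trans h2.symm))).elim
    · exact (hyy (hinj (h1.trans h2.symm))).elim
  · have hinj : ∀ {a c : W}, (lab a : ℕ) = lab c ↔ a = c :=
      fun {a c} => ⟨fun e => lab.injective (Subtype.ext e), fun e => e ▸ rfl⟩
    -- The vertices `b - 1` and `b + 2` lie in none of the four cliques together.
    have hfar : ∀ {a c : W}, (lab a : ℕ) + 1 = b → (lab c : ℕ) = b + 2 → ¬ H.Adj a c := by
      intro a c ha hc hac
      obtain ⟨F, hF, hle⟩ := exists_cliqueFacet_superset
        (SimpleGraph.isClique_pair.2 fun _ => hac)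
      have haF : a ∈ F := hle (by simp)
      have hcF : c ∈ F := hle (by simp)
      rw [he] at hF
      rcases hF with rfl | rfl | rfl | rfl <;> rw [mem_labelInterval] at haF hcF <;> omega
    obtain ⟨h1, h2⟩ := hd.four hb he
    obtain ⟨h1', h2'⟩ := hd'.four hb he
    have hxx := hinj.not.2 hxx
    have hxy := hinj.not.2 hxy
    have hyx := hinj.not.2 hyx
    have hyy := hinj.not.2 hyy
    simp only [← hinj]
    -- Disjointness forces the two outer edges. Then `c` is the label of the tip of the first
    -- diamond that lies on the second edge.
    obtain ⟨c, hxc, huc, hends⟩ : ∃ c, ((lab x' : ℕ) = c ∨ (lab y' : ℕ) = c) ∧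
        ((lab u : ℕ) = c ∨ (lab w : ℕ) = c) ∧
        ((((lab x : ℕ) + 1 = b ∨ (lab y : ℕ) + 1 = b) ∧
        ((lab x' : ℕ) = b + 2 ∨ (lab y' : ℕ) = b + 2)) ∨
        (((lab x' : ℕ) + 1 = b ∨ (lab y' : ℕ) + 1 = b) ∧
        ((lab x : ℕ) = b + 2 ∨ (lab y : ℕ) = b + 2))) := by
      rcases h2 with ⟨h2, h3⟩ | h2 | ⟨h2, h3⟩ <;> rcases h2' with ⟨h2', -⟩ | h2' | ⟨h2', -⟩
      case inl.inr.inr => exact ⟨b + 1, by omega, h3, by clear h3; omega⟩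
      case inr.inr.inl => exact ⟨b, by omega, h3, by clear h3; omega⟩
      all_goals exfalso; omega
    constructor
    · rintro ⟨a1, a2, a3, a4⟩
      rcases hends with ⟨e | e, e' | e'⟩ | ⟨e | e, e' | e'⟩
      exacts [hfar e e' a1, hfar e e' a2, hfar e e' a3, hfar e e' a4, hfar e e' a1.symm,
        hfar e e' a3.symm, hfar e e' a2.symm, hfar e e' a4.symm]
    · clear hends h1 h1' h2 h2' hxx hxy hyx hyy
      omega

end Forms

/-! ### Blocks, wide ends and the exceptional forms. -/

section Blocks

variable {V : Type u} {G : SimpleGraph V} {n : ℕ} {l : V → ℕ} {r : ℕ → ℕ} {s t : ℕ}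

/-- A clique with least label `i` lies in `[i, r i]`, so it is enough that the listed intervals are
cliques, absorb each `[i, r i]` within the block, and form an antichain. -/
lemma IntervalLabelling.cliqueFacets_intervalSubgraph (h : IntervalLabelling G n l r)
    (hs : 1 ≤ s) (hst : s ≤ t) (ht : t ≤ n) (P : Set (ℕ × ℕ))
    (h₁ : ∀ p ∈ P, s ≤ p.1 ∧ p.1 ≤ p.2 ∧ p.2 ≤ t ∧ p.2 ≤ r p.1)
    (h₂ : ∀ i, s ≤ i → i ≤ t → ∃ p ∈ P, p.1 ≤ i ∧ (r i ≤ p.2 ∨ p.2 = t))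
    (h₃ : ∀ p ∈ P, ∀ p' ∈ P, p'.1 ≤ p.1 → p.2 ≤ p'.2 → p = p') :
    cliqueFacets (intervalSubgraph G l s t).coe =
      (fun p : ℕ × ℕ => {w | p.1 ≤ l w.1 ∧ l w.1 ≤ p.2}) '' P := by
  apply cliqueFacets_eq
  · rintro _ ⟨p, hp, rfl⟩ x hx y hy hxy
    obtain ⟨h4, h5, h6, h7⟩ := h₁ p hp
    simp only [Set.mem_ofPred_eq] at hx hy
    rw [SimpleGraph.Subgraph.coe_adj, intervalSubgraph_adj]
    refine ⟨x.2, y.2, ?_⟩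
    have hne : l x.1 ≠ l y.1 := fun e => hxy (Subtype.ext (h.inj e))
    rcases lt_or_gt_of_ne hne with hlt | hlt
    · exact h.adj_of_le hlt ((hy.2.trans h7).trans (h.mono _ _ hx.1))
    · exact (h.adj_of_le hlt ((hx.2.trans h7).trans (h.mono _ _ hy.1))).symm
  · intro C hC
    obtain ⟨i, hsi, hit, hi⟩ : ∃ i, s ≤ i ∧ i ≤ t ∧ ∀ w ∈ C, i ≤ l w.1 ∧ l w.1 ≤ r i := by
      by_cases hCe : C.Nonempty
      · obtain ⟨x, hx, hmin⟩ := exists_minimalFor_of_wellFoundedLT (· ∈ C) (fun w => l w.1) hCe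
        have hle : ∀ w ∈ C, l x.1 ≤ l w.1 := fun w hw => by
          by_contra hc
          exact hc (hmin hw (by simp only; omega))
        have hx2 : s ≤ l x.1 ∧ l x.1 ≤ t := x.2
        refine ⟨l x.1, hx2.1, hx2.2, fun w hw => ⟨hle w hw, ?_⟩⟩
        by_cases hwx : w = x
        · rw [hwx]
          exact h.le_r _ (h.le_n _)
        · have h4 := hC hx hw (Ne.symm hwx)
          rw [SimpleGraph.Subgraph.coe_adj, intervalSubgraph_adj] at h4
          have h5 : l x.1 ≠ l w.1 := fun e => h4.2.2.ne (h.inj e)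
          exact h.le_of_adj (lt_of_le_of_ne (hle w hw) h5) h4.2.2
      · exact ⟨s, le_rfl, hst, fun w hw => (hCe ⟨w, hw⟩).elim⟩
    obtain ⟨p, hp, hpi, hpr⟩ := h₂ i hsi hit
    refine ⟨_, ⟨p, hp, rfl⟩, fun w hw => ?_⟩
    have h4 := hi w hw
    have h5 : s ≤ l w.1 ∧ l w.1 ≤ t := w.2
    simp only [Set.mem_ofPred_eq]
    omega
  · rintro _ ⟨p, hp, rfl⟩ _ ⟨p', hp', rfl⟩ hle
    obtain ⟨h4, h5, h6, -⟩ := h₁ p hp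
    obtain ⟨x, hx⟩ := h.surj p.1 (by omega) (by omega)
    obtain ⟨y, hy⟩ := h.surj p.2 (by omega) (by omega)
    have hx' := @hle ⟨x, (by omega : s ≤ l x), (by omega : l x ≤ t)⟩ ⟨hx.ge, by simp only; omega⟩
    have hy' := @hle ⟨y, (by omega : s ≤ l y), (by omega : l y ≤ t)⟩ ⟨by simp only; omega, hy.le⟩
    simp only [Set.mem_ofPred_eq] at hx' hy'
    rw [h₃ p hp p' hp' (by omega) (by omega)]

lemma IntervalLabelling.exists_blockLabelling (h : IntervalLabelling G n l r) (hs : 1 ≤ s)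
    (ht : t ≤ n) :
    ∃ lab : (intervalSubgraph G l s t).verts ≃ Set.Icc 1 (t + 1 - s),
      ∀ w, (lab w : ℕ) + s = l w.1 + 1 := by
  refine ⟨Equiv.ofBijective (fun w => ⟨l w.1 + 1 - s, ?_⟩) ⟨?_, ?_⟩, ?_⟩
  · have : s ≤ l w.1 ∧ l w.1 ≤ t := w.2
    rw [Set.mem_Icc]
    omega
  · intro w w' hww
    have h1 : s ≤ l w.1 ∧ l w.1 ≤ t := w.2
    have h2 : s ≤ l w'.1 ∧ l w'.1 ≤ t := w'.2
    have h3 : l w.1 + 1 - s = l w'.1 + 1 - s := congrArg Subtype.val hww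
    exact Subtype.ext (h.inj (by omega))
  · rintro ⟨i, h1, h2⟩
    obtain ⟨v, hv⟩ := h.surj (i + s - 1) (by omega) (by omega)
    refine ⟨⟨v, (by omega : s ≤ l v), (by omega : l v ≤ t)⟩, Subtype.ext ?_⟩
    simp only
    omega
  · intro w
    have h1 : s ≤ l w.1 ∧ l w.1 ≤ t := w.2
    change l w.1 + 1 - s + s = _
    omega

lemma labelInterval_eq {lab : (intervalSubgraph G l s t).verts ≃ Set.Icc 1 (t + 1 - s)}
    (hlab : ∀ w, (lab w : ℕ) + s = l w.1 + 1) {a b a' b' : ℕ} (ha : a + s = a' + 1)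
    (hb : b + s = b' + 1) : labelInterval lab a b = {w | a' ≤ l w.1 ∧ l w.1 ≤ b'} := by
  ext w
  have := hlab w
  rw [mem_labelInterval, Set.mem_ofPred_eq]
  omega

/-- No edge jumps over the left end of a block. -/
lemma IsBlock.le_of_le_r (h : IntervalLabelling G n l r) (hB : IsBlock r 1 n s t) {j : ℕ}
    (hj : 1 ≤ j) (hsj : s < r j) : s ≤ j := by
  by_contra hc
  have h1 := h.mono j (s - 1) (by omega)
  have h2 := hB.left
  omega

/-- A block without wide ends is a maximal clique. -/
lemma IntervalLabelling.isMaximalCliqueSubgraph (h : IntervalLabelling G n l r)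
    (hB : IsBlock r 1 n s t) (hno : ∀ q, IsWideEnd n r q → ¬ (s < q ∧ q < t)) :
    IsMaximalCliqueSubgraph (intervalSubgraph G l s t) := by
  have h1 := hB.le_left
  have h2 := hB.lt
  have h3 := hB.right_le
  -- Otherwise `r s` is a clique end interior to the block, and the absence of cut vertices makes it
  -- wide.
  have hst : t ≤ r s := by
    by_contra hc
    have h4 := h.lt_r s h1 (by omega)
    exact hno (r s) ⟨⟨s, h1, rfl⟩, by omega, hB.no_cut _ h4 (by omega)⟩ ⟨h4, by omega⟩
  refine ⟨intervalSubgraph_isInduced, ?_, ?_⟩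
  · intro x hx y hy hxy
    rw [mem_intervalSubgraph] at hx hy
    have hne : l x ≠ l y := fun e => hxy (h.inj e)
    rcases lt_or_gt_of_ne hne with hlt | hlt
    · exact h.adj_of_le hlt ((hy.2.trans hst).trans (h.mono _ _ hx.1))
    · exact (h.adj_of_le hlt ((hx.2.trans hst).trans (h.mono _ _ hy.1))).symm
  · intro C hC hle x hx
    obtain ⟨a, ha⟩ := h.surj s (by omega) (by omega)
    obtain ⟨b, hb⟩ := h.surj t (by omega) (by omega)
    have haC : a ∈ C := hle (mem_intervalSubgraph.2 (by omega))
    have hbC : b ∈ C := hle (mem_intervalSubgraph.2 (by omega))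
    rw [mem_intervalSubgraph]
    by_contra hcon
    have hx1 := h.one_le x
    have hxn := h.le_n x
    by_cases hxs : l x < s
    · have h4 := h.le_of_adj (by omega) (hC hx hbC (by rintro rfl; omega))
      have h5 := hB.le_of_le_r h hx1 (by omega)
      omega
    · have h4 := h.le_of_adj (by omega) (hC haC hx (by rintro rfl; omega))
      have h5 := h.mono s (t - 1) (by omega)
      have h6 := hB.right
      rw [ha] at h4
      omega

/-- The first wide end in a block is the end of its first maximal clique. -/
lemma IntervalLabelling.isWideEnd_of_isBlock (h : IntervalLabelling G n l r)
    (hB : IsBlock r 1 n s t) {q : ℕ} (hq : IsWideEnd n r q) (hsq : s < q) (hqt : q < t) :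
    r s < t ∧ s + 2 ≤ r s ∧ IsWideEnd n r (r s) := by
  have h1 := hB.le_left
  have h3 := hB.right_le
  obtain ⟨j, hj, hjq⟩ := hq.1
  have h4 := hB.le_of_le_r h hj (by omega)
  have h5 := h.mono s j h4
  have h6 := h.lt_r s h1 (by omega)
  have h7 : IsWideEnd n r (r s) :=
    ⟨⟨s, h1, rfl⟩, by omega, hB.no_cut _ h6 (by omega)⟩
  refine ⟨by omega, ?_, h7⟩
  by_contra hc
  have h8 : r s - 1 = s := by omega
  have := h7.2.2
  rw [h8] at this
  omega

/-- The block containing a wide end is of one of the exceptional forms. -/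
lemma IntervalLabelling.hasExceptionalForm (h : IntervalLabelling G n l r) (hN : IsNarrow n r)
    (hB : IsBlock r 1 n s t) {q : ℕ} (hq : IsWideEnd n r q) (hsq : s < q) (hqt : q < t) :
    HasExceptionalForm (intervalSubgraph G l s t).coe := by
  obtain ⟨hqt', hsq', hwide⟩ := h.isWideEnd_of_isBlock hB hq hsq hqt
  have h1 := hB.le_left
  have h3 := hB.right_le
  clear hq hsq hqt q
  obtain ⟨q, hq⟩ : ∃ q, r s = q := ⟨_, rfl⟩
  rw [hq] at hqt' hsq' hwide
  have hw := hwide.2.2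
  have hF : r (q - 2) = q := by
    apply le_antisymm
    · have := hN.1 s h1 (by omega)
      rwa [hq] at this
    · have := h.mono s (q - 2) (by omega)
      omega
  obtain ⟨lab, hlab⟩ := h.exists_blockLabelling h1 h3
  -- From the first clique end `q = r s`, the values `r (q - 1)`, `r q`, `r (q + 1)` are followed
  -- until one reaches `t`; stopping at the first, second or third gives the forms (a), (b), (c).
  by_cases hq2 : t ≤ r (q - 1)
  · left
    have he := h.cliqueFacets_intervalSubgraph h1 hB.lt.le h3 {(s, q), (q - 1, t)} ?_ ?_ ?_
    · rw [Set.image_pair] at he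
      refine ⟨_, _, ?_, he, ?_⟩
      · intro heq
        obtain ⟨x, hx⟩ := h.surj s h1 (by omega)
        have hx' : (⟨x, (by omega : s ≤ l x), (by omega : l x ≤ t)⟩ :
          (intervalSubgraph G l s t).verts) ∈ {w | s ≤ l w.1 ∧ l w.1 ≤ q} :=
          ⟨hx.ge, by simp only; omega⟩
        rw [heq] at hx'
        simp only [Set.mem_ofPred_eq] at hx'
        omega
      · obtain ⟨x, hx⟩ := h.surj (q - 1) (by omega) (by omega)
        obtain ⟨y, hy⟩ := h.surj q (by omega) (by omega)
        rw [Set.ncard_eq_two]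
        refine ⟨⟨x, (by omega : s ≤ l x), (by omega : l x ≤ t)⟩,
          ⟨y, (by omega : s ≤ l y), (by omega : l y ≤ t)⟩, ?_, ?_⟩
        · intro e
          have : x = y := congrArg Subtype.val e
          rw [this] at hx
          omega
        · ext ⟨w, hw⟩
          simp only [Set.mem_inter_iff, Set.mem_ofPred_eq, Set.mem_insert_iff,
            Set.mem_singleton_iff, Subtype.ext_iff]
          constructor
          · intro hw'
            by_cases hwq : l w = q
            · exact Or.inr (h.inj (show l w = l y by omega))
            · exact Or.inl (h.inj (show l w = l x by omega))
          · rintro (rfl | rfl) <;> omega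
    · rintro p (rfl | rfl) <;> simp only <;> omega
    · intro i hsi hit
      by_cases hi : i ≤ q - 2
      · have := h.mono _ _ hi
        exact ⟨(s, q), by simp, hsi, Or.inl (by simp only; omega)⟩
      · exact ⟨(q - 1, t), by simp, by simp only; omega, Or.inr rfl⟩
    · rintro p (rfl | rfl) p' (rfl | rfl) <;>
      intro h8 h9 <;> first | rfl | (exfalso; dsimp only at h8 h9; omega)
  have hwide2 : IsWideEnd n r (r (q - 1)) :=
    ⟨⟨q - 1, by omega, rfl⟩, by omega, hB.no_cut _ (by omega) (by omega)⟩
  -- As a wide end it is at most `q + 2`, and the value `q + 2` is excluded by the second clause of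
  -- narrowness.
  have hr1 : r (q - 1) = q + 1 := by
    obtain ⟨h4, h5⟩ := hN.2 q _ hwide hwide2 hw
    omega
  rw [hr1] at hwide2 hq2
  have hw2 : q + 1 < r q := hwide2.2.2
  by_cases hq3 : t ≤ r q
  · right; left
    refine ⟨t + 1 - s, lab, q + 1 - s, by omega, by omega, ?_⟩
    have he := h.cliqueFacets_intervalSubgraph h1 hB.lt.le h3
      {(s, q), (q - 1, q + 1), (q, t)} ?_ ?_ ?_
    · rw [he, Set.image_insert_eq, Set.image_pair, labelInterval_eq hlab (a' := s) (b' := q),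
        labelInterval_eq hlab (a' := q - 1) (b' := q + 1),
        labelInterval_eq hlab (a' := q) (b' := t)] <;> omega
    · rintro p (rfl | rfl | rfl) <;> simp only <;> omega
    · intro i hsi hit
      by_cases hi : i ≤ q - 2
      · have := h.mono _ _ hi
        exact ⟨(s, q), by simp, hsi, Or.inl (by simp only; omega)⟩
      by_cases hi' : i = q - 1
      · subst hi'
        exact ⟨(q - 1, q + 1), by simp, le_rfl, Or.inl hr1.le⟩
      · exact ⟨(q, t), by simp, by simp only; omega, Or.inr rfl⟩
    · rintro p (rfl | rfl | rfl) p' (rfl | rfl | rfl) <;>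
      intro h8 h9 <;> first | rfl | (exfalso; dsimp only at h8 h9; omega)
  have hwide3 : IsWideEnd n r (r q) :=
    ⟨⟨q, by omega, rfl⟩, by omega, hB.no_cut _ (by omega) (by omega)⟩
  have hr2 : r q = q + 2 := by
    obtain ⟨h4, h5⟩ := hN.2 q _ hwide hwide3 (by omega)
    omega
  rw [hr2] at hwide3 hq3
  have hw3 : q + 2 < r (q + 1) := hwide3.2.2
  -- Otherwise there would be a further wide end, at distance at least three from `q`.
  have hq4 : t ≤ r (q + 1) := by
    by_contra hc
    have hwide4 : IsWideEnd n r (r (q + 1)) :=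
      ⟨⟨q + 1, by omega, rfl⟩, by omega, hB.no_cut _ (by omega) (by omega)⟩
    obtain ⟨h4, h5⟩ := hN.2 q _ hwide hwide4 (by omega)
    omega
  right; right
  refine ⟨t + 1 - s, lab, q + 1 - s, by omega, by omega, ?_⟩
  have he := h.cliqueFacets_intervalSubgraph h1 hB.lt.le h3
    {(s, q), (q - 1, q + 1), (q, q + 2), (q + 1, t)} ?_ ?_ ?_
  · rw [he, Set.image_insert_eq, Set.image_insert_eq, Set.image_pair,
      labelInterval_eq hlab (a' := s) (b' := q),
      labelInterval_eq hlab (a' := q - 1) (b' := q + 1),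
      labelInterval_eq hlab (a' := q) (b' := q + 2),
      labelInterval_eq hlab (a' := q + 1) (b' := t)] <;> omega
  · rintro p (rfl | rfl | rfl | rfl) <;> simp only <;> omega
  · intro i hsi hit
    by_cases hi : i ≤ q - 2
    · have := h.mono _ _ hi
      exact ⟨(s, q), by simp, hsi, Or.inl (by simp only; omega)⟩
    by_cases hi' : i = q - 1
    · subst hi'
      exact ⟨(q - 1, q + 1), by simp, le_rfl, Or.inl hr1.le⟩
    by_cases hi'' : i = q
    · subst hi''
      exact ⟨(i, i + 2), by simp, le_rfl, Or.inl hr2.le⟩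
    · exact ⟨(q + 1, t), by simp, by simp only; omega, Or.inr rfl⟩
  · rintro p (rfl | rfl | rfl | rfl) p' (rfl | rfl | rfl | rfl) <;>
      intro h8 h9 <;> first | rfl | (exfalso; dsimp only at h8 h9; omega)

/-- In the narrow case, all wide ends lie in the same block. -/
lemma IsNarrow.mem_block (h : IntervalLabelling G n l r) (hN : IsNarrow n r)
    (hB : IsBlock r 1 n s t) {q q' : ℕ} (hq : IsWideEnd n r q) (hq' : IsWideEnd n r q')
    (hsq : s < q) (hqt : q < t) : s < q' ∧ q' < t := by
  have h1 := hB.left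
  have h2 := hB.right
  obtain ⟨h3, h4⟩ := hq.three_le h
  obtain ⟨h3', h4'⟩ := hq'.three_le h
  have h5 := hq.2
  have h5' := hq'.2
  constructor
  · by_contra hc
    have h6 := (hN.2 q' q hq' hq (by omega)).1
    by_cases hqs : q' = s
    · subst hqs
      omega
    · have h7 := h.mono (q - 2) (s - 1) (by omega)
      omega
  · by_contra hc
    have h6 := (hN.2 q q' hq hq' (by omega)).1
    by_cases hqs : q' = t
    · subst hqs
      omega
    · have h7 := h.mono (q' - 2) (t - 1) (by omega)
      omega

lemma IntervalLabelling.isDiamond (h : IntervalLabelling G n l r)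
    {x y u w : (intervalSubgraph G l s t).verts} (hux : l u.1 < l x.1) (hxy : l x.1 < l y.1)
    (hyw : l y.1 < l w.1) (hy : l y.1 ≤ r (l u.1)) (hw : l w.1 ≤ r (l x.1))
    (hn : r (l u.1) < l w.1) : IsDiamond (intervalSubgraph G l s t).coe x y u w := by
  have key : ∀ a b : (intervalSubgraph G l s t).verts, l a.1 < l b.1 → l b.1 ≤ r (l a.1) →
      (intervalSubgraph G l s t).coe.Adj a b := fun a b hab hr =>
    intervalSubgraph_adj.2 ⟨a.2, b.2, h.adj_of_le hab hr⟩
  have h1 := h.mono _ _ hux.le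
  have h2 := h.mono _ _ hxy.le
  refine ⟨key x y hxy (by omega), key u x hux (by omega), key u y (by omega) hy,
    (key x w (by omega) hw).symm, (key y w hyw (by omega)).symm, ?_, fun hadj => ?_⟩
  · rintro rfl
    omega
  · rw [SimpleGraph.Subgraph.coe_adj, intervalSubgraph_adj] at hadj
    have := h.le_of_adj (by omega) hadj.2.2
    omega

/-- If all wide ends lie in a block of one of the exceptional forms, the labelling is narrow. -/
lemma IntervalLabelling.isNarrow_of_hasExceptionalForm [Finite V] (h : IntervalLabelling G n l r)
    (hB : IsBlock r 1 n s t) (hE : HasExceptionalForm (intervalSubgraph G l s t).coe)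
    (hmem : ∀ q, IsWideEnd n r q → s < q ∧ q < t) : IsNarrow n r := by
  have h1 := hB.le_left
  have h3 := hB.right_le
  have hv : ∀ i, s ≤ i → i ≤ t → ∃ w : (intervalSubgraph G l s t).verts, l w.1 = i := by
    intro i hi hit
    obtain ⟨v, hv⟩ := h.surj i (by omega) (by omega)
    exact ⟨⟨v, (by omega : s ≤ l v), (by omega : l v ≤ t)⟩, hv⟩
  -- An overlap of three vertices yields three diamonds with the same tips on the edges of a
  -- triangle.
  have hF : ∀ j, 1 ≤ j → r j < n → r (r j - 2) ≤ r j := by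
    intro j hj hjn
    by_contra hcon
    have h4 := h.mono (r j - 2) (r j - 1) (by omega)
    obtain ⟨h5, h6⟩ := hmem (r j) ⟨⟨j, hj, rfl⟩, hjn, by omega⟩
    have h7 := hB.le_of_le_r h hj h5
    have h8 : j < r j - 2 := by
      by_contra hc
      have := h.mono (r j - 2) j (by omega)
      omega
    obtain ⟨u, hu⟩ := hv j h7 (by omega)
    obtain ⟨x, hx⟩ := hv (r j - 2) (by omega) (by omega)
    obtain ⟨y, hy⟩ := hv (r j - 1) (by omega) (by omega)
    obtain ⟨z, hz⟩ := hv (r j) (by omega) (by omega)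
    obtain ⟨w, hw⟩ := hv (r j + 1) (by omega) (by omega)
    refine hE.false_of_three (x := x) (y := y) (z := z) (u := u) (w := w)
      (h.isDiamond ?_ ?_ ?_ ?_ ?_ ?_) (h.isDiamond ?_ ?_ ?_ ?_ ?_ ?_)
      (h.isDiamond ?_ ?_ ?_ ?_ ?_ ?_) <;>
      simp only [hu, hx, hy, hz, hw] <;> omega
  -- At a wide end the edge `{q - 1, q}` has tips `q - 2` and `q + 1`, once triple overlaps are
  -- excluded.
  have hD : ∀ q, IsWideEnd n r q → ∃ x y u w : (intervalSubgraph G l s t).verts,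
      l x.1 = q - 1 ∧ l y.1 = q ∧ l u.1 = q - 2 ∧ l w.1 = q + 1 ∧
      IsDiamond (intervalSubgraph G l s t).coe x y u w := by
    intro q hq
    obtain ⟨h4, h5⟩ := hmem q hq
    obtain ⟨h6, h7⟩ := hq.three_le h
    obtain ⟨⟨j, hj, hjq⟩, hqn, hqr⟩ := hq
    have h8 := hB.le_of_le_r h hj (by omega)
    have h9 := hF j hj (by omega)
    have h10 := hB.le_of_le_r h (j := q - 2) (by omega) (by omega)
    rw [hjq] at h9
    obtain ⟨u, hu⟩ := hv (q - 2) (by omega) (by omega)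
    obtain ⟨x, hx⟩ := hv (q - 1) (by omega) (by omega)
    obtain ⟨y, hy⟩ := hv q (by omega) (by omega)
    obtain ⟨w, hw⟩ := hv (q + 1) (by omega) (by omega)
    refine ⟨x, y, u, w, hx, hy, hu, hw, h.isDiamond ?_ ?_ ?_ ?_ ?_ ?_⟩ <;>
      simp only [hu, hx, hy, hw] <;> omega
  refine ⟨hF, fun q q' hq hq' hqq' => ?_⟩
  by_contra hcon
  obtain ⟨x, y, u, w, hx, hy, hu, hw, hd⟩ := hD q hq
  obtain ⟨x', y', u', w', hx', hy', hu', hw', hd'⟩ := hD q' hq'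
  have h4 := (hq.three_le h).1
  have h5 := hq.2.2
  have hne : ∀ {a b : (intervalSubgraph G l s t).verts}, l a.1 ≠ l b.1 → a ≠ b :=
    fun hab e => hab (e ▸ rfl)
  obtain ⟨h6, h7⟩ := hE.of_disjoint hd hd' (hne (by omega)) (hne (by omega)) (hne (by omega))
    (hne (by omega))
  -- At distance at least three, the second edge avoids the tips `q - 2` and `q + 1` of the first
  -- diamond.
  by_cases hq3 : q + 3 ≤ q'
  · rcases h7 with h7 | h7 | h7 | h7 <;>
      exact hne (by omega) h7
  -- Now `q' = q + 2` and `r (q - 1) ≥ q + 2`, so the two edges span a clique, which the forms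
  -- forbid.
  · have h8 := h.mono (q - 1) q (by omega)
    have key : ∀ a b : (intervalSubgraph G l s t).verts, l a.1 < l b.1 → l b.1 ≤ r (l a.1) →
        (intervalSubgraph G l s t).coe.Adj a b := fun a b hab hr =>
      intervalSubgraph_adj.2 ⟨a.2, b.2, h.adj_of_le hab hr⟩
    apply h6
    refine ⟨key _ _ ?_ ?_, key _ _ ?_ ?_, key _ _ ?_ ?_, key _ _ ?_ ?_⟩ <;>
      simp only [hx, hy, hx', hy'] <;> omega

lemma IsMaximalCliqueSubgraph.isClique_univ {H : G.Subgraph} (hH : IsMaximalCliqueSubgraph H) :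
    H.coe.IsClique Set.univ := by
  intro x _ y _ hxy
  exact hH.1 x.2 y.2 (hH.2.1 x.2 y.2 fun e => hxy (Subtype.ext e))

/-- A block containing a wide end is not a clique. -/
lemma IntervalLabelling.not_isMaximalCliqueSubgraph (h : IntervalLabelling G n l r)
    (hB : IsBlock r 1 n s t) {q : ℕ} (hq : IsWideEnd n r q) (hsq : s < q) (hqt : q < t) :
    ¬ IsMaximalCliqueSubgraph (intervalSubgraph G l s t) := by
  intro hmax
  have h1 := hB.le_left
  have h3 := hB.right_le
  obtain ⟨a, ha⟩ := h.surj s h1 (by omega)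
  obtain ⟨b, hb⟩ := h.surj t (by omega) (by omega)
  have hab := hmax.2.1 (mem_intervalSubgraph.2 (by omega)) (mem_intervalSubgraph.2 (by omega))
    (by rintro rfl; omega : a ≠ b)
  have h4 := h.le_of_adj (by omega) hab
  obtain ⟨⟨j, hj, hjq⟩, -⟩ := hq
  have h5 := h.mono s j (hB.le_of_le_r h hj (by omega))
  rw [ha] at h4
  omega

end Blocks

theorem corollary3p5 {V : Type u} [Finite V] (K : Type v) [Field K] (G : SimpleGraph V)
    (hconn : G.Connected) (hclosed : IsClosedGraph G)
    (hnotCM : ¬ IsCohenMacaulayIdeal (binomialEdgeIdeal K G))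
    (L : List G.Subgraph) (hL : IsDecomposition ⊤ L) :
    IsAlmostCohenMacaulayIdeal (binomialEdgeIdeal K G) ↔
      ∃! i : Fin L.length, HasExceptionalForm (L.get i).coe ∧
        ∀ j : Fin L.length, j ≠ i → IsMaximalCliqueSubgraph (L.get j) := by
  obtain ⟨n, l, r, hn, h⟩ := exists_intervalLabelling hconn hclosed
  have hC : ¬ SingleOverlapFrom n r 1 := fun hC => hnotCM (h.isCohenMacaulayIdeal hn hC)
  -- A failure of single overlap at `j` is a wide end at `r j`.
  obtain ⟨q, hq⟩ : ∃ q, IsWideEnd n r q := by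
    by_contra! hno
    refine hC fun j hj hjn => ?_
    by_contra hcon
    exact hno (r j) ⟨⟨j, hj, rfl⟩, hjn, by omega⟩
  have hn2 : 1 < n := by
    have := (hq.three_le h).1
    have := hq.2.1
    omega
  rw [h.isAlmostCohenMacaulayIdeal_iff hn]
  obtain ⟨M, hLM, hM, hcov, hdisj⟩ := h.exists_blocks hL 1 n h.intervalSubgraph_eq_top.symm le_rfl
    hn2 le_rfl
  subst hLM
  have hlen : ∀ i : Fin (M.map fun p => intervalSubgraph G l p.1 p.2).length, i.1 < M.length :=
    fun i => by simpa using i.2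
  have hget : ∀ i : Fin (M.map fun p => intervalSubgraph G l p.1 p.2).length,
      (M.map fun p => intervalSubgraph G l p.1 p.2).get i =
        intervalSubgraph G l (M[i.1]'(hlen i)).1 (M[i.1]'(hlen i)).2 := fun i => by simp
  have hblock : ∀ i : Fin (M.map fun p => intervalSubgraph G l p.1 p.2).length,
      IsBlock r 1 n (M[i.1]'(hlen i)).1 (M[i.1]'(hlen i)).2 := fun i => hM _ (List.getElem_mem _)
  -- Blocks cover `[1, n)` by half-open intervals. A wide end is not a cut vertex, so it cannot be
  -- the left end of its block.
  have hwide : ∀ q, IsWideEnd n r q →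
      ∃ i : Fin (M.map fun p => intervalSubgraph G l p.1 p.2).length,
        (M[i.1]'(hlen i)).1 < q ∧ q < (M[i.1]'(hlen i)).2 := by
    intro q hq
    have h3 := (hq.three_le h).1
    obtain ⟨p, hp, hpq, hqp⟩ := hcov q (by omega) hq.2.1
    obtain ⟨i, hi, rfl⟩ := List.getElem_of_mem hp
    refine ⟨⟨i, by simpa using hi⟩, lt_of_le_of_ne hpq ?_, hqp⟩
    intro e
    have h4 := (hM _ hp).left
    have h5 := hq.2.2
    rw [e] at h4
    omega
  have hdisj' : ∀ i j : Fin (M.map fun p => intervalSubgraph G l p.1 p.2).length, i ≠ j →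
      (M[i.1]'(hlen i)).2 ≤ (M[j.1]'(hlen j)).1 ∨ (M[j.1]'(hlen j)).2 ≤ (M[i.1]'(hlen i)).1 := by
    intro i j hij
    rw [List.pairwise_iff_getElem] at hdisj
    rcases lt_or_gt_of_ne (fun e => hij (Fin.ext e) : i.1 ≠ j.1) with hlt | hlt
    · exact hdisj i.1 j.1 (hlen i) (hlen j) hlt
    · exact (hdisj j.1 i.1 (hlen j) (hlen i) hlt).symm
  constructor
  · intro hN
    obtain ⟨i, hi, hi'⟩ := hwide q hq
    have hform := h.hasExceptionalForm hN (hblock i) hq hi hi'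
    rw [← hget] at hform
    refine ⟨i, ⟨hform, fun j hj => ?_⟩, fun i' hi' => ?_⟩
    · rw [hget]
      refine h.isMaximalCliqueSubgraph (hblock j) fun q' hq' hmem => ?_
      have h1 := hN.mem_block h (hblock i) hq hq' hi hi'
      have h2 := hdisj' j i hj
      omega
    · by_contra hne
      exact hform.not_isClique_univ (hi'.2 i (Ne.symm hne)).isClique_univ
  · rintro ⟨i, ⟨hform, hmax⟩, -⟩
    rw [hget] at hform
    -- The other blocks are cliques and contain no wide end, so all wide ends lie in the exceptional
    -- block.
    refine h.isNarrow_of_hasExceptionalForm (hblock i) hform fun q' hq' => ?_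
    obtain ⟨j, hj, hj'⟩ := hwide q' hq'
    by_cases hji : j = i
    · rw [← hji]
      exact ⟨hj, hj'⟩
    · have := hmax j hji
      rw [hget] at this
      exact (h.not_isMaximalCliqueSubgraph (hblock j) hq' hj hj' this).elim
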